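/- **Setting.** Fix finitely many program variables $\mathsf V$ and finitely many function symbols $\mathcal F$, each of positive arity, and a countably infinite set of constants $\mathcal C$ that contains an initial constant $v_0$ for each variable $\mathsf v$. Uninterpreted programs (UPs) are built from $\mathbf{skip}$, $\mathsf x\gets \mathsf y$, $\mathsf x\gets f(\vec{\mathsf y})$, $\mathbf{assume}(c)$, sequencing, if-then-else and while, with conditions $c$ of the form $\mathsf x=\mathsf y$ or $\mathsf x\neq \mathsf y$. A configuration is a triple $\langle s,q,pc\rangle$ of a statement $s$, a state $q:\mathsf V\to\mathcal C$ and a path condition $pc$, a set (conjunction) of EUF literals $t\approx t'$, $t\not\approx t'$. The transition system $\mathcal S_P$ of $P$ is given by the usual small-step symbolic semantics from $\langle P,q_0,\top\rangle$, $q_0(\mathsf v)=v_0$: an assume adds its literal to $pc$ if the result is satisfiable, and an assignment $\mathsf x\gets e$ maps $\mathsf x$ to a constant $x'$ occurring neither in $pc$ nor in $q$ and adds $x'\approx q(e)$ to $pc$. A configuration is labelled by its location $s$. $P$ is *coherent* (a CUP) if every reachable configuration $\langle s,q,pc\rangle$ satisfies: * if the next statement to be executed is $\mathsf x\gets f(\vec{\mathsf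 y})$, then every term $t$ of $pc$ with $pc\models t\approx f(q(\vec{\mathsf y}))$ satisfies $pc\models q(\mathsf v)\approx t$ for some $\mathsf v\in\mathsf V$; * if it is $\mathbf{assume}(\mathsf x=\mathsf y)$, then every term $t$ of $pc$ with $pc\models t\approx s'$ for some term $s'$ containing $q(\mathsf x)$ or $q(\mathsf y)$ satisfies $pc\models q(\mathsf v)\approx t$ for some $\mathsf v\in\mathsf V$. **The abstraction.** Below, $\vdash$ is the EUF proof system that derives literals (reflexivity, symmetry, transitivity, congruence, replacement of equals in a literal), without hypothetical reasoning. A *$V$-basis* of a set $\Gamma$ of literals is a triple $\langle W,\beta,\delta\rangle$ such that: * $W$ is a set of constants disjoint from $V$ and from the constants of $\Gamma$, and $(\exists W.\ \beta\wedge\delta)\equiv\Gamma$; * $\beta$ consists of literals $u\approx v$ and $u\not\approx v$ with $u,v\in V$, and $v\approx f(\vec a)$ with $v\in V$, $\vec a\subseteq V\cup W$, $\vec a\cap V\ne\emptyset$; * $\delta$ consists of literals $w\approx u$ with $w\in V\cup W$ and $u\notin V\cup W$ a constant; $u\not\approx w$ with $u\in W$, $w\in V\cup W$; and $v\approx f(\vec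 a)$ with $v,\vec a\in V\cup W$ and $\vec a\subseteq W$ if $v\in V$; * $\beta\wedge\delta$ derives no equality between a constant of $V$ and one of $W$, or between distinct constants of $W$; * $\Gamma$ and $\beta$ derive the same literals $u\approx v$ and the same literals $u\not\approx v$ with $u,v\in V$; * each $w\in W$ satisfies $\beta\wedge\delta\vdash w\approx t$ for some term $t$ of $\Gamma$. *Normalization* $n_V(\beta)$: keep the literals over $V$. Two literals $v\approx f(\vec a)$, $v'\approx f(\vec a')$ of $\beta$ that contain constants outside $V$ have the same *template* if $\vec a,\vec a'$ have their constants outside $V$ at the same positions and agree there. A *context* $Z$ is the set of all literals of $\beta$ with a given template, with constants outside $V$ replaced by a hole "?". Fix for each possible context $Z$ a constant $w_Z\notin V$, injectively in $Z$. For each context $Z$, add to $n_V(\beta)$ all literals of $Z$ with every hole filled by $w_Z$. A *base–renaming–normalization abstraction* of $P$ is a map $\alpha$ that is computed on every reachable configuration $\langle s,q,pc\rangle$ as follows: take any $q(\mathsf V)$-basis $\langle W,\beta,\delta\rangle$ of $pc$; form $n_{q(\mathsf V)}(\beta)$; rename each $q(\mathsf v)$ to $v_0$ (moving other constants that equal initial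 constants to fresh ones); apply $n_{\mathcal C_0}$, where $\mathcal C_0=\{v_0\mid \mathsf v\in\mathsf V\}$, to obtain $pc'$; put $\alpha(\langle s,q,pc\rangle)=\langle s,q_0,pc'\rangle$. The abstract transition system $\alpha(\mathcal S_P)$ has initial state $\alpha(\langle P,q_0,\top\rangle)$ and the transitions $\alpha(c)\to\alpha(c')$ for $c\to c'$ with $c$ reachable in $\mathcal S_P$. **Theorem.** 1. For every CUP $P$ and every base–renaming–normalization abstraction $\alpha$ of $P$, the system $\alpha(\mathcal S_P)$ has finitely many reachable states, and there is a location-preserving bisimulation from $\mathcal S_P$ to $\alpha(\mathcal S_P)$ that relates the initial states and relates every reachable $c$ to $\alpha(c)$. 2. $\alpha(\mathcal S_P)$ is computable: there is a map $\alpha$ that is a base–renaming–normalization abstraction of every CUP, and an algorithm that, given any CUP $P$, outputs the finite system of reachable states of $\alpha(\mathcal S_P)$, i.e. the list of its states (location and path condition), its initial state and its transitions. 3. Let $(\Phi_k)_{k\in\mathbb N}$ be properties of location-labelled transition systems that are invariant under label-preserving bisimulation, and suppose that $\Phi_k(T)$ is decidable, given $k$ and a finite transition system $T$. Then there is an algorithm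 that, given any CUP $P$ and any $k$, halts and decides $\Phi_k(\mathcal S_P)$. 4. In particular, temporal-logic model checking of CUPs is decidable: there is an algorithm that, given any CUP $P$ and any formula $\varphi$ of the modal $\mu$-calculus whose atomic propositions are locations, halts and decides whether $\mathcal S_P\models\varphi$. -/

import Mathlib

/-- A signature: finitely many program variables and finitely many function symbols, each of
positive arity.  The constants of the logic are the natural numbers. -/
structure UP.Sig where
  vars : ℕ
  funs : ℕ
  arity : Fin funs → ℕ
  arity_pos : ∀ f, 0 < arity f

namespace UP

/-! ### Equality with uninterpreted functions -/

inductive Term (S : Sig) : Type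
  | const (c : ℕ) : Term S
  | app (f : Fin S.funs) (ts : Fin (S.arity f) → Term S) : Term S

/-- Literals `s ≈ t` and `s ≉ t`. -/
inductive Lit (S : Sig) : Type
  | eq (s t : Term S) : Lit S
  | ne (s t : Term S) : Lit S

namespace Term

variable {S : Sig}

/-- All subterms of a term, including the term itself. -/
def subterms : Term S → Set (Term S)
  | const c => {const c}
  | app f ts => {app f ts} ∪ ⋃ i, subterms (ts i)

/-- Renaming of constants. -/
def map (σ : ℕ → ℕ) : Term S → Term S
  | const c => const (σ c)
  | app f ts => app f (fun i => map σ (ts i))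

/-- Goedel number of a term. -/
def code : Term S → ℕ
  | const c => Nat.pair 0 c
  | app f ts => Nat.pair 1 (Encodable.encode (f.val, List.ofFn (fun i => code (ts i))))

end Term

namespace Lit

variable {S : Sig}

def terms : Lit S → Set (Term S)
  | eq s t => s.subterms ∪ t.subterms
  | ne s t => s.subterms ∪ t.subterms

def consts (l : Lit S) : Set ℕ := {c | Term.const c ∈ l.terms}

def map (σ : ℕ → ℕ) : Lit S → Lit S
  | eq s t => eq (s.map σ) (t.map σ)
  | ne s t => ne (s.map σ) (t.map σ)

def code : Lit S → ℕ
  | eq s t => Nat.pair 0 (Nat.pair s.code t.code)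
  | ne s t => Nat.pair 1 (Nat.pair s.code t.code)

/-- The literal `v ≈ f(a)` whose arguments are constants. -/
def flat (v : ℕ) (f : Fin S.funs) (a : Fin (S.arity f) → ℕ) : Lit S :=
  eq (Term.const v) (Term.app f (fun i => Term.const (a i)))

end Lit

/-- The set of all (sub)terms in a set of literals. -/
def termsOf {S : Sig} (Γ : Set (Lit S)) : Set (Term S) := {t | ∃ l ∈ Γ, t ∈ l.terms}

/-- The set of all constants in a set of literals. -/
def constsOf {S : Sig} (Γ : Set (Lit S)) : Set ℕ := {c | ∃ l ∈ Γ, c ∈ l.consts}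

/-- First-order structures; equality is interpreted as equality. -/
structure Interp (S : Sig) where
  U : Type
  con : ℕ → U
  fn : (f : Fin S.funs) → (Fin (S.arity f) → U) → U

namespace Interp

variable {S : Sig}

def eval (M : Interp S) : Term S → M.U
  | Term.const c => M.con c
  | Term.app f ts => M.fn f (fun i => M.eval (ts i))

def Sat (M : Interp S) : Lit S → Prop
  | Lit.eq s t => M.eval s = M.eval t
  | Lit.ne s t => M.eval s ≠ M.eval t

/-- `M` is a model of (the conjunction of) `Γ`. -/
def Models (M : Interp S) (Γ : Set (Lit S)) : Prop := ∀ l ∈ Γ, M.Sat l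

/-- The structure `M` with another interpretation of the constants. -/
def withCon (M : Interp S) (con' : ℕ → M.U) : Interp S := ⟨M.U, con', M.fn⟩

end Interp

def Satisfiable {S : Sig} (Γ : Set (Lit S)) : Prop := ∃ M : Interp S, M.Models Γ

/-- `Γ ⊨ l`. -/
def Entails {S : Sig} (Γ : Set (Lit S)) (l : Lit S) : Prop :=
  ∀ M : Interp S, M.Models Γ → M.Sat l

/-- `Γ ⊢ l`: the usual proof system of equality with uninterpreted functions, which derives
literals (there is no hypothetical reasoning). -/
inductive Derives {S : Sig} (Γ : Set (Lit S)) : Lit S → Prop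
  | ax {l : Lit S} : l ∈ Γ → Derives Γ l
  | refl (t : Term S) : Derives Γ (Lit.eq t t)
  | symm {s t : Term S} : Derives Γ (Lit.eq s t) → Derives Γ (Lit.eq t s)
  | trans {s t u : Term S} :
      Derives Γ (Lit.eq s t) → Derives Γ (Lit.eq t u) → Derives Γ (Lit.eq s u)
  | cong {f : Fin S.funs} {ss ts : Fin (S.arity f) → Term S} :
      (∀ i, Derives Γ (Lit.eq (ss i) (ts i))) → Derives Γ (Lit.eq (Term.app f ss) (Term.app f ts))
  | ne_symm {s t : Term S} : Derives Γ (Lit.ne s t) → Derives Γ (Lit.ne t s)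
  | pmod {s s' t : Term S} :
      Derives Γ (Lit.ne s t) → Derives Γ (Lit.eq s s') → Derives Γ (Lit.ne s' t)

/-! ### Uninterpreted programs -/

/-- The condition `x = y` (`pos = true`) or `x ≠ y` (`pos = false`). -/
structure Cond (S : Sig) where
  pos : Bool
  lhs : Fin S.vars
  rhs : Fin S.vars

def Cond.neg {S : Sig} (b : Cond S) : Cond S := ⟨!b.pos, b.lhs, b.rhs⟩

def Cond.code {S : Sig} (b : Cond S) : ℕ := Encodable.encode (b.pos, b.lhs.val, b.rhs.val)

inductive Stmt (S : Sig) : Type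
  | skip : Stmt S
  | copy (x y : Fin S.vars) : Stmt S
  | assign (x : Fin S.vars) (f : Fin S.funs) (ys : Fin (S.arity f) → Fin S.vars) : Stmt S
  | assume (b : Cond S) : Stmt S
  | seq (s₁ s₂ : Stmt S) : Stmt S
  | ite (b : Cond S) (s₁ s₂ : Stmt S) : Stmt S
  | loop (b : Cond S) (s : Stmt S) : Stmt S

/-- Goedel number of a program. -/
def Stmt.code {S : Sig} : Stmt S → ℕ
  | skip => Nat.pair 0 0
  | copy x y => Nat.pair 1 (Nat.pair x.val y.val)
  | assign x f ys =>
      Nat.pair 2 (Encodable.encode (x.val, f.val, List.ofFn (fun i => (ys i).val)))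
  | assume b => Nat.pair 3 b.code
  | seq s₁ s₂ => Nat.pair 4 (Nat.pair s₁.code s₂.code)
  | ite b s₁ s₂ => Nat.pair 5 (Nat.pair b.code (Nat.pair s₁.code s₂.code))
  | loop b s => Nat.pair 6 (Nat.pair b.code s.code)

/-- The statement that is executed next. -/
def Stmt.head {S : Sig} : Stmt S → Stmt S
  | seq s₁ _ => s₁.head
  | s => s

/-- Configurations `⟨s, q, pc⟩`; the path condition is a conjunction (set) of literals. -/
@[ext] structure Config (S : Sig) where
  stmt : Stmt S
  state : Fin S.vars → ℕ
  pc : Set (Lit S)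

/-- The initial state: variable `v` holds its initial constant `v₀`, the number `v`. -/
def initState (S : Sig) : Fin S.vars → ℕ := fun v => v.val

/-- The value of a condition in a state. -/
def Cond.value {S : Sig} (b : Cond S) (q : Fin S.vars → ℕ) : Lit S :=
  if b.pos then Lit.eq (Term.const (q b.lhs)) (Term.const (q b.rhs))
  else Lit.ne (Term.const (q b.lhs)) (Term.const (q b.rhs))

/-- The term `f(q(y₁), …, q(yₖ))`. -/
def appValue {S : Sig} (q : Fin S.vars → ℕ) (f : Fin S.funs)
    (ys : Fin (S.arity f) → Fin S.vars) : Term S :=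
  Term.app f (fun i => Term.const (q (ys i)))

/-- Small-step symbolic semantics.  The constant introduced by an assignment is fresh for the
configuration. -/
inductive Step {S : Sig} : Config S → Config S → Prop
  | skip_seq (s q pc) : Step ⟨Stmt.seq Stmt.skip s, q, pc⟩ ⟨s, q, pc⟩
  | seq {s₁ q pc s₁' q' pc'} (s₂ : Stmt S) :
      Step ⟨s₁, q, pc⟩ ⟨s₁', q', pc'⟩ → Step ⟨Stmt.seq s₁ s₂, q, pc⟩ ⟨Stmt.seq s₁' s₂, q', pc'⟩
  | assume (b : Cond S) (q pc) : Satisfiable (insert (b.value q) pc) →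
      Step ⟨Stmt.assume b, q, pc⟩ ⟨Stmt.skip, q, insert (b.value q) pc⟩
  | copy (x y : Fin S.vars) (q pc) (x' : ℕ) : x' ∉ constsOf pc → x' ∉ Set.range q →
      Step ⟨Stmt.copy x y, q, pc⟩ ⟨Stmt.skip, Function.update q x x',
        insert (Lit.eq (Term.const x') (Term.const (q y))) pc⟩
  | assign (x : Fin S.vars) (f : Fin S.funs) (ys : Fin (S.arity f) → Fin S.vars) (q pc) (x' : ℕ) :
      x' ∉ constsOf pc → x' ∉ Set.range q →
      Step ⟨Stmt.assign x f ys, q, pc⟩ ⟨Stmt.skip, Function.update q x x',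
        insert (Lit.eq (Term.const x') (appValue q f ys)) pc⟩
  | ite_true (b : Cond S) (s₁ s₂ q pc) :
      Step ⟨Stmt.ite b s₁ s₂, q, pc⟩ ⟨Stmt.seq (Stmt.assume b) s₁, q, pc⟩
  | ite_false (b : Cond S) (s₁ s₂ q pc) :
      Step ⟨Stmt.ite b s₁ s₂, q, pc⟩ ⟨Stmt.seq (Stmt.assume b.neg) s₂, q, pc⟩
  | loop (b : Cond S) (s q pc) :
      Step ⟨Stmt.loop b s, q, pc⟩ ⟨Stmt.ite b (Stmt.seq s (Stmt.loop b s)) Stmt.skip, q, pc⟩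

/-! ### Transition systems -/

/-- Transition systems with an initial state, whose states are labelled by numbers. -/
structure TS where
  State : Type
  init : State
  step : State → State → Prop
  label : State → ℕ

def TS.Reachable (T : TS) (c : T.State) : Prop := Relation.ReflTransGen T.step T.init c

/-- `ρ` is a label-preserving bisimulation that relates the initial states. -/
structure IsBisimulation (T T' : TS) (ρ : T.State → T'.State → Prop) : Prop where
  init : ρ T.init T'.init
  label : ∀ c d, ρ c d → T.label c = T'.label d
  forth : ∀ c d, ρ c d → ∀ c', T.step c c' → ∃ d', T'.step d d' ∧ ρ c' d'
  back : ∀ c d, ρ c d → ∀ d', T'.step d d' → ∃ c', T.step c c' ∧ ρ c' d'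

def Bisimilar (T T' : TS) : Prop := ∃ ρ : T.State → T'.State → Prop, IsBisimulation T T' ρ

/-- The transition system of a program.  A configuration is labelled by its location, that is, by
the statement that remains to be executed. -/
def progTS {S : Sig} (P : Stmt S) : TS where
  State := Config S
  init := ⟨P, initState S, ∅⟩
  step := Step
  label c := c.stmt.code

/-- The abstract transition system that an abstraction function `α`, regarded as a partial
function defined on the reachable configurations of `P`, induces on the program `P`. -/
def absTS {S : Sig} (P : Stmt S) (α : Config S → Config S) : TS where
  State := Config S
  init := α ⟨P, initState S, ∅⟩
  step a a' := ∃ c c' : Config S,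
    (progTS P).Reachable c ∧ Step c c' ∧ a = α c ∧ a' = α c'
  label a := a.stmt.code

/-- `pc ⊨ q(v) ≈ t` for some program variable `v`. -/
def Config.Stored {S : Sig} (c : Config S) (t : Term S) : Prop :=
  ∃ v, Entails c.pc (Lit.eq (Term.const (c.state v)) t)

def Config.Memoizing {S : Sig} (c : Config S) : Prop :=
  ∀ (x : Fin S.vars) (f : Fin S.funs) (ys : Fin (S.arity f) → Fin S.vars),
    c.stmt.head = Stmt.assign x f ys →
    ∀ t ∈ termsOf c.pc, Entails c.pc (Lit.eq t (appValue c.state f ys)) → c.Stored t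

def Config.EarlyAssume {S : Sig} (c : Config S) : Prop :=
  ∀ x y : Fin S.vars, c.stmt.head = Stmt.assume ⟨true, x, y⟩ →
    ∀ t ∈ termsOf c.pc, ∀ s : Term S,
      (Term.const (c.state x) ∈ s.subterms ∨ Term.const (c.state y) ∈ s.subterms) →
      Entails c.pc (Lit.eq t s) → c.Stored t

/-- Coherent uninterpreted programs. -/
def Coherent {S : Sig} (P : Stmt S) : Prop :=
  ∀ c : Config S, (progTS P).Reachable c → c.Memoizing ∧ c.EarlyAssume

/-! ### Base abstraction -/

/-- `⟨W, β, δ⟩` is a `V`-basis of `Γ`. -/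
structure IsBasis {S : Sig} (Γ : Set (Lit S)) (V W : Set ℕ) (β δ : Set (Lit S)) : Prop where
  /-- `W` consists of fresh constants. -/
  fresh : Disjoint W (constsOf Γ ∪ V)
  /-- `(∃ W, β ∧ δ) ≡ Γ`. -/
  equiv : ∀ M : Interp S, M.Models Γ ↔
    ∃ con' : ℕ → M.U, (∀ c, c ∉ W → con' c = M.con c) ∧ (M.withCon con').Models (β ∪ δ)
  shape_base : ∀ l ∈ β,
    (∃ u v, u ∈ V ∧ v ∈ V ∧ l = Lit.eq (Term.const u) (Term.const v)) ∨
    (∃ u v, u ∈ V ∧ v ∈ V ∧ l = Lit.ne (Term.const u) (Term.const v)) ∨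
    (∃ v f a, v ∈ V ∧ (∀ i, a i ∈ V ∪ W) ∧ (∃ i, a i ∈ V) ∧ l = Lit.flat v f a)
  shape_rest : ∀ l ∈ δ,
    (∃ w u, w ∈ V ∪ W ∧ u ∉ V ∪ W ∧ l = Lit.eq (Term.const w) (Term.const u)) ∨
    (∃ u w, u ∈ W ∧ w ∈ W ∪ V ∧ l = Lit.ne (Term.const u) (Term.const w)) ∨
    (∃ v f a, v ∈ V ∪ W ∧ (∀ i, a i ∈ V ∪ W) ∧ (v ∈ V → ∀ i, a i ∈ W) ∧ l = Lit.flat v f a)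
  sep_base : ∀ v ∈ V, ∀ w ∈ W, ¬ Derives (β ∪ δ) (Lit.eq (Term.const v) (Term.const w))
  sep_fresh : ∀ w₁ ∈ W, ∀ w₂ ∈ W, w₁ ≠ w₂ →
    ¬ Derives (β ∪ δ) (Lit.eq (Term.const w₁) (Term.const w₂))
  /-- `β` has the same equalities and disequalities between constants of `V` as `Γ`. -/
  eq_iff : ∀ u ∈ V, ∀ v ∈ V, Derives Γ (Lit.eq (Term.const u) (Term.const v)) ↔
    Derives β (Lit.eq (Term.const u) (Term.const v))
  ne_iff : ∀ u ∈ V, ∀ v ∈ V, Derives Γ (Lit.ne (Term.const u) (Term.const v)) ↔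
    Derives β (Lit.ne (Term.const u) (Term.const v))
  /-- Every constant of `W` represents the class of a term of `Γ`. -/
  represents : ∀ w ∈ W, ∃ t ∈ termsOf Γ, Derives (β ∪ δ) (Lit.eq (Term.const w) t)

/-! ### Normalization -/

/-- The literals `v ≈ f(a)` in which some arguments are holes (`none`). -/
structure Holed (S : Sig) where
  val : ℕ
  fn : Fin S.funs
  args : Fin (S.arity fn) → Option ℕ

def Holed.code {S : Sig} (z : Holed S) : ℕ :=
  Encodable.encode (z.val, z.fn.val, List.ofFn z.args)

open scoped Classical in
/-- The template of an argument tuple: constants of `V` become holes. -/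
noncomputable def template {k : ℕ} (V : Set ℕ) (a : Fin k → ℕ) : Fin k → Option ℕ :=
  fun i => if a i ∈ V then none else some (a i)

open scoped Classical in
/-- The literal `v ≈ f(a)` with all constants outside `V` replaced by holes. -/
noncomputable def dig {S : Sig} (V : Set ℕ) (v : ℕ) (f : Fin S.funs)
    (a : Fin (S.arity f) → ℕ) : Holed S :=
  ⟨v, f, fun i => if a i ∈ V then some (a i) else none⟩

/-- The context, in `L`, of the template of `f(a)`. -/
def context {S : Sig} (V : Set ℕ) (L : Set (Lit S)) (f : Fin S.funs)
    (a : Fin (S.arity f) → ℕ) : Set (Holed S) :=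
  {z | ∃ v b, Lit.flat v f b ∈ L ∧ template V b = template V a ∧ z = dig V v f b}

/-- All contexts of terms `f(a)` in `L` with some argument outside `V`. -/
def contexts {S : Sig} (V : Set ℕ) (L : Set (Lit S)) : Set (Set (Holed S)) :=
  {Z | ∃ v f a, Lit.flat v f a ∈ L ∧ (∃ i, a i ∉ V) ∧ Z = context V L f a}

/-- The canonical constant for a context: outside `V` if `V` is finite, and injective in the
(finite) context. -/
noncomputable def ctxConst {S : Sig} (V : Set ℕ) (Z : Set (Holed S)) : ℕ :=
  sSup V + 1 + ∑ᶠ z ∈ Z, 2 ^ z.code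

open scoped Classical in
/-- The normalization function: constants outside `V` are replaced by those of the contexts. -/
noncomputable def normalize {S : Sig} (V : Set ℕ) (L : Set (Lit S)) : Set (Lit S) :=
  {l ∈ L | l.consts ⊆ V} ∪
  {l | ∃ Z ∈ contexts V L, ∃ v f a, Lit.flat v f a ∈ L ∧ dig V v f a ∈ Z ∧
    l = Lit.flat v f (fun i => if a i ∈ V then a i else ctxConst V Z)}

/-! ### The composed abstraction -/

/-- `σ` renames the constant `q(v)` to the initial constant `v₀`, for all variables `v`, and the
other constants of `Γ` apart from these, moving only those that are initial constants. -/
structure IsInitRenaming {S : Sig} (q : Fin S.vars → ℕ) (Γ : Set (Lit S)) (σ : ℕ → ℕ) : Prop where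
  inj : Set.InjOn σ (constsOf Γ ∪ Set.range q)
  init : ∀ v, σ (q v) = initState S v
  stay : ∀ c ∈ constsOf Γ, c ∉ Set.range q → c ∉ Set.range (initState S) → σ c = c

/-- `a` is a result of the composed abstraction at `c`: take any basis of the path condition
relative to the constants of the state, normalize, rename, and normalize again. -/
def AbstractsTo {S : Sig} (c a : Config S) : Prop :=
  ∃ (W : Set ℕ) (β δ : Set (Lit S)) (σ : ℕ → ℕ),
    IsBasis c.pc (Set.range c.state) W β δ ∧
    IsInitRenaming c.state (normalize (Set.range c.state) β) σ ∧
    a = ⟨c.stmt, initState S, normalize (Set.range (initState S))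
      (Lit.map σ '' normalize (Set.range c.state) β)⟩

/-- `α` is a version of the composed base, renaming and normalization abstraction on the reachable
configurations of `P`. -/
def IsAbstraction {S : Sig} (P : Stmt S) (α : Config S → Config S) : Prop :=
  ∀ c : Config S, (progTS P).Reachable c → AbstractsTo c (α c)

/-! ### Finite transition systems as finite data -/

/-- A finite transition system with labels in `L`: the list of the labels of the states
`0, 1, …`, the initial state, and the list of the transitions. -/
abbrev FinTS (L : Type) : Type := List L × ℕ × List (ℕ × ℕ)

/-- The transition system described by a list of labels, an initial state and a list of
transitions. -/
def finTS (D : FinTS ℕ) : TS where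
  State := ℕ
  init := D.2.1
  step i j := (i, j) ∈ D.2.2
  label i := D.1.getD i 0

/-- A configuration with the initial state is described by the number of its statement and a list
of the numbers of the literals of its path condition. -/
def Config.HasCode {S : Sig} (c : Config S) (k : ℕ × List ℕ) : Prop :=
  c.state = initState S ∧ k.1 = c.stmt.code ∧ ∀ r, r ∈ k.2 ↔ ∃ l ∈ c.pc, l.code = r

/-- The finite data `D` list the reachable states of the abstract system, without repetition, its
initial state and its transitions. -/
def Lists {S : Sig} (D : FinTS (ℕ × List ℕ)) (P : Stmt S) (α : Config S → Config S) : Prop :=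
  ∃ e : Fin D.1.length ≃ {a : Config S // (absTS P α).Reachable a},
    (∀ i, (e i).1.HasCode (D.1.get i)) ∧
    (∃ i, i.val = D.2.1 ∧ (e i).1 = (absTS P α).init) ∧
    (∀ k ∈ D.2.2, k.1 < D.1.length ∧ k.2 < D.1.length) ∧
    ∀ i j, (i.val, j.val) ∈ D.2.2 ↔ (absTS P α).step (e i).1 (e j).1

/-! ### Temporal logic: the modal mu-calculus -/

/-- Formulas in positive normal form, with de Bruijn indices for the fixed-point variables. -/
inductive Mu : Type
  | atom (k : ℕ) : Mu
  | natom (k : ℕ) : Mu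
  | var (i : ℕ) : Mu
  | and (φ ψ : Mu) : Mu
  | or (φ ψ : Mu) : Mu
  | dia (φ : Mu) : Mu
  | box (φ : Mu) : Mu
  | mu (φ : Mu) : Mu
  | nu (φ : Mu) : Mu

def Mu.code : Mu → ℕ
  | atom k => Nat.pair 0 k
  | natom k => Nat.pair 1 k
  | var i => Nat.pair 2 i
  | and φ ψ => Nat.pair 3 (Nat.pair φ.code ψ.code)
  | or φ ψ => Nat.pair 4 (Nat.pair φ.code ψ.code)
  | dia φ => Nat.pair 5 φ.code
  | box φ => Nat.pair 6 φ.code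
  | mu φ => Nat.pair 7 φ.code
  | nu φ => Nat.pair 8 φ.code

/-- Extend an environment by a new variable `0`. -/
def push {X : Type} (A : Set X) (e : ℕ → Set X) : ℕ → Set X
  | 0 => A
  | i + 1 => e i

/-- The set of states that satisfy a formula. -/
def Mu.sem (T : TS) : Mu → (ℕ → Set T.State) → Set T.State
  | atom k, _ => {c | T.label c = k}
  | natom k, _ => {c | T.label c ≠ k}
  | var i, e => e i
  | and φ ψ, e => φ.sem T e ∩ ψ.sem T e
  | or φ ψ, e => φ.sem T e ∪ ψ.sem T e
  | dia φ, e => {c | ∃ c', T.step c c' ∧ c' ∈ φ.sem T e}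
  | box φ, e => {c | ∀ c', T.step c c' → c' ∈ φ.sem T e}
  | mu φ, e => ⋂₀ {A | φ.sem T (push A e) ⊆ A}
  | nu φ, e => ⋃₀ {A | A ⊆ φ.sem T (push A e)}

/-- `T ⊨ φ`; free variables denote the empty set. -/
def TS.Satisfies (T : TS) (φ : Mu) : Prop := T.init ∈ φ.sem T (fun _ => ∅)

/-- The partial recursive function `g` decides the property `Q` of a coherent program and a
number: it halts on all coherent programs, with the right answer. -/
def DecidesCoherent (S : Sig) (g : ℕ × ℕ →. Bool) (Q : Stmt S → ℕ → Prop) : Prop :=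
  Partrec g ∧ ∀ P : Stmt S, Coherent P → ∀ k : ℕ, ∃ b ∈ g (P.code, k), (b = true ↔ Q P k)

end UP

/-! Only a finite part of a path condition matters for the future of a coherent program. For a
family of terms (the current values of the variables), `keyOf` records which members are derivably
equal, which are derivably unequal, and the contexts: for each set of hole positions that is not the
set of all positions, and each choice of unstored parameters for the holes, the set of derivable
flat equations `v ≈ f(…)`. The parameters themselves are forgotten; what remains is which equations
share them. Hence there are finitely many keys over finitely many variables.

The main point is that, under coherence, the key after an action is a function `post` of the action
and the key before (`post_of_act`), and the key also decides whether the action is enabled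
(`act_of_post`). Copies and assignments define a fresh constant, which is conservative
(`derives_insert_def`), so only the key of the defined term has to be found. If the term is stored,
this is a restriction of the old key (`keyOf_restrict`). If not, memoization says that the term does
not occur up to congruence, and inversion of derivations (`Deq.cases`) shows that it contributes
nothing but its own equation (`keyOf_extend`). An assumed disequality creates no equalities. For an
assumed equality, congruence propagates only through superterms of the two merged values; the
early-assume condition says that those are stored, so the propagation is visible in the contexts. A
normal-form map `nf` shows that nothing else becomes derivable (`keyOf_assumeEq`). Pairs of a
statement and a key thus form a finite quotient of the reachable configurations.

The abstraction is tied to keys as follows. `raw` reads a key off flat literals; the two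
normalizations with the renaming in between reproduce this raw key over the initial constants
(`abstraction_eq_ofKey`); and for every basis its saturation is the key of the path condition
(`IsBasis.keyOf_eq_sat`). So an abstract state ranges over a finite set and determines the statement
and the key. Different bases may give different abstract states for one key, which is why the
bisimulation relates `c` to `α d` for all reachable `d` with the statement and key of `c`.

For computability, the basis of all derivable literals of admissible shape has the key itself as its
raw key (`exists_basis`), so abstract states amount to pairs of a statement and a key. For a fixed
signature `post` is a finite table, and the possible next statements are primitive recursive in
Goedel numbers; a search that stops when no new pair turns up lists the system. Invariance under
bisimulation then transfers decidability from finite systems. The mu-calculus is invariant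
(`IsBisimulation.mem_sem`), and on finite systems its fixed points are reached by as many iterations
as there are states (`eval_spec`). -/

namespace UP

variable {S : Sig}

/-! ### Derivations -/

/-- `Γ ⊢ s ≈ t`. -/
abbrev Deq (Γ : Set (Lit S)) (s t : Term S) : Prop := Derives Γ (Lit.eq s t)

/-- No rule that concludes an equality has a disequality as a premise, so the cases for
disequalities drop out. The motive takes the two sides instead of a literal. -/
theorem Deq.induct {Γ : Set (Lit S)} {P : Term S → Term S → Prop}
    (ax : ∀ s t, Lit.eq s t ∈ Γ → P s t) (refl : ∀ t, P t t)
    (symm : ∀ s t, Deq Γ s t → P s t → P t s)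
    (trans : ∀ s t u, Deq Γ s t → Deq Γ t u → P s t → P t u → P s u)
    (cong : ∀ (f : Fin S.funs) (ss ts : Fin (S.arity f) → Term S),
      (∀ i, Deq Γ (ss i) (ts i)) → (∀ i, P (ss i) (ts i)) → P (Term.app f ss) (Term.app f ts))
    {s t : Term S} (h : Deq Γ s t) : P s t := by
  have key : ∀ l, Derives Γ l → ∀ s t, l = Lit.eq s t → P s t := by
    intro l hl
    induction hl with
    | ax hl => rintro s t rfl; exact ax _ _ hl
    | refl t => intro a b hab; cases hab; exact refl _
    | symm h ih => intro a b hab; cases hab; exact symm _ _ h (ih _ _ rfl)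
    | trans h₁ h₂ ih₁ ih₂ =>
      intro a b hab; cases hab; exact trans _ _ _ h₁ h₂ (ih₁ _ _ rfl) (ih₂ _ _ rfl)
    | cong h ih => intro a b hab; cases hab; exact cong _ _ _ h (fun i => ih i _ _ rfl)
    | ne_symm h ih => intro a b hab; cases hab
    | pmod h₁ h₂ ih₁ ih₂ => intro a b hab; cases hab
  exact key _ h _ _ rfl

/-- The rules for disequalities only swap the sides and move them along derived equalities, so every
derived disequality goes back to a single assumed one. -/
theorem derives_ne_iff {Γ : Set (Lit S)} {s t : Term S} :
    Derives Γ (Lit.ne s t) ↔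
      ∃ a b, Lit.ne a b ∈ Γ ∧ ((Deq Γ s a ∧ Deq Γ t b) ∨ (Deq Γ s b ∧ Deq Γ t a)) := by
  constructor
  · intro h
    have key : ∀ l, Derives Γ l → ∀ s t, l = Lit.ne s t → ∃ a b, Lit.ne a b ∈ Γ ∧
        ((Deq Γ s a ∧ Deq Γ t b) ∨ (Deq Γ s b ∧ Deq Γ t a)) := by
      intro l hl
      induction hl with
      | ax hl => rintro s t rfl; exact ⟨s, t, hl, Or.inl ⟨.refl _, .refl _⟩⟩
      | refl t => intro a b hab; cases hab
      | symm h ih => intro a b hab; cases hab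
      | trans h₁ h₂ ih₁ ih₂ => intro a b hab; cases hab
      | cong h ih => intro a b hab; cases hab
      | ne_symm h ih =>
        intro a b hab; cases hab
        obtain ⟨a, b, hab, h | h⟩ := ih _ _ rfl
        · exact ⟨a, b, hab, Or.inr ⟨h.2, h.1⟩⟩
        · exact ⟨a, b, hab, Or.inl ⟨h.2, h.1⟩⟩
      | pmod h₁ h₂ ih₁ ih₂ =>
        intro a b hab; cases hab
        obtain ⟨a, b, hab, h | h⟩ := ih₁ _ _ rfl
        · exact ⟨a, b, hab, Or.inl ⟨(h₂.symm).trans h.1, h.2⟩⟩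
        · exact ⟨a, b, hab, Or.inr ⟨(h₂.symm).trans h.1, h.2⟩⟩
    exact key _ h _ _ rfl
  · rintro ⟨a, b, hab, ⟨h₁, h₂⟩ | ⟨h₁, h₂⟩⟩
    · exact (((Derives.ax hab).pmod h₁.symm).ne_symm.pmod h₂.symm).ne_symm
    · exact ((Derives.ax hab).pmod h₂.symm).ne_symm.pmod h₁.symm

/-- Transport of a derived disequality along derived equalities. -/
theorem Derives.ne_congr {Γ : Set (Lit S)} {s s' t t' : Term S} (h : Derives Γ (Lit.ne s t))
    (hs : Deq Γ s s') (ht : Deq Γ t t') : Derives Γ (Lit.ne s' t') :=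
  ((h.pmod hs).ne_symm.pmod ht).ne_symm

/-- Substitution of terms for constants. -/
def Term.bind (θ : ℕ → Term S) : Term S → Term S
  | const c => θ c
  | app f ts => app f (fun i => (ts i).bind θ)

def Lit.bind (θ : ℕ → Term S) : Lit S → Lit S
  | eq s t => eq (s.bind θ) (t.bind θ)
  | ne s t => ne (s.bind θ) (t.bind θ)

theorem Derives.bind {Γ Δ : Set (Lit S)} {θ : ℕ → Term S} (hΔ : ∀ l ∈ Δ, Derives Γ (l.bind θ))
    {l : Lit S} (h : Derives Δ l) : Derives Γ (l.bind θ) := by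
  induction h with
  | ax h => exact hΔ _ h
  | refl t => exact .refl _
  | symm h ih => exact ih.symm
  | trans h₁ h₂ ih₁ ih₂ => exact ih₁.trans ih₂
  | cong h ih => exact .cong ih
  | ne_symm h ih => exact ih.ne_symm
  | pmod h₁ h₂ ih₁ ih₂ => exact ih₁.pmod ih₂

theorem Derives.cut {Γ Δ : Set (Lit S)} (hΔ : ∀ l ∈ Δ, Derives Γ l)
    {l : Lit S} (h : Derives Δ l) : Derives Γ l := by
  induction h with
  | ax h => exact hΔ _ h
  | refl t => exact .refl _
  | symm h ih => exact ih.symm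
  | trans h₁ h₂ ih₁ ih₂ => exact ih₁.trans ih₂
  | cong h ih => exact .cong ih
  | ne_symm h ih => exact ih.ne_symm
  | pmod h₁ h₂ ih₁ ih₂ => exact ih₁.pmod ih₂

theorem Derives.mono {Γ Δ : Set (Lit S)} (hΔ : Γ ⊆ Δ) {l : Lit S} (h : Derives Γ l) :
    Derives Δ l := h.cut fun _ hl => .ax (hΔ hl)

theorem Term.self_mem_subterms (t : Term S) : t ∈ t.subterms := by
  cases t <;> simp [Term.subterms]

theorem Term.arg_mem_subterms {f : Fin S.funs} {ts : Fin (S.arity f) → Term S}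
    (i : Fin (S.arity f)) {s : Term S} (h : s ∈ (ts i).subterms) :
    s ∈ (Term.app f ts).subterms := by
  simp only [Term.subterms, Set.mem_union, Set.mem_iUnion]
  exact Or.inr ⟨i, h⟩

theorem Term.subterms_trans {s t : Term S} (h : s ∈ t.subterms) : s.subterms ⊆ t.subterms := by
  induction t with
  | const c => simp only [Term.subterms, Set.mem_singleton_iff] at h; subst h; rfl
  | app f ts ih =>
    simp only [Term.subterms, Set.mem_union, Set.mem_iUnion, Set.mem_singleton_iff] at h
    obtain rfl | ⟨i, h⟩ := h
    · rfl
    · exact fun u hu => Term.arg_mem_subterms i (ih i h hu)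

theorem Term.subterms_finite (t : Term S) : t.subterms.Finite := by
  induction t with
  | const c => exact Set.finite_singleton _
  | app f ts ih => exact (Set.finite_singleton _).union (Set.finite_iUnion ih)

theorem Term.bind_congr {θ θ' : ℕ → Term S} {t : Term S}
    (h : ∀ c, Term.const c ∈ t.subterms → θ c = θ' c) : t.bind θ = t.bind θ' := by
  induction t with
  | const c => exact h c (Term.self_mem_subterms _)
  | app f ts ih =>
    simp only [Term.bind]
    congr 1
    funext i
    exact ih i fun c hc => h c (Term.arg_mem_subterms i hc)

theorem Term.bind_const (t : Term S) : t.bind Term.const = t := by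
  induction t with
  | const c => rfl
  | app f ts ih => simp only [Term.bind, ih]

theorem Term.bind_eq_self {θ : ℕ → Term S} {t : Term S}
    (h : ∀ c, Term.const c ∈ t.subterms → θ c = Term.const c) : t.bind θ = t :=
  (Term.bind_congr h).trans t.bind_const

theorem Lit.bind_eq_self {θ : ℕ → Term S} {l : Lit S}
    (h : ∀ c ∈ l.consts, θ c = Term.const c) : l.bind θ = l := by
  cases l <;>
  · simp only [Lit.bind, Lit.consts, Lit.terms, Set.mem_ofPred_eq, Set.mem_union] at h ⊢
    rw [Term.bind_eq_self fun c hc => h c (Or.inl hc), Term.bind_eq_self fun c hc => h c (Or.inr hc)]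

/-- Substituting equal terms gives equal terms. -/
theorem Deq.of_bind {Γ : Set (Lit S)} {θ θ' : ℕ → Term S} (h : ∀ c, Deq Γ (θ c) (θ' c))
    (t : Term S) : Deq Γ (t.bind θ) (t.bind θ') := by
  induction t with
  | const c => exact h c
  | app f ts ih => exact .cong ih

theorem Lit.terms_finite (l : Lit S) : l.terms.Finite := by
  cases l <;> exact (Term.subterms_finite _).union (Term.subterms_finite _)

theorem termsOf_finite {Γ : Set (Lit S)} (h : Γ.Finite) : (termsOf Γ).Finite := by
  have : termsOf Γ = ⋃ l ∈ Γ, l.terms := by ext; simp [termsOf]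
  rw [this]
  exact h.biUnion fun l _ => l.terms_finite

theorem constsOf_finite {Γ : Set (Lit S)} (h : Γ.Finite) : (constsOf Γ).Finite :=
  (termsOf_finite h).preimage (f := Term.const) (fun _ _ _ _ h => by cases h; rfl)

theorem termsOf_subterm {Γ : Set (Lit S)} {s t : Term S} (ht : t ∈ termsOf Γ)
    (h : s ∈ t.subterms) : s ∈ termsOf Γ := by
  obtain ⟨l, hl, ht⟩ := ht
  refine ⟨l, hl, ?_⟩
  cases l <;>
  · simp only [Lit.terms, Set.mem_union] at ht ⊢
    exact ht.imp (fun h' => Term.subterms_trans h' h) (fun h' => Term.subterms_trans h' h)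

theorem termsOf_arg {Γ : Set (Lit S)} {f : Fin S.funs} {ts : Fin (S.arity f) → Term S}
    (ht : Term.app f ts ∈ termsOf Γ) (i : Fin (S.arity f)) : ts i ∈ termsOf Γ :=
  termsOf_subterm ht (Term.arg_mem_subterms i (Term.self_mem_subterms _))

theorem mem_termsOf_eq {Γ : Set (Lit S)} {s t : Term S} (h : Lit.eq s t ∈ Γ) :
    s ∈ termsOf Γ ∧ t ∈ termsOf Γ :=
  ⟨⟨_, h, Or.inl (Term.self_mem_subterms _)⟩, ⟨_, h, Or.inr (Term.self_mem_subterms _)⟩⟩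

theorem mem_termsOf_ne {Γ : Set (Lit S)} {s t : Term S} (h : Lit.ne s t ∈ Γ) :
    s ∈ termsOf Γ ∧ t ∈ termsOf Γ :=
  ⟨⟨_, h, Or.inl (Term.self_mem_subterms _)⟩, ⟨_, h, Or.inr (Term.self_mem_subterms _)⟩⟩

/-! ### Soundness and completeness -/

theorem Derives.sound {Γ : Set (Lit S)} {l : Lit S} (h : Derives Γ l) : Entails Γ l := by
  intro M hM
  induction h with
  | ax h => exact hM _ h
  | refl t => rfl
  | symm h ih => exact Eq.symm ih
  | trans h₁ h₂ ih₁ ih₂ => exact Eq.trans ih₁ ih₂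
  | cong h ih =>
    simp only [Interp.Sat, Interp.eval] at ih ⊢
    simp only [ih]
  | ne_symm h ih => exact Ne.symm ih
  | pmod h₁ h₂ ih₁ ih₂ =>
    simp only [Interp.Sat] at ih₁ ih₂ ⊢
    rwa [← ih₂]

def eqSetoid (Γ : Set (Lit S)) : Setoid (Term S) where
  r := Deq Γ
  iseqv := ⟨.refl, .symm, .trans⟩

/-- The quotient of the term algebra by the derivable equalities. -/
noncomputable def quotInterp (Γ : Set (Lit S)) : Interp S where
  U := Quotient (eqSetoid Γ)
  con c := Quotient.mk _ (Term.const c)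
  fn f args := Quotient.mk _ (Term.app f fun i => (args i).out)

theorem quotInterp_eval (Γ : Set (Lit S)) (t : Term S) :
    (quotInterp Γ).eval t = Quotient.mk (eqSetoid Γ) t := by
  induction t with
  | const c => rfl
  | app f ts ih =>
    simp only [Interp.eval, ih]
    refine Quotient.sound (Derives.cong fun i => ?_)
    exact Quotient.mk_out (s := eqSetoid Γ) (ts i)

theorem quotInterp_eq_iff {Γ : Set (Lit S)} {s t : Term S} :
    (quotInterp Γ).eval s = (quotInterp Γ).eval t ↔ Deq Γ s t := by
  rw [quotInterp_eval, quotInterp_eval]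
  exact Quotient.eq (r := eqSetoid Γ)

/-- The term model modulo derivable equality satisfies every assumed equality; it fails to be a
model only if the sides of an assumed disequality are derivably equal. -/
theorem satisfiable_iff {Γ : Set (Lit S)} :
    Satisfiable Γ ↔ ∀ s t, Lit.ne s t ∈ Γ → ¬ Deq Γ s t := by
  constructor
  · rintro ⟨M, hM⟩ s t hst h
    exact hM _ hst (h.sound M hM)
  · intro h
    refine ⟨quotInterp Γ, fun l hl => ?_⟩
    cases l with
    | eq s t => exact quotInterp_eq_iff.2 (.ax hl)
    | ne s t => exact fun h' => h s t hl (quotInterp_eq_iff.1 h')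

/-- Completeness needs satisfiability: an unsatisfiable set entails every literal, while the proof
system has no rule to exploit a contradiction. This lemma turns the coherence conditions, stated by
entailment, into statements on derivations. -/
theorem entails_eq_iff {Γ : Set (Lit S)} (hΓ : Satisfiable Γ) {s t : Term S} :
    Entails Γ (Lit.eq s t) ↔ Deq Γ s t := by
  refine ⟨fun h => ?_, Derives.sound⟩
  refine quotInterp_eq_iff.1 (h _ fun l hl => ?_)
  cases l with
  | eq s t => exact quotInterp_eq_iff.2 (.ax hl)
  | ne s t => exact fun h' => satisfiable_iff.1 hΓ s t hl (quotInterp_eq_iff.1 h')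

/-! ### Inversion of derived equalities -/

/-- The term is congruent, argumentwise, to a term of `Γ`. -/
def Occurs (Γ : Set (Lit S)) : Term S → Prop
  | .const c => Term.const c ∈ termsOf Γ
  | .app f ss => ∃ ts, Term.app f ts ∈ termsOf Γ ∧ ∀ i, Deq Γ (ss i) (ts i)

theorem Occurs.of_mem {Γ : Set (Lit S)} {t : Term S} (h : t ∈ termsOf Γ) : Occurs Γ t := by
  cases t with
  | const c => exact h
  | app f ts => exact ⟨ts, h, fun i => .refl _⟩

theorem Occurs.exists_mem {Γ : Set (Lit S)} {t : Term S} (h : Occurs Γ t) :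
    ∃ s ∈ termsOf Γ, Deq Γ t s := by
  cases t with
  | const c => exact ⟨_, h, .refl _⟩
  | app f ts =>
    obtain ⟨ts', h, h'⟩ := h
    exact ⟨_, h, .cong h'⟩

/-- Equality up to congruence at the root. -/
def RootCong (Γ : Set (Lit S)) (s t : Term S) : Prop :=
  s = t ∨ ∃ f ss ts, s = Term.app f ss ∧ t = Term.app f ts ∧ ∀ i, Deq Γ (ss i) (ts i)

theorem RootCong.occurs {Γ : Set (Lit S)} {s t : Term S} (h : RootCong Γ s t) (ht : Occurs Γ t) :
    Occurs Γ s := by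
  obtain rfl | ⟨f, ss, ts, rfl, rfl, h⟩ := h
  · exact ht
  · obtain ⟨us, hu, hu'⟩ := ht
    exact ⟨us, hu, fun i => (h i).trans (hu' i)⟩

theorem RootCong.symm {Γ : Set (Lit S)} {s t : Term S} (h : RootCong Γ s t) : RootCong Γ t s := by
  obtain rfl | ⟨f, ss, ts, rfl, rfl, h⟩ := h
  · exact Or.inl rfl
  · exact Or.inr ⟨f, _, _, rfl, rfl, fun i => (h i).symm⟩

theorem RootCong.trans {Γ : Set (Lit S)} {s t u : Term S} (h : RootCong Γ s t)
    (h' : RootCong Γ t u) : RootCong Γ s u := by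
  obtain rfl | ⟨f, ss, ts, rfl, rfl, h⟩ := h
  · exact h'
  · obtain rfl | ⟨g, ts', us, h₁, rfl, h'⟩ := h'
    · exact Or.inr ⟨f, _, _, rfl, rfl, h⟩
    · cases h₁
      exact Or.inr ⟨f, _, _, rfl, rfl, fun i => (h i).trans (h' i)⟩

theorem Occurs.congr {Γ : Set (Lit S)} {s t : Term S} (hs : Occurs Γ s)
    (h : (Occurs Γ s ∧ Occurs Γ t) ∨ RootCong Γ s t) : Occurs Γ t := by
  obtain ⟨-, h⟩ | h := h
  · exact h
  · exact h.symm.occurs hs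

/-- If a chain of equalities uses an assumption at the root, then both ends are congruent to terms
of `Γ`; otherwise only congruence is used at the root. Composing the two kinds of links stays within
this dichotomy because `Occurs` is transported by `RootCong`. -/
theorem Deq.cases {Γ : Set (Lit S)} {s t : Term S} (h : Deq Γ s t) :
    (Occurs Γ s ∧ Occurs Γ t) ∨ RootCong Γ s t := by
  refine Deq.induct (P := fun s t => (Occurs Γ s ∧ Occurs Γ t) ∨ RootCong Γ s t)
    ?_ ?_ ?_ ?_ ?_ h
  · exact fun s t h => Or.inl ((mem_termsOf_eq h).imp Occurs.of_mem Occurs.of_mem)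
  · exact fun t => Or.inr (Or.inl rfl)
  · exact fun s t _ ih => ih.imp And.symm RootCong.symm
  · intro s t u _ _ ih₁ ih₂
    obtain ⟨hs, ht⟩ | h := ih₁ <;> obtain ⟨ht', hu⟩ | h' := ih₂
    · exact Or.inl ⟨hs, hu⟩
    · exact Or.inl ⟨hs, h'.symm.occurs ht⟩
    · exact Or.inl ⟨h.occurs ht', hu⟩
    · exact Or.inr (h.trans h')
  · exact fun f ss ts h _ => Or.inr (Or.inr ⟨f, ss, ts, rfl, rfl, h⟩)

/-- A constant and an application are never congruent at the root, so an assumption must have been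
used there. -/
theorem Deq.occurs_of_const {Γ : Set (Lit S)} {c : ℕ} {f : Fin S.funs}
    {ts : Fin (S.arity f) → Term S} (h : Deq Γ (Term.const c) (Term.app f ts)) :
    Occurs Γ (Term.app f ts) := by
  obtain ⟨_, h⟩ | h | ⟨g, ss, ts', h, -⟩ := h.cases
  · exact h
  · cases h
  · cases h

theorem Deq.occurs {Γ : Set (Lit S)} {s t : Term S} (h : Deq Γ s t) (hs : Occurs Γ s) :
    Occurs Γ t := hs.congr h.cases

theorem occurs_iff {Γ : Set (Lit S)} {t : Term S} : Occurs Γ t ↔ ∃ s ∈ termsOf Γ, Deq Γ t s :=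
  ⟨Occurs.exists_mem, fun ⟨_, hs, h⟩ => Deq.occurs (Derives.symm h) (.of_mem hs)⟩

theorem Occurs.arg {Γ : Set (Lit S)} {f : Fin S.funs} {ts : Fin (S.arity f) → Term S}
    (h : Occurs Γ (Term.app f ts)) (i : Fin (S.arity f)) : Occurs Γ (ts i) := by
  obtain ⟨us, hu, h⟩ := h
  exact occurs_iff.2 ⟨_, termsOf_arg hu i, h i⟩

/-! ### Normal forms -/

/-- Terms over a set `Q` of base classes. -/
inductive NF (S : Sig) (Q : Type) : Type
  | base (z : Q) : NF S Q
  | app (f : Fin S.funs) (ts : Fin (S.arity f) → NF S Q) : NF S Q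

open scoped Classical in
/-- Application of a function symbol to normal forms: it is looked up among the terms of `Γ`, which
are classified by `ι`. -/
noncomputable def nfApp {Q : Type} (Γ : Set (Lit S)) (ι : Term S → Q) (f : Fin S.funs)
    (ts : Fin (S.arity f) → NF S Q) : NF S Q :=
  if h : ∃ zs : Fin (S.arity f) → Term S, Term.app f zs ∈ termsOf Γ ∧
      ∀ i, ts i = .base (ι (zs i))
  then .base (ι (Term.app f h.choose)) else .app f ts

/-- Bottom-up evaluation in the partial algebra of classes of terms of `Γ`, freely extended where
`Γ` has no matching application. -/
noncomputable def nf {Q : Type} (Γ : Set (Lit S)) (ι : Term S → Q) : Term S → NF S Q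
  | .const c => .base (ι (.const c))
  | .app f ts => nfApp Γ ι f (fun i => nf Γ ι (ts i))

/-- `ι` respects the function applications in `Γ`. -/
def Compat {Q : Type} (Γ : Set (Lit S)) (ι : Term S → Q) : Prop :=
  ∀ (f : Fin S.funs) (zs zs' : Fin (S.arity f) → Term S), Term.app f zs ∈ termsOf Γ →
    Term.app f zs' ∈ termsOf Γ → (∀ i, ι (zs i) = ι (zs' i)) →
    ι (Term.app f zs) = ι (Term.app f zs')

section

variable {Q : Type} {Γ : Set (Lit S)} {ι : Term S → Q}

/-- Compatibility makes the value independent of the application that the lookup in `nfApp` happens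
to choose. -/
theorem nf_app_of_mem (hι : Compat Γ ι) {f : Fin S.funs} {ts zs : Fin (S.arity f) → Term S}
    (hz : Term.app f zs ∈ termsOf Γ) (h : ∀ i, nf Γ ι (ts i) = .base (ι (zs i))) :
    nf Γ ι (.app f ts) = .base (ι (.app f zs)) := by
  have hex : ∃ zs : Fin (S.arity f) → Term S, Term.app f zs ∈ termsOf Γ ∧
        ∀ i, nf Γ ι (ts i) = .base (ι (zs i)) := ⟨zs, hz, h⟩
  rw [nf, nfApp, dif_pos hex]
  congr 1
  refine hι _ _ _ hex.choose_spec.1 hz fun i => ?_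
  have := (hex.choose_spec.2 i).symm.trans (h i)
  injection this

theorem nf_of_mem (hι : Compat Γ ι) {t : Term S} (ht : t ∈ termsOf Γ) :
    nf Γ ι t = .base (ι t) := by
  induction t with
  | const c => rfl
  | app f ts ih => exact nf_app_of_mem hι ht fun i => ih i (termsOf_arg ht i)

theorem nf_app_eq_base {f : Fin S.funs} {ts : Fin (S.arity f) → Term S} {z : Q}
    (h : nf Γ ι (.app f ts) = .base z) :
    ∃ zs : Fin (S.arity f) → Term S, Term.app f zs ∈ termsOf Γ ∧
        (∀ i, nf Γ ι (ts i) = .base (ι (zs i))) ∧ ι (.app f zs) = z := by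
  rw [nf, nfApp] at h
  split_ifs at h with hex
  · exact ⟨_, hex.choose_spec.1, hex.choose_spec.2, by injection h⟩

/-- `nf` is a congruence by construction, so only the assumptions have to be checked. This is the
tool for showing that equalities are not derivable. `Δ` is separate from `Γ` so that it may contain
a further assumption. -/
theorem nf_eq_of_deq {Δ : Set (Lit S)}
    (hΔ : ∀ s t, Lit.eq s t ∈ Δ → nf Γ ι s = nf Γ ι t) {s t : Term S} (h : Deq Δ s t) :
    nf Γ ι s = nf Γ ι t := by
  refine Deq.induct (P := fun s t => nf Γ ι s = nf Γ ι t) hΔ (fun _ => rfl)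
    (fun _ _ _ ih => ih.symm) (fun _ _ _ _ _ ih₁ ih₂ => ih₁.trans ih₂) ?_ h
  intro f ss ts _ ih
  simp only [nf, ih]

end

end UP

/-! ### Keys, and their change under forgetting and under definitions -/

namespace UP

variable {S : Sig} {X Y : Type}

/-! ### Keys -/

/-- Holed literals `v ≈ f(h)` over the index set `X`, where `none` is a hole. -/
abbrev HLit (S : Sig) (X : Type) (f : Fin S.funs) : Type := X × (Fin (S.arity f) → Option X)

/-- What a set of literals says about a family of terms: equalities, disequalities, and contexts. -/
@[ext] structure Key (S : Sig) (X : Type) where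
  E : X → X → Prop
  D : X → X → Prop
  C : ∀ f : Fin S.funs, Set (Set (HLit S X f))

/-- The finiteness of the abstract systems and of the table for `post` rests on this. -/
instance [Finite X] : Finite (Key S X) := by
  refine Finite.of_injective (β := (X → X → Prop) × (X → X → Prop) ×
    (∀ f : Fin S.funs, Set (Set (HLit S X f)))) (fun κ => (κ.E, κ.D, κ.C)) ?_
  intro κ κ' h
  simp only [Prod.mk.injEq] at h
  exact Key.ext h.1 h.2.1 h.2.2

/-- Fill the holes of `h` with parameters. -/
def fill {k : ℕ} (Q : X → Term S) (p : Fin k → Term S) (h : Fin k → Option X) : Fin k → Term S :=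
  fun i => (h i).elim (p i) Q

/-- The holed literals with hole positions `N` that are derivable for the parameters `p`. -/
def ctxSet (Γ : Set (Lit S)) (Q : X → Term S) (f : Fin S.funs) (N : Set (Fin (S.arity f)))
    (p : Fin (S.arity f) → Term S) : Set (HLit S X f) :=
  {z | (∀ i, z.2 i = none ↔ i ∈ N) ∧ Deq Γ (Q z.1) (Term.app f (fill Q p z.2))}

/-- The key of the family `Q` of terms. -/
def keyOf (Γ : Set (Lit S)) (Q : X → Term S) : Key S X where
  E u v := Deq Γ (Q u) (Q v)
  D u v := Derives Γ (Lit.ne (Q u) (Q v))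
  C f := {Z | ∃ N p, (∃ i, i ∉ N) ∧ (∀ i ∈ N, ∀ u, ¬ Deq Γ (Q u) (p i)) ∧
    Z = ctxSet Γ Q f N p ∧ Z.Nonempty}

theorem deq_app_fill {Γ : Set (Lit S)} {Q Q' : X → Term S} {f : Fin S.funs}
    {p p' : Fin (S.arity f) → Term S} {h : Fin (S.arity f) → Option X}
    (hQ : ∀ u, Deq Γ (Q u) (Q' u)) (hp : ∀ i, h i = none → Deq Γ (p i) (p' i)) :
    Deq Γ (.app f (fill Q p h)) (.app f (fill Q' p' h)) := by
  refine .cong fun i => ?_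
  unfold fill
  cases hi : h i with
  | none => exact hp i hi
  | some y => exact hQ y

theorem ctxSet_congr {Γ : Set (Lit S)} {Q : X → Term S} {f : Fin S.funs}
    {N : Set (Fin (S.arity f))} {p p' : Fin (S.arity f) → Term S}
    (h : ∀ i ∈ N, Deq Γ (p i) (p' i)) : ctxSet Γ Q f N p = ctxSet Γ Q f N p' := by
  ext z
  refine and_congr_right fun hz => ⟨fun h' => h'.trans ?_, fun h' => h'.trans ?_⟩
  · exact deq_app_fill (fun u => .refl _) fun i hi => h i ((hz i).1 hi)
  · exact deq_app_fill (fun u => .refl _) fun i hi => (h i ((hz i).1 hi)).symm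

theorem occurs_param {Γ : Set (Lit S)} {Q : X → Term S} {f : Fin S.funs}
    {N : Set (Fin (S.arity f))} {p : Fin (S.arity f) → Term S} {z : HLit S X f}
    (hz : z ∈ ctxSet Γ Q f N p) (ho : Occurs Γ (.app f (fill Q p z.2))) :
    ∀ i ∈ N, Occurs Γ (p i) := by
  intro i hi
  have := ho.arg i
  rwa [fill, (hz.1 i).2 hi] at this

/-! ### Forgetting -/

/-- Pull a context back along `r`, where the entries prescribed by `g` become holes. -/
def pull (r : Y → X) {f : Fin S.funs} (g : Fin (S.arity f) → Option X) (Z : Set (HLit S X f)) :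
    Set (HLit S Y f) :=
  {z | (∀ i, g i ≠ none → z.2 i = none) ∧
    (r z.1, fun i => (g i).or ((z.2 i).map r)) ∈ Z}

/-- An argument that was stored only in forgotten indices turns into a parameter: `g` selects such
positions together with the value that becomes the parameter. The side condition says that no
remaining index stores this value. Contexts left without any index among their arguments are
dropped, as in `keyOf`. -/
def Key.restrict (κ : Key S X) (r : Y → X) : Key S Y where
  E u v := κ.E (r u) (r v)
  D u v := κ.D (r u) (r v)
  C f := {Z' | ∃ Z ∈ κ.C f, ∃ g : Fin (S.arity f) → Option X,
    (∀ i u, g i = some u → ∀ y, ¬ κ.E (r y) u) ∧ Z' = pull r g Z ∧ ∃ z ∈ Z', ∃ i, z.2 i ≠ none}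

/-- The parameters of a context for the smaller family split into those that the larger family
stores, which `g` records, and those that it does not store, which remain holes in a context of the
larger family. -/
theorem keyOf_restrict (Γ : Set (Lit S)) (Q : X → Term S) (r : Y → X) :
    keyOf Γ (Q ∘ r) = (keyOf Γ Q).restrict r := by
  classical
  -- Common core of both inclusions: the holes `N` of the small context are the holes `M` of the
  -- large one together with the positions prescribed by `g`.
  have key : ∀ (f : Fin S.funs) (N M : Set (Fin (S.arity f))) (p p' : Fin (S.arity f) → Term S)
      (g : Fin (S.arity f) → Option X), (∀ i, i ∈ N ↔ i ∈ M ∨ g i ≠ none) →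
      (∀ i, g i ≠ none → i ∉ M) →
      (∀ i ∈ N, Deq Γ (p i) ((g i).elim (p' i) Q)) →
      ctxSet Γ (Q ∘ r) f N p = pull r g (ctxSet Γ Q f M p') := by
    intro f N M p p' g hN hgM hp
    ext z
    have aux : (∀ i, g i ≠ none → z.2 i = none) → ((∀ i, z.2 i = none ↔ i ∈ N) ↔
        ∀ i, (g i).or ((z.2 i).map r) = none ↔ i ∈ M) := by
      intro hg
      refine forall_congr' fun i => ?_
      rw [hN]
      have h1 := hg i
      have h2 := hgM i
      cases hi : g i <;> simp_all
    have aux2 : (∀ i, g i ≠ none → z.2 i = none) → (∀ i, z.2 i = none ↔ i ∈ N) →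
        Deq Γ (.app f (fill (Q ∘ r) p z.2))
          (.app f (fill Q p' (fun i => (g i).or ((z.2 i).map r)))) := by
      intro hg hz
      refine .cong fun i => ?_
      unfold fill
      cases hi : z.2 i with
      | none =>
        have := hp i ((hz i).1 hi)
        cases hgi : g i <;> simpa [hgi, hi] using this
      | some y =>
        have : g i = none := by
          by_contra h'
          rw [hg i h'] at hi
          cases hi
        simpa [this, hi] using Derives.refl _
    constructor
    · rintro ⟨h1, h2⟩
      have hg : ∀ i, g i ≠ none → z.2 i = none := fun i hi => (h1 i).2 ((hN i).2 (Or.inr hi))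
      exact ⟨hg, (aux hg).1 h1, h2.trans (aux2 hg h1)⟩
    · rintro ⟨hg, h1, h2⟩
      have h1' := (aux hg).2 h1
      exact ⟨h1', Derives.trans h2 (aux2 hg h1').symm⟩
  refine Key.ext rfl rfl ?_
  funext f
  ext Z'
  constructor
  · rintro ⟨N, p, ⟨i₀, hi₀⟩, hns, rfl, z, hz⟩
    -- `g i` names some index that stores the parameter at the hole `i`, if there is one.
    have hg : ∀ i, ∃ o : Option X, (o ≠ none ↔ i ∈ N ∧ ∃ u, Deq Γ (Q u) (p i)) ∧
        ∀ u, o = some u → Deq Γ (Q u) (p i) := by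
      intro i
      by_cases h : i ∈ N ∧ ∃ u, Deq Γ (Q u) (p i)
      · obtain ⟨hi, u, hu⟩ := h
        exact ⟨some u, by simpa [hi] using Exists.intro u hu, by simpa using hu⟩
      · exact ⟨none, by simpa using h, by simp⟩
    choose g hg hgu using hg
    have hZ := key f N (N \ {i | g i ≠ none}) p p g
      (fun i => by
        simp only [Set.mem_sdiff, Set.mem_ofPred_eq]
        have := (hg i).1
        tauto)
      (fun i hi => by simp [hi])
      (fun i hi => by
        cases h : g i with
        | none => exact .refl _
        | some u => exact (hgu i u h).symm)
    refine ⟨_, ⟨N \ {i | g i ≠ none}, p, ⟨i₀, fun h => hi₀ h.1⟩, ?_, rfl, ?_⟩, g, ?_, hZ, z, hz, i₀,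
      fun h => hi₀ ((hz.1 i₀).1 h)⟩
    · rintro i ⟨hi, hi'⟩ u hu
      exact hi' ((hg i).2 ⟨hi, u, hu⟩)
    · rw [hZ] at hz
      exact ⟨_, hz.2⟩
    · intro i u hu y hy
      have : i ∈ N := ((hg i).1 (by simp [hu])).1
      exact hns i this y (Derives.trans hy (hgu i u hu))
  · rintro ⟨Z, ⟨M, p', hM, hns, rfl, hne⟩, g, hg, rfl, z, hz, i₀, hi₀⟩
    have hgM : ∀ i, g i ≠ none → i ∉ M := by
      intro i hi hiM
      have := (hz.2.1 i).2 hiM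
      simp only [Option.or_eq_none_iff] at this
      exact hi this.1
    -- The positions given by `g` become holes, whose parameters are the forgotten values.
    have hZ := key f (M ∪ {i | g i ≠ none}) M (fun i => (g i).elim (p' i) Q) p' g
      (fun i => Iff.rfl) hgM (fun i _ => .refl _)
    refine ⟨_, _, ⟨i₀, ?_⟩, ?_, hZ.symm, z, hz⟩
    · rw [← hZ] at hz
      exact fun h => hi₀ ((hz.1 i₀).2 h)
    · intro i hi y hy
      cases h : g i with
      | none =>
        rw [h] at hy
        refine hns i ?_ (r y) hy
        rcases hi with hi | hi
        · exact hi
        · exact absurd h hi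
      | some u =>
        rw [h] at hy
        exact hg i u h y hy

/-! ### Fresh definitions -/

section

variable {Γ : Set (Lit S)} {x' : ℕ} {T : Term S}

/-- Replacing `x'` by `T` leaves the literals of `Γ` unchanged and turns the definition into `T ≈
T`, so derivations are mapped to derivations from `Γ`. Conversely, the definition makes every term
equal to its image. -/
theorem derives_insert_def (hx : x' ∉ constsOf Γ) (hT : Term.const x' ∉ T.subterms) {l : Lit S} :
    Derives (insert (Lit.eq (Term.const x') T) Γ) l ↔
      Derives Γ (l.bind (Function.update Term.const x' T)) := by
  set θ := Function.update Term.const x' T with hθ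
  have hT' : T.bind θ = T := Term.bind_eq_self fun c hc => by
    rw [hθ, Function.update_of_ne]
    rintro rfl
    exact hT hc
  constructor
  · refine Derives.bind ?_
    rintro l (rfl | hl)
    · simp only [Lit.bind, Term.bind, hT']
      rw [hθ, Function.update_self]
      exact .refl _
    · rw [Lit.bind_eq_self]
      · exact .ax hl
      · intro c hc
        rw [hθ, Function.update_of_ne]
        rintro rfl
        exact hx ⟨l, hl, hc⟩
  · intro h
    have h' := h.mono (Set.subset_insert (Lit.eq (Term.const x') T) Γ)
    have hc : ∀ t : Term S, Deq (insert (Lit.eq (Term.const x') T) Γ) (t.bind θ) t := by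
      intro t
      have := Deq.of_bind (Γ := insert (Lit.eq (Term.const x') T) Γ) (θ := θ) (θ' := Term.const)
        (fun c => by
          by_cases hcx : c = x'
          · subst hcx
            rw [hθ, Function.update_self]
            exact .symm (.ax (Set.mem_insert _ _))
          · rw [hθ, Function.update_of_ne hcx]
            exact .refl _) t
      rwa [Term.bind_const] at this
    cases l with
    | eq s t => exact (hc s).symm.trans (Derives.trans h' (hc t))
    | ne s t => exact h'.ne_congr (hc s) (hc t)

/-- The parameters of a context may contain `x'` after the definition but can be translated by the
substitution. For the converse, `hp` lets every parameter be replaced by a term of `Γ`, which the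
substitution fixes. -/
theorem keyOf_insert_def (hx : x' ∉ constsOf Γ) (hT : Term.const x' ∉ T.subterms)
    {Q Q' : X → Term S} (hQ : ∀ u, (Q' u).bind (Function.update Term.const x' T) = Q u)
    (hp : ∀ f N p, ∀ z ∈ ctxSet Γ Q f N p, (∀ i ∈ N, ∀ u, ¬ Deq Γ (Q u) (p i)) →
      ∀ i ∈ N, Occurs Γ (p i)) :
    keyOf (insert (Lit.eq (Term.const x') T) Γ) Q' = keyOf Γ Q := by
  classical
  have hd := fun l => derives_insert_def (l := l) hx hT
  have hctx : ∀ f N (p : Fin (S.arity f) → Term S),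
      ctxSet (insert (Lit.eq (Term.const x') T) Γ) Q' f N p =
      ctxSet Γ Q f N (fun i => (p i).bind (Function.update Term.const x' T)) := by
    intro f N p
    ext z
    refine and_congr_right fun hz => ?_
    rw [Deq, hd, Lit.bind, Term.bind, hQ]
    have : (fun i => (fill Q' p z.2 i).bind (Function.update Term.const x' T)) =
        fill Q (fun i => (p i).bind (Function.update Term.const x' T)) z.2 := by
      funext i
      unfold fill
      cases z.2 i <;> simp [hQ]
    rw [this]
  apply Key.ext
  · funext u v
    simp only [keyOf, Deq, hd, Lit.bind, hQ]
  · funext u v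
    simp only [keyOf, hd, Lit.bind, hQ]
  · funext f
    ext Z
    constructor
    · rintro ⟨N, p, hN, hns, rfl, hne⟩
      refine ⟨N, _, hN, ?_, hctx f N p, hne⟩
      intro i hi u hu
      refine hns i hi u ?_
      rw [Deq, hd, Lit.bind, hQ]
      exact hu
    · rintro ⟨N, p, hN, hns, rfl, z, hz⟩
      -- Terms of `Γ` do not contain `x'`, so these parameters mean the same before and after the
      -- definition.
      have ht : ∀ i, ∃ t : Term S, i ∈ N → t ∈ termsOf Γ ∧ Deq Γ (p i) t := by
        intro i
        by_cases hi : i ∈ N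
        · obtain ⟨t, ht⟩ := (hp f N p z hz hns i hi).exists_mem
          exact ⟨t, fun _ => ht⟩
        · exact ⟨p i, fun h => absurd h hi⟩
      choose t ht using ht
      have htb : ∀ i ∈ N, (t i).bind (Function.update Term.const x' T) = t i := by
        intro i hi
        refine Term.bind_eq_self fun c hc => ?_
        rw [Function.update_of_ne]
        rintro rfl
        exact hx (termsOf_subterm (ht i hi).1 hc)
      refine ⟨N, t, hN, ?_, ?_, z, hz⟩
      · intro i hi u hu
        rw [Deq, hd, Lit.bind, hQ, htb i hi] at hu
        exact hns i hi u (hu.trans (ht i hi).2.symm)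
      · rw [hctx]
        refine ctxSet_congr fun i hi => ?_
        rw [htb i hi]
        exact (ht i hi).2

end

/-! ### A new application -/

/-- A context with holes stays a context when the index set is extended. -/
def liftCtx {f : Fin S.funs} (Z : Set (HLit S X f)) : Set (HLit S (Option X) f) :=
  {z | ∃ w ∈ Z, z = (some w.1, fun i => (w.2 i).map some)}

/-- The literals without holes after `none ≈ g(ys)` is added. -/
def Key.fullCtx (κ : Key S X) (g : Fin S.funs) (ys : Fin (S.arity g) → X) (f : Fin S.funs) :
    Set (HLit S (Option X) f) :=
  {z | (∃ (v : X) (h : Fin (S.arity f) → X), z = (some v, fun i => some (some (h i))) ∧ ∃ Z ∈ κ.C f, (v, fun i => some (h i)) ∈ Z) ∨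
    ∃ h : Fin (S.arity f) → X, z = (none, fun i => some (some (h i))) ∧ f = g ∧
      ∀ (i : Fin (S.arity f)) (j : Fin (S.arity g)), i.val = j.val → κ.E (h i) (ys j)}

/-- Add a new index `none` for the new term `g(ys)`. -/
def Key.extend (κ : Key S X) (g : Fin S.funs) (ys : Fin (S.arity g) → X) : Key S (Option X) where
  E
    | some u, some v => κ.E u v
    | none, none => True
    | _, _ => False
  D
    | some u, some v => κ.D u v
    | _, _ => False
  C f := {Z' | (∃ Z ∈ κ.C f, (∀ z ∈ Z, ∃ i, z.2 i = none) ∧ Z' = liftCtx Z) ∨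
    (Z' = κ.fullCtx g ys f ∧ Z'.Nonempty)}

section

variable {Γ : Set (Lit S)} {q : X → ℕ} {g : Fin S.funs} {ys : Fin (S.arity g) → X}

/-- The family `q` of constants, extended by the term `g(q(ys))`. -/
def extendFam (S : Sig) (q : X → ℕ) (g : Fin S.funs) (ys : Fin (S.arity g) → X) :
    Option X → Term S :=
  fun o => o.elim (Term.app g fun i => Term.const (q (ys i))) fun u => Term.const (q u)

theorem not_deq_new (hT : ¬ Occurs Γ (Term.app g fun i => Term.const (q (ys i)))) (c : ℕ) :
    ¬ Deq Γ (Term.const c) (Term.app g fun i => Term.const (q (ys i))) :=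
  fun h => hT h.occurs_of_const

/-- If the value is a constant, the application occurs in `Γ`, and so do its arguments, none of
which can then be the new term. If the value is the new term, which does not occur, only congruence
at the root remains: the application is `g` with arguments equal to the given ones, and there is no
hole. -/
theorem extendFam_ctx (hT : ¬ Occurs Γ (Term.app g fun i => Term.const (q (ys i))))
    {f : Fin S.funs} {N : Set (Fin (S.arity f))} {p : Fin (S.arity f) → Term S}
    {z : HLit S (Option X) f} (hz : z ∈ ctxSet Γ (extendFam S q g ys) f N p)
    (hns : ∀ i ∈ N, ∀ u, ¬ Deq Γ (Term.const (q u)) (p i)) :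
    (∀ i, z.2 i ≠ some none) ∧ ((∃ v, z.1 = some v ∧ Occurs Γ (.app f (fill (extendFam S q g ys) p z.2))) ∨
      (z.1 = none ∧ N = ∅ ∧ f = g ∧ ∀ (i : Fin (S.arity f)) (j : Fin (S.arity g)), i.val = j.val →
        ∃ u, z.2 i = some (some u) ∧ Deq Γ (Term.const (q u)) (Term.const (q (ys j))))) := by
  obtain ⟨v, h⟩ := z
  obtain ⟨hN, hd⟩ := hz
  cases v with
  | some v =>
    have ho : Occurs Γ (.app f (fill (extendFam S q g ys) p h)) := Deq.occurs_of_const hd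
    refine ⟨fun i hi => hT ?_, Or.inl ⟨v, rfl, ho⟩⟩
    have := ho.arg i
    simp only at hi
    rwa [fill, hi] at this
  | none =>
    have hr : f = g ∧ ∀ (i : Fin (S.arity f)) (j : Fin (S.arity g)), i.val = j.val →
        Deq Γ (fill (extendFam S q g ys) p h i) (Term.const (q (ys j))) := by
      obtain ⟨h', -⟩ | h' | ⟨f', ss, ts, h1, h2, h3⟩ := Deq.cases hd
      · exact absurd h' hT
      · obtain ⟨rfl, h''⟩ := Term.app.inj h'
        refine ⟨rfl, fun i j hij => ?_⟩
        obtain rfl := Fin.ext hij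
        rw [← eq_of_heq h'']
        exact .refl _
      · obtain ⟨rfl, h1⟩ := Term.app.inj h1
        obtain ⟨rfl, h2⟩ := Term.app.inj h2
        refine ⟨rfl, fun i j hij => ?_⟩
        obtain rfl := Fin.ext hij
        have := (h3 i).symm
        rwa [← eq_of_heq h1, ← eq_of_heq h2] at this
    obtain ⟨rfl, hr⟩ := hr
    have hs : ∀ i : Fin (S.arity f), ∃ u, h i = some (some u) := by
      intro i
      have := hr i i rfl
      unfold fill at this
      match hi : h i with
      | none =>
        rw [hi] at this
        exact absurd (this.symm) (hns i ((hN i).1 hi) _)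
      | some none =>
        rw [hi] at this
        exact absurd this.symm (not_deq_new hT _)
      | some (some u) => exact ⟨u, rfl⟩
    refine ⟨fun i hi => ?_, Or.inr ⟨rfl, ?_, rfl, ?_⟩⟩
    · obtain ⟨u, hu⟩ := hs i
      simp_all
    · ext i
      obtain ⟨u, hu⟩ := hs i
      rw [← hN i]
      simp [hu]
    · intro i j hij
      obtain ⟨u, hu⟩ := hs i
      refine ⟨u, hu, ?_⟩
      have := hr i j hij
      rw [fill, hu] at this
      exact this

theorem fill_extendFam {k : ℕ} (p : Fin k → Term S) (h : Fin k → Option X) :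
    fill (extendFam S q g ys) p (fun i => (h i).map some) = fill (fun u => Term.const (q u)) p h := by
  funext i
  simp only [fill]
  cases h i <;> rfl

theorem exists_map_some {α : Type*} {h : α → Option (Option X)} (hh : ∀ i, h i ≠ some none) :
    ∃ h' : α → Option X, h = fun i => (h' i).map some := by
  have : ∀ i, ∃ o : Option X, h i = o.map some := by
    intro i
    match hi : h i with
    | none => exact ⟨none, rfl⟩
    | some none => exact absurd hi (hh i)
    | some (some u) => exact ⟨some u, rfl⟩
  choose h' hh' using this
  exact ⟨h', funext hh'⟩

/-- A term that does not occur up to congruence is equal only to terms congruent to it at the root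
and takes part in no disequality. The only new equations are its own ones. They have no holes, so
they enter the single context without holes, and all contexts with holes are merely lifted. -/
theorem keyOf_extend (hT : ¬ Occurs Γ (Term.app g fun i => Term.const (q (ys i)))) :
    keyOf Γ (extendFam S q g ys) = (keyOf Γ fun u => Term.const (q u)).extend g ys := by
  have hne : ∀ t, ¬ Derives Γ (Lit.ne (Term.app g fun i => Term.const (q (ys i))) t) := by
    intro t h
    obtain ⟨a, b, hab, h | h⟩ := derives_ne_iff.1 h
    · exact hT (occurs_iff.2 ⟨_, (mem_termsOf_ne hab).1, h.1⟩)
    · exact hT (occurs_iff.2 ⟨_, (mem_termsOf_ne hab).2, h.1⟩)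
  have hlift : ∀ f (N : Set (Fin (S.arity f))) p, N.Nonempty →
      (∀ i ∈ N, ∀ u, ¬ Deq Γ (Term.const (q u)) (p i)) →
      ctxSet Γ (extendFam S q g ys) f N p =
        liftCtx (ctxSet Γ (fun u => Term.const (q u)) f N p) := by
    intro f N p hNe hns
    ext z
    constructor
    · intro hz
      obtain ⟨h1, ⟨v, hv, -⟩ | ⟨-, h2, -⟩⟩ := extendFam_ctx hT hz hns
      · obtain ⟨h', hh'⟩ := exists_map_some h1
        obtain ⟨z1, z2⟩ := z
        simp only at hv hh'
        subst hv hh'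
        refine ⟨(v, h'), ⟨fun i => ?_, ?_⟩, rfl⟩
        · rw [← hz.1 i]
          simp
        · have := hz.2
          rwa [fill_extendFam] at this
      · exact absurd h2 hNe.ne_empty
    · rintro ⟨w, hw, rfl⟩
      refine ⟨fun i => ?_, ?_⟩
      · rw [← hw.1 i]
        simp
      · simp only [fill_extendFam]
        exact hw.2
  have hfull : ∀ f p, ctxSet Γ (extendFam S q g ys) f ∅ p =
      (keyOf Γ fun u => Term.const (q u)).fullCtx g ys f := by
    intro f p
    ext z
    constructor
    · intro hz
      obtain ⟨h1, h2⟩ := extendFam_ctx hT hz (by simp)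
      have h3 : ∀ i, ∃ u, z.2 i = some (some u) := by
        intro i
        match hi : z.2 i with
        | none => exact absurd ((hz.1 i).1 hi) (by simp)
        | some none => exact absurd hi (h1 i)
        | some (some u) => exact ⟨u, rfl⟩
      choose h hh using h3
      obtain ⟨z1, z2⟩ := z
      simp only at hh
      obtain rfl : z2 = fun i => (some (some (h i))) := funext hh
      obtain ⟨v, hv, ho⟩ | ⟨hv, -, hfg, h4⟩ := h2
      · simp only at hv
        subst hv
        have hmem : (v, fun i => some (h i)) ∈ ctxSet Γ (fun u => Term.const (q u)) f ∅ p := by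
          refine ⟨by simp, ?_⟩
          have := hz.2
          rwa [← fill_extendFam (g := g) (ys := ys)]
        -- Positive arity supplies the position that is not a hole.
        exact Or.inl ⟨v, h, rfl, _, ⟨∅, p, ⟨⟨0, S.arity_pos f⟩, by simp⟩, by simp, rfl, _, hmem⟩, hmem⟩
      · simp only at hv
        subst hv
        refine Or.inr ⟨h, rfl, hfg, fun i j hij => ?_⟩
        obtain ⟨u, hu, hd⟩ := h4 i j hij
        simp only [Option.some.injEq] at hu
        subst hu
        exact hd
    · rintro (⟨v, h, rfl, Z, ⟨N, p', -, hns, rfl, -⟩, hZ⟩ | ⟨h, rfl, rfl, hE⟩)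
      · refine ⟨by simp, ?_⟩
        have := hZ.2
        rwa [← fill_extendFam (g := g) (ys := ys)] at this
      · refine ⟨by simp, .cong fun i => ?_⟩
        exact (hE i i rfl).symm
  apply Key.ext
  · funext u v
    cases u <;> cases v <;> simp only [keyOf, Key.extend, extendFam, Option.elim, eq_iff_iff]
    · exact ⟨fun _ => trivial, fun _ => .refl _⟩
    · exact ⟨fun h => not_deq_new hT _ h.symm, False.elim⟩
    · exact ⟨fun h => not_deq_new hT _ h, False.elim⟩
  · funext u v
    cases u <;> cases v <;> simp only [keyOf, Key.extend, extendFam, Option.elim, eq_iff_iff]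
    · exact ⟨hne _, False.elim⟩
    · exact ⟨hne _, False.elim⟩
    · exact ⟨fun h => hne _ h.ne_symm, False.elim⟩
  · funext f
    ext Z'
    constructor
    · rintro ⟨N, p, hN, hns, rfl, hZ⟩
      by_cases hNe : N.Nonempty
      · have hns' : ∀ i ∈ N, ∀ u, ¬ Deq Γ (Term.const (q u)) (p i) :=
          fun i hi u => hns i hi (some u)
        rw [hlift f N p hNe hns'] at hZ ⊢
        obtain ⟨_, w, hw, -⟩ := hZ
        obtain ⟨i, hi⟩ := hNe
        exact Or.inl ⟨_, ⟨N, p, hN, hns', rfl, w, hw⟩, fun z hz => ⟨i, (hz.1 i).2 hi⟩, rfl⟩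
      · rw [Set.not_nonempty_iff_eq_empty] at hNe
        subst hNe
        exact Or.inr ⟨hfull f p, hZ⟩
    · rintro (⟨Z, ⟨N, p, hN, hns, rfl, w, hw⟩, hh, rfl⟩ | ⟨rfl, hZ⟩)
      · obtain ⟨i, hi⟩ := hh w hw
        have hNe : N.Nonempty := ⟨i, (hw.1 i).1 hi⟩
        refine ⟨N, p, hN, ?_, (hlift f N p hNe hns).symm, _, w, hw, rfl⟩
        intro i hi u
        cases u with
        | some u => exact hns i hi u
        | none =>
          intro h
          -- The context contains an equation whose value is a constant, so its parameters occur;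
          -- the new term does not.
          have ho := occurs_param hw (Deq.occurs_of_const hw.2) i hi
          exact hT (Deq.occurs h.symm ho)
      · refine ⟨∅, fun _ => Term.const 0, ⟨⟨0, S.arity_pos f⟩, by simp⟩, by simp, ?_, hZ⟩
        exact (hfull f _).symm

end

end UP

/-! ### Change of keys under assumptions -/

namespace UP

variable {S : Sig} {X Y : Type}

/-! ### Saturation -/

/-- The least equivalence relation that contains the equalities and respects the contexts. -/
inductive Key.Cl (κ : Key S X) : X → X → Prop
  | base {u v} : κ.E u v → Key.Cl κ u v
  | refl (u) : Key.Cl κ u u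
  | symm {u v} : Key.Cl κ u v → Key.Cl κ v u
  | trans {u v w} : Key.Cl κ u v → Key.Cl κ v w → Key.Cl κ u w
  | ctx {f : Fin S.funs} {Z : Set (HLit S X f)} {v v' : X} {h h' : Fin (S.arity f) → Option X} :
      Z ∈ κ.C f → (v, h) ∈ Z → (v', h') ∈ Z →
      (∀ i y y', h i = some y → h' i = some y' → Key.Cl κ y y') → Key.Cl κ v v'

/-- A relation, extended to holes. -/
def HoleRel (R : X → X → Prop) (o o' : Option X) : Prop :=
  (o = none ↔ o' = none) ∧ ∀ y y', o = some y → o' = some y' → R y y'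

def closeCtx (R : X → X → Prop) {f : Fin S.funs} (Z : Set (HLit S X f)) : Set (HLit S X f) :=
  {z | ∃ w ∈ Z, R w.1 z.1 ∧ ∀ i, HoleRel R (w.2 i) (z.2 i)}

/-- The key generated by the recorded literals: congruence closure restricted to the indices, with
disequalities and contexts transported along it. -/
def Key.sat (κ : Key S X) : Key S X where
  E := κ.Cl
  D u v := ∃ u' v', κ.D u' v' ∧ ((κ.Cl u u' ∧ κ.Cl v v') ∨ (κ.Cl u v' ∧ κ.Cl v u'))
  C f := {Z' | ∃ Z ∈ κ.C f, Z' = closeCtx κ.Cl Z}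

def Key.addEq (κ : Key S X) (x y : X) : Key S X :=
  { κ with E := fun u v => κ.E u v ∨ (u = x ∧ v = y) }

/-- The new disequality is transported along the old equalities at once, since no further equality
arises; by contrast, `addEq` must be followed by `sat`. -/
def Key.addNe (κ : Key S X) (x y : X) : Key S X :=
  { κ with D := fun u v => κ.D u v ∨ (κ.E u x ∧ κ.E v y) ∨ (κ.E u y ∧ κ.E v x) }

theorem deq_fill_of_holeRel {Γ : Set (Lit S)} {Q : X → Term S} {f : Fin S.funs}
    {p : Fin (S.arity f) → Term S} {h h' : Fin (S.arity f) → Option X}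
    (hh : ∀ i, HoleRel (fun u v => Deq Γ (Q u) (Q v)) (h i) (h' i)) :
    Deq Γ (.app f (fill Q p h)) (.app f (fill Q p h')) := by
  refine .cong fun i => ?_
  unfold fill
  cases hi : h i with
  | none => rw [(hh i).1.1 hi]; exact .refl _
  | some y =>
    cases hi' : h' i with
    | none => rw [(hh i).1.2 hi'] at hi; cases hi
    | some y' => exact (hh i).2 y y' hi hi'

theorem holeRel_of_masks {R : X → X → Prop} {k : ℕ} {h h' : Fin k → Option X} {N : Set (Fin k)}
    (h₁ : ∀ i, h i = none ↔ i ∈ N) (h₂ : ∀ i, h' i = none ↔ i ∈ N)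
    (hR : ∀ i y y', h i = some y → h' i = some y' → R y y') (i : Fin k) :
    HoleRel R (h i) (h' i) :=
  ⟨(h₁ i).trans (h₂ i).symm, hR i⟩

/-! ### Disequality assumptions -/

theorem deq_insert_ne {Γ : Set (Lit S)} {a b s t : Term S} :
    Deq (insert (Lit.ne a b) Γ) s t ↔ Deq Γ s t := by
  refine ⟨fun h => ?_, Derives.mono (Set.subset_insert _ _)⟩
  refine Deq.induct (P := Deq Γ) ?_ .refl (fun _ _ _ => .symm) (fun _ _ _ _ _ => .trans)
    (fun _ _ _ _ => .cong) h
  rintro s t (h | h)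
  · cases h
  · exact .ax h

theorem keyOf_insert_ne (Γ : Set (Lit S)) (Q : X → Term S) (x y : X) :
    keyOf (insert (Lit.ne (Q x) (Q y)) Γ) Q = (keyOf Γ Q).addNe x y := by
  apply Key.ext
  · funext u v
    exact propext deq_insert_ne
  · funext u v
    simp only [keyOf, Key.addNe, eq_iff_iff]
    rw [derives_ne_iff]
    constructor
    · rintro ⟨a, b, hab | hab, h⟩
      · cases hab
        simp only [deq_insert_ne] at h
        exact Or.inr h
      · simp only [deq_insert_ne] at h
        exact Or.inl (derives_ne_iff.2 ⟨a, b, hab, h⟩)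
    · rintro (h | h)
      · obtain ⟨a, b, hab, h⟩ := derives_ne_iff.1 h
        refine ⟨a, b, Or.inr hab, ?_⟩
        simpa only [deq_insert_ne] using h
      · refine ⟨_, _, Or.inl rfl, ?_⟩
        simpa only [deq_insert_ne] using h
  · funext f
    simp only [keyOf, Key.addNe, ctxSet, deq_insert_ne]

theorem satisfiable_insert_ne {Γ : Set (Lit S)} (hΓ : Satisfiable Γ) {a b : Term S} :
    Satisfiable (insert (Lit.ne a b) Γ) ↔ ¬ Deq Γ a b := by
  rw [satisfiable_iff] at hΓ ⊢
  simp only [deq_insert_ne]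
  constructor
  · exact fun h => h a b (Or.inl rfl)
  · rintro h s t (h' | h')
    · cases h'
      exact h
    · exact hΓ s t h'

/-! ### Equality assumptions -/

section

variable {Γ : Set (Lit S)} {q : X → ℕ} {x y : X}

/-- The term is equal to one that contains `q(x)` or `q(y)`. -/
def Super (Γ : Set (Lit S)) (q : X → ℕ) (x y : X) (t : Term S) : Prop :=
  ∃ s : Term S, (Term.const (q x) ∈ s.subterms ∨ Term.const (q y) ∈ s.subterms) ∧ Deq Γ t s

theorem Super.congr {s t : Term S} (h : Super Γ q x y t) (hst : Deq Γ s t) : Super Γ q x y s :=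
  let ⟨r, hr, h⟩ := h
  ⟨r, hr, hst.trans h⟩

theorem Super.app {f : Fin S.funs} {ts : Fin (S.arity f) → Term S} (i : Fin (S.arity f))
    (h : Super Γ q x y (ts i)) : Super Γ q x y (.app f ts) := by
  classical
  obtain ⟨r, hr, h⟩ := h
  refine ⟨.app f (Function.update ts i r), hr.imp ?_ ?_, .cong fun j => ?_⟩
  · exact fun hr => Term.arg_mem_subterms i (by rwa [Function.update_self])
  · exact fun hr => Term.arg_mem_subterms i (by rwa [Function.update_self])
  · by_cases hj : j = i
    · subst hj
      rwa [Function.update_self]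
    · rw [Function.update_of_ne hj]
      exact .refl _

variable (Γ q x y) in
/-- The equalities between indices after `q(x) ≈ q(y)` is added. -/
abbrev MergeIdx : X → X → Prop := ((keyOf Γ fun u => Term.const (q u)).addEq x y).Cl

theorem MergeIdx.deq {u v : X} (h : MergeIdx Γ q x y u v) :
    Deq (insert (Lit.eq (.const (q x)) (.const (q y))) Γ) (.const (q u)) (.const (q v)) := by
  induction h with
  | base h =>
    obtain h | ⟨rfl, rfl⟩ := h
    · exact Derives.mono (Set.subset_insert _ _) h
    · exact .ax (Or.inl rfl)
  | refl u => exact .refl _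
  | symm _ ih => exact ih.symm
  | trans _ _ ih₁ ih₂ => exact ih₁.trans ih₂
  | ctx hZ hv hv' _ ih =>
    obtain ⟨N, p, -, -, rfl, -⟩ := hZ
    refine (Derives.mono (Set.subset_insert _ _) hv.2).trans
      (Derives.trans ?_ (Derives.mono (Set.subset_insert _ _) hv'.2).symm)
    exact deq_fill_of_holeRel (holeRel_of_masks hv.1 hv'.1 ih)

/-- A merge through a context either uses only old equalities of arguments, and then yields an old
equality, or has an argument pair that is new. In that case both arguments are superterms by
induction, hence so are the two applications and the values. -/
theorem MergeIdx.super {u v : X} (h : MergeIdx Γ q x y u v) :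
    Deq Γ (.const (q u)) (.const (q v)) ∨
      (Super Γ q x y (.const (q u)) ∧ Super Γ q x y (.const (q v))) := by
  induction h with
  | base h =>
    obtain h | ⟨rfl, rfl⟩ := h
    · exact Or.inl h
    · exact Or.inr ⟨⟨_, Or.inl (Term.self_mem_subterms _), .refl _⟩,
        ⟨_, Or.inr (Term.self_mem_subterms _), .refl _⟩⟩
  | refl u => exact Or.inl (.refl _)
  | symm _ ih => exact ih.imp .symm And.symm
  | trans _ _ ih₁ ih₂ =>
    obtain h₁ | h₁ := ih₁ <;> obtain h₂ | h₂ := ih₂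
    · exact Or.inl (h₁.trans h₂)
    · exact Or.inr ⟨h₂.1.congr h₁, h₂.2⟩
    · exact Or.inr ⟨h₁.1, h₁.2.congr h₂.symm⟩
    · exact Or.inr ⟨h₁.1, h₂.2⟩
  | @ctx f Z v v' h h' hZ hv hv' _ ih =>
    obtain ⟨N, p, -, -, rfl, -⟩ := hZ
    by_cases hall : ∀ i y₁ y₂, h i = some y₁ → h' i = some y₂ →
        Deq Γ (.const (q y₁)) (.const (q y₂))
    · refine Or.inl (Derives.trans hv.2 (Derives.trans ?_ (Derives.symm hv'.2)))
      exact deq_fill_of_holeRel (holeRel_of_masks hv.1 hv'.1 hall)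
    · push Not at hall
      obtain ⟨i, y₁, y₂, h₁, h₂, hne⟩ := hall
      obtain ⟨hs₁, hs₂⟩ := (ih i y₁ y₂ h₁ h₂).resolve_left hne
      refine Or.inr ⟨Super.congr (Super.app i ?_) hv.2, Super.congr (Super.app i ?_) hv'.2⟩
      · simpa [fill, h₁] using hs₁
      · simpa [fill, h₂] using hs₂

variable (Γ q x y) in
/-- The equality of known terms after `q(x) ≈ q(y)` is added. -/
def mergeSetoid : Setoid (Term S) where
  r s t := Deq Γ s t ∨ ∃ u v, MergeIdx Γ q x y u v ∧ Deq Γ s (.const (q u)) ∧ Deq Γ (.const (q v)) t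
  iseqv := by
    refine ⟨fun s => Or.inl (.refl _), ?_, ?_⟩
    · rintro s t (h | ⟨u, v, h, hs, ht⟩)
      · exact Or.inl h.symm
      · exact Or.inr ⟨v, u, h.symm, ht.symm, hs.symm⟩
    · rintro s t r (h | ⟨u, v, h, hs, ht⟩) (h' | ⟨u', v', h', hs', ht'⟩)
      · exact Or.inl (h.trans h')
      · exact Or.inr ⟨u', v', h', h.trans hs', ht'⟩
      · exact Or.inr ⟨u, v, h, hs, ht.trans h'⟩
      · exact Or.inr ⟨u, v', h.trans (.trans (.base (Or.inl (ht.trans hs'))) h'), hs, ht'⟩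

variable (Γ q x y) in
def mergeClass (t : Term S) : Quotient (mergeSetoid Γ q x y) := Quotient.mk _ t

theorem mergeClass_eq_iff {s t : Term S} : mergeClass Γ q x y s = mergeClass Γ q x y t ↔
    Deq Γ s t ∨ ∃ u v, MergeIdx Γ q x y u v ∧ Deq Γ s (.const (q u)) ∧ Deq Γ (.const (q v)) t :=
  Quotient.eq (r := mergeSetoid Γ q x y)

theorem mergeClass_const {u : X} {t : Term S} :
    mergeClass Γ q x y (.const (q u)) = mergeClass Γ q x y t ↔
      ∃ v, MergeIdx Γ q x y u v ∧ Deq Γ (.const (q v)) t := by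
  rw [mergeClass_eq_iff]
  constructor
  · rintro (h | ⟨u', v, h, hu, hv⟩)
    · exact ⟨u, .refl _, h⟩
    · exact ⟨v, .trans (.base (Or.inl hu)) h, hv⟩
  · rintro ⟨v, h, hv⟩
    exact Or.inr ⟨u, v, h, .refl _, hv⟩

theorem deq_of_mergeClass {s t : Term S} (h : mergeClass Γ q x y s = mergeClass Γ q x y t) :
    Deq (insert (Lit.eq (.const (q x)) (.const (q y))) Γ) s t := by
  obtain h | ⟨u, v, h, hs, ht⟩ := mergeClass_eq_iff.1 h
  · exact Derives.mono (Set.subset_insert _ _) h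
  · exact (Derives.mono (Set.subset_insert _ _) hs).trans
      (h.deq.trans (Derives.mono (Set.subset_insert _ _) ht))

variable (Γ q x y) in
/-- All superterms of `q(x)` and `q(y)` are stored. -/
def StoredSupers : Prop := ∀ t, Occurs Γ t → Super Γ q x y t → ∃ v, Deq Γ (.const (q v)) t

/-- This is where the early-assume condition enters. If two applications in `Γ` get equal arguments
and some argument equality is new, both applications are superterms of the merged constants, hence
stored; the two resulting equations lie in one context, so the closure identifies their values. -/
theorem mergeClass_compat (hs : StoredSupers Γ q x y) : Compat Γ (mergeClass Γ q x y) := by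
  intro f zs zs' hz hz' h
  by_cases hall : ∀ i, Deq Γ (zs i) (zs' i)
  · exact mergeClass_eq_iff.2 (Or.inl (.cong hall))
  push Not at hall
  obtain ⟨i₀, hi₀⟩ := hall
  have hm := fun i => mergeClass_eq_iff.1 (h i)
  obtain ⟨u₀, v₀, huv, hu, hv⟩ := (hm i₀).resolve_left hi₀
  have hsup := huv.super.resolve_left fun h' => hi₀ (hu.trans (h'.trans hv))
  obtain ⟨w, hw⟩ := hs _ (.of_mem hz) (Super.app i₀ (hsup.1.congr hu))
  obtain ⟨w', hw'⟩ := hs _ (.of_mem hz') (Super.app i₀ (hsup.2.congr hv.symm))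
  -- A stored argument pair is written as a pair of related indices. An argument that is not stored
  -- is unaffected by the merge and becomes a hole, with a common parameter for both applications.
  have hex : ∀ i, ∃ o o' : Option X, HoleRel (MergeIdx Γ q x y) o o' ∧
      (o = none → (∀ u, ¬ Deq Γ (.const (q u)) (zs i)) ∧ Deq Γ (zs i) (zs' i)) ∧
      (∀ u, o = some u → Deq Γ (.const (q u)) (zs i)) ∧
      (∀ u, o' = some u → Deq Γ (.const (q u)) (zs' i)) := by
    intro i
    obtain h | ⟨u, v, h, hu, hv⟩ := hm i
    · by_cases hst : ∃ u, Deq Γ (.const (q u)) (zs i)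
      · obtain ⟨u, hu⟩ := hst
        refine ⟨some u, some u, ⟨by simp, ?_⟩, by simp, ?_, ?_⟩
        · rintro _ _ ⟨⟩ ⟨⟩
          exact .refl _
        · rintro _ ⟨⟩
          exact hu
        · rintro _ ⟨⟩
          exact hu.trans h
      · push Not at hst
        exact ⟨none, none, ⟨by simp, by simp⟩, fun _ => ⟨hst, h⟩, by simp, by simp⟩
    · refine ⟨some u, some v, ⟨by simp, ?_⟩, by simp, ?_, ?_⟩
      · rintro _ _ ⟨⟩ ⟨⟩
        exact h
      · rintro _ ⟨⟩
        exact hu.symm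
      · rintro _ ⟨⟩
        exact hv
  choose o o' hR hn ho ho' using hex
  have h₁ : (w, o) ∈ ctxSet Γ (fun u => Term.const (q u)) f {i | o i = none} zs := by
    refine ⟨fun i => Iff.rfl, Derives.trans hw (.cong fun i => ?_)⟩
    simp only [fill]
    cases hoi : o i with
    | none => exact .refl _
    | some u => exact (ho i u hoi).symm
  have h₂ : (w', o') ∈ ctxSet Γ (fun u => Term.const (q u)) f {i | o i = none} zs := by
    refine ⟨fun i => (hR i).1.symm, Derives.trans hw' (.cong fun i => ?_)⟩
    simp only [fill]
    cases hoi : o' i with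
    | none => exact (hn i ((hR i).1.2 hoi)).2.symm
    | some u => exact (ho' i u hoi).symm
  refine mergeClass_eq_iff.2 (Or.inr ⟨w, w', .ctx (f := f) ?_ h₁ h₂ fun i => (hR i).2, hw.symm, hw'⟩)
  refine ⟨_, zs, ⟨i₀, fun h => ?_⟩, fun i hi => (hn i hi).1, rfl, _, h₁⟩
  -- The argument at `i₀` is stored in `u₀`, so `i₀` is the required position without a hole.
  exact (hn i₀ h).1 u₀ hu.symm

variable (Γ q x y) in
noncomputable abbrev mergeNF : Term S → NF S (Quotient (mergeSetoid Γ q x y)) := nf Γ (mergeClass Γ q x y)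

/-- Normal forms bound what the new equality can derive; `deq_of_mergeNF` is the converse for terms
whose normal form is the class of a given term. -/
theorem mergeNF_eq (hs : StoredSupers Γ q x y) {s t : Term S}
    (h : Deq (insert (Lit.eq (.const (q x)) (.const (q y))) Γ) s t) :
    mergeNF Γ q x y s = mergeNF Γ q x y t := by
  refine nf_eq_of_deq ?_ h
  rintro s t (h | h)
  · cases h
    simp only [nf]
    congr 1
    exact mergeClass_const.2 ⟨y, .base (Or.inr ⟨rfl, rfl⟩), .refl _⟩
  · rw [nf_of_mem (mergeClass_compat hs) (mem_termsOf_eq h).1,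
      nf_of_mem (mergeClass_compat hs) (mem_termsOf_eq h).2]
    congr 1
    exact mergeClass_eq_iff.2 (Or.inl (.ax h))

theorem deq_of_mergeNF {s z : Term S}
    (h : mergeNF Γ q x y s = .base (mergeClass Γ q x y z)) :
    Deq (insert (Lit.eq (.const (q x)) (.const (q y))) Γ) s z := by
  induction s generalizing z with
  | const c =>
    refine deq_of_mergeClass ?_
    simp only [mergeNF, nf] at h
    injection h
  | app f ts ih =>
    obtain ⟨zs, hz, hzs, h⟩ := nf_app_eq_base h
    exact (Derives.cong fun i => ih i (hzs i)).trans (deq_of_mergeClass h)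

theorem mergeClass_of_deq (hs : StoredSupers Γ q x y) {u : X} {t : Term S} (ht : t ∈ termsOf Γ)
    (h : Deq (insert (Lit.eq (.const (q x)) (.const (q y))) Γ) (.const (q u)) t) :
    ∃ v, MergeIdx Γ q x y u v ∧ Deq Γ (.const (q v)) t := by
  have := mergeNF_eq hs h
  rw [mergeNF, nf_of_mem (mergeClass_compat hs) ht, nf] at this
  injection this with this
  exact mergeClass_const.1 this

theorem mergeIdx_iff (hs : StoredSupers Γ q x y) {u v : X} : MergeIdx Γ q x y u v ↔
    Deq (insert (Lit.eq (.const (q x)) (.const (q y))) Γ) (.const (q u)) (.const (q v)) := by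
  refine ⟨MergeIdx.deq, fun h => ?_⟩
  have := mergeNF_eq hs h
  simp only [mergeNF, nf] at this
  injection this with this
  obtain ⟨w, hw, hwv⟩ := mergeClass_const.1 this
  exact hw.trans (.base (Or.inl hwv))

/-- All identifications pass through merged indices. Hence the new equalities between indices are
the closure, the sides of an assumed disequality, being terms of `Γ`, can be replaced by indices
when they become stored, and a parameter that is not stored before stays so and is not identified
with another parameter. -/
theorem keyOf_assumeEq (hs : StoredSupers Γ q x y) :
    keyOf (insert (Lit.eq (.const (q x)) (.const (q y))) Γ) (fun u => Term.const (q u)) =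
      ((keyOf Γ fun u => Term.const (q u)).addEq x y).sat := by
  set Δ := insert (Lit.eq (.const (q x)) (.const (q y))) Γ with hΔ
  have hmono : ∀ {l}, Derives Γ l → Derives Δ l := Derives.mono (Set.subset_insert _ _)
  -- the context with parameters `p` over `Δ` is the closure of one over `Γ`
  have hctx : ∀ f N (p zs : Fin (S.arity f) → Term S),
      (∀ i ∈ N, mergeNF Γ q x y (p i) = .base (mergeClass Γ q x y (zs i))) →
      (∀ i ∈ N, ∀ u, ¬ Deq Γ (.const (q u)) (zs i)) →
      ctxSet Δ (fun u => Term.const (q u)) f N p =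
        closeCtx (MergeIdx Γ q x y) (ctxSet Γ (fun u => Term.const (q u)) f N zs) := by
    intro f N p zs hp hns
    ext ⟨v, h⟩
    constructor
    · rintro ⟨hN, hd⟩
      have := mergeNF_eq hs hd
      simp only [mergeNF, nf.eq_1] at this
      obtain ⟨ws, hw, hws, hv⟩ := nf_app_eq_base this.symm
      obtain ⟨v', hv', hd'⟩ := mergeClass_const.1 hv.symm
      have hex : ∀ i, ∃ o : Option X, HoleRel (MergeIdx Γ q x y) o (h i) ∧
          (∀ u, o = some u → Deq Γ (.const (q u)) (ws i)) ∧ (o = none → Deq Γ (zs i) (ws i)) := by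
        intro i
        have hi := hws i
        unfold fill at hi
        cases hhi : h i with
        | none =>
          rw [hhi] at hi
          have hiN := (hN i).1 hhi
          have := (hp i hiN).symm.trans hi
          injection this with this
          refine ⟨none, ⟨by simp, by simp⟩, by simp, fun _ => ?_⟩
          refine (mergeClass_eq_iff.1 this).resolve_right ?_
          rintro ⟨u, v, -, hu, -⟩
          exact hns i hiN u hu.symm
        | some y₁ =>
          rw [hhi] at hi
          simp only [Option.elim, nf] at hi
          injection hi with hi
          obtain ⟨y₂, h₁, h₂⟩ := mergeClass_const.1 hi
          refine ⟨some y₂, ⟨by simp, ?_⟩, ?_, by simp⟩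
          · rintro _ _ ⟨⟩ ⟨⟩
            exact h₁.symm
          · rintro _ ⟨⟩
            exact h₂
      choose o ho hou hon using hex
      refine ⟨(v', o), ⟨fun i => ((ho i).1).trans (hN i), Derives.trans hd' (.cong fun i => ?_)⟩,
        hv'.symm, ho⟩
      simp only [fill]
      cases hoi : o i with
      | none => exact (hon i hoi).symm
      | some u => exact (hou i u hoi).symm
    · rintro ⟨⟨v', h'⟩, ⟨hN, hd⟩, hv, hh⟩
      have hN' : ∀ i, h i = none ↔ i ∈ N := fun i => ((hh i).1).symm.trans (hN i)
      refine ⟨hN', (MergeIdx.deq hv).symm.trans ((hmono hd).trans ?_)⟩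
      refine Derives.trans (deq_app_fill (fun _ => .refl _) (p' := p) fun i hi =>
        (deq_of_mergeNF (hp i ((hN i).1 hi))).symm) ?_
      refine deq_fill_of_holeRel fun i => ⟨(hh i).1, fun y₁ y₂ h₁ h₂ => ?_⟩
      exact MergeIdx.deq ((hh i).2 y₁ y₂ h₁ h₂)
  apply Key.ext
  · funext u v
    exact propext (mergeIdx_iff hs).symm
  · funext u v
    simp only [keyOf, Key.sat, eq_iff_iff]
    constructor
    · intro h
      obtain ⟨a, b, hab, h⟩ := derives_ne_iff.1 h
      have hab : Lit.ne a b ∈ Γ := by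
        obtain hab | hab := hab
        · cases hab
        · exact hab
      have ha := (mem_termsOf_ne hab).1
      have hb := (mem_termsOf_ne hab).2
      obtain ⟨h₁, h₂⟩ | ⟨h₁, h₂⟩ := h
      · obtain ⟨u', hu, hu'⟩ := mergeClass_of_deq hs ha h₁
        obtain ⟨v', hv, hv'⟩ := mergeClass_of_deq hs hb h₂
        exact ⟨u', v', (Derives.ax hab).ne_congr hu'.symm hv'.symm, Or.inl ⟨hu, hv⟩⟩
      · obtain ⟨u', hu, hu'⟩ := mergeClass_of_deq hs hb h₁
        obtain ⟨v', hv, hv'⟩ := mergeClass_of_deq hs ha h₂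
        exact ⟨v', u', (Derives.ax hab).ne_congr hv'.symm hu'.symm, Or.inr ⟨hu, hv⟩⟩
    · rintro ⟨u', v', h, ⟨hu, hv⟩ | ⟨hu, hv⟩⟩
      · exact (hmono h).ne_congr (MergeIdx.deq hu).symm (MergeIdx.deq hv).symm
      · exact ((hmono h).ne_congr (MergeIdx.deq hv).symm (MergeIdx.deq hu).symm).ne_symm
  · funext f
    ext Z
    constructor
    · rintro ⟨N, p, hN, hns, rfl, ⟨v, h⟩, hz⟩
      have hd := mergeNF_eq hs hz.2
      simp only [mergeNF, nf.eq_1] at hd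
      -- The equation has a constant on one side, so the normal form of the application is a class;
      -- this gives terms of `Γ` that are equal to the parameters after the assumption.
      obtain ⟨zs, hzs, hws, -⟩ := nf_app_eq_base hd.symm
      have hp : ∀ i ∈ N, mergeNF Γ q x y (p i) = .base (mergeClass Γ q x y (zs i)) := by
        intro i hi
        have := hws i
        rwa [fill, show h i = none from (hz.1 i).2 hi] at this
      have hns' : ∀ i ∈ N, ∀ u, ¬ Deq Γ (.const (q u)) (zs i) :=
        fun i hi u hu => hns i hi u ((hmono hu).trans (deq_of_mergeNF (hp i hi)).symm)
      have hc := hctx f N p zs hp hns'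
      refine ⟨_, ⟨N, zs, hN, hns', rfl, ?_⟩, hc⟩
      rw [hc] at hz
      obtain ⟨w, hw, -⟩ := hz
      exact ⟨w, hw⟩
    · rintro ⟨_, ⟨N, p, hN, hns, rfl, ⟨v, h⟩, hz⟩, rfl⟩
      have hp₀ : ∀ i ∈ N, Occurs Γ (p i) := occurs_param hz (Deq.occurs_of_const hz.2)
      have hex : ∀ i, ∃ t, i ∈ N → t ∈ termsOf Γ ∧ Deq Γ (p i) t := by
        intro i
        by_cases hi : i ∈ N
        · obtain ⟨t, ht⟩ := (hp₀ i hi).exists_mem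
          exact ⟨t, fun _ => ht⟩
        · exact ⟨p i, fun h => absurd h hi⟩
      choose t ht using hex
      have hnt : ∀ i ∈ N, ∀ u, ¬ Deq Γ (.const (q u)) (t i) :=
        fun i hi u hu => hns i hi u (hu.trans (ht i hi).2.symm)
      have hc := hctx f N t t
        (fun i hi => nf_of_mem (mergeClass_compat hs) (ht i hi).1) hnt
      rw [ctxSet_congr fun i hi => (ht i hi).2] at hz ⊢
      refine ⟨N, t, hN, ?_, hc.symm, (v, h), (v, h), hz, .refl _, fun i => ⟨Iff.rfl, ?_⟩⟩
      · intro i hi u hu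
        obtain ⟨w, -, hw⟩ := mergeClass_of_deq hs (ht i hi).1 hu
        exact hnt i hi w hw
      · intro y₁ y₂ h₁ h₂
        rw [h₁] at h₂
        cases h₂
        exact .refl _

/-- A conflict is an assumed disequality whose sides become equal. Since the equality is not an old
one, it goes through merged indices, and the disequality can be moved to these; so the key detects
every conflict. -/
theorem satisfiable_assumeEq (hΓ : Satisfiable Γ) (hs : StoredSupers Γ q x y) :
    Satisfiable (insert (Lit.eq (.const (q x)) (.const (q y))) Γ) ↔
      ¬ ∃ u v, (keyOf Γ fun u => Term.const (q u)).D u v ∧ MergeIdx Γ q x y u v := by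
  constructor
  · rintro ⟨M, hM⟩ ⟨u, v, hD, hR⟩
    exact (Derives.mono (Set.subset_insert _ _) hD).sound M hM (hR.deq.sound M hM)
  · intro h
    rw [satisfiable_iff] at hΓ ⊢
    rintro s t (hst | hst) hd
    · cases hst
    have := mergeNF_eq hs hd
    rw [mergeNF, nf_of_mem (mergeClass_compat hs) (mem_termsOf_ne hst).1,
      nf_of_mem (mergeClass_compat hs) (mem_termsOf_ne hst).2] at this
    injection this with this
    obtain h' | ⟨u, v, hR, hu, hv⟩ := mergeClass_eq_iff.1 this
    · exact hΓ s t hst h'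
    · exact h ⟨u, v, (Derives.ax hst).ne_congr hu hv.symm, hR⟩

end

end UP

/-! ### Program steps as actions on keys -/

namespace UP

variable {S : Sig} {X Y : Type}

/-! ### Actions of programs -/

def Stmt.isSkip : Stmt S → Bool
  | skip => true
  | _ => false

theorem Stmt.isSkip_iff {s : Stmt S} : s.isSkip = true ↔ s = skip := by
  cases s <;> simp [isSkip]

/-- The possible next actions together with the statements that remain; the action `skip` stands
for a step that does not change the state or the path condition. -/
def Stmt.next : Stmt S → List (Stmt S × Stmt S)
  | skip => []
  | copy x y => [(copy x y, skip)]
  | assign x f ys => [(assign x f ys, skip)]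
  | assume b => [(assume b, skip)]
  | seq s₁ s₂ => (if s₁.isSkip then [(skip, s₂)] else []) ++ s₁.next.map fun p => (p.1, seq p.2 s₂)
  | ite b s₁ s₂ => [(skip, seq (assume b) s₁), (skip, seq (assume b.neg) s₂)]
  | loop b s => [(skip, ite b (seq s (loop b s)) skip)]

/-- The effect of an action. -/
def Act : Stmt S → (Fin S.vars → ℕ) → Set (Lit S) → (Fin S.vars → ℕ) → Set (Lit S) → Prop
  | .copy x y, q, pc, q', pc' => ∃ x', x' ∉ constsOf pc ∧ x' ∉ Set.range q ∧
      q' = Function.update q x x' ∧ pc' = insert (Lit.eq (.const x') (.const (q y))) pc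
  | .assign x f ys, q, pc, q', pc' => ∃ x', x' ∉ constsOf pc ∧ x' ∉ Set.range q ∧
      q' = Function.update q x x' ∧ pc' = insert (Lit.eq (.const x') (appValue q f ys)) pc
  | .assume b, q, pc, q', pc' => Satisfiable (insert (b.value q) pc) ∧ q' = q ∧
      pc' = insert (b.value q) pc
  | _, q, pc, q', pc' => q' = q ∧ pc' = pc

/-- With `step_of_next`, this separates a step into control flow, which depends on the statement
only, and the effect on the data, which depends on the action only. -/
theorem Step.exists_next {c c' : Config S} (h : Step c c') :
    ∃ a, (a, c'.stmt) ∈ c.stmt.next ∧ Act a c.state c.pc c'.state c'.pc := by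
  induction h with
  | skip_seq s q pc => exact ⟨.skip, by simp [Stmt.next, Stmt.isSkip], rfl, rfl⟩
  | seq s₂ _ ih =>
    obtain ⟨a, ha, h⟩ := ih
    refine ⟨a, ?_, h⟩
    simp only [Stmt.next, List.mem_append, List.mem_map]
    exact Or.inr ⟨_, ha, rfl⟩
  | assume b q pc h => exact ⟨.assume b, by simp [Stmt.next], h, rfl, rfl⟩
  | copy x y q pc x' h₁ h₂ => exact ⟨.copy x y, by simp [Stmt.next], x', h₁, h₂, rfl, rfl⟩
  | assign x f ys q pc x' h₁ h₂ =>
    exact ⟨.assign x f ys, by simp [Stmt.next], x', h₁, h₂, rfl, rfl⟩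
  | ite_true b s₁ s₂ q pc => exact ⟨.skip, by simp [Stmt.next], rfl, rfl⟩
  | ite_false b s₁ s₂ q pc => exact ⟨.skip, by simp [Stmt.next], rfl, rfl⟩
  | loop b s q pc => exact ⟨.skip, by simp [Stmt.next], rfl, rfl⟩

theorem step_of_next {a s s' : Stmt S} {q q' : Fin S.vars → ℕ} {pc pc' : Set (Lit S)}
    (hn : (a, s') ∈ s.next) (ha : Act a q pc q' pc') : Step ⟨s, q, pc⟩ ⟨s', q', pc'⟩ := by
  induction s generalizing s' with
  | skip => simp [Stmt.next] at hn
  | copy x y =>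
    simp only [Stmt.next, List.mem_singleton, Prod.mk.injEq] at hn
    obtain ⟨rfl, rfl⟩ := hn
    obtain ⟨x', h₁, h₂, rfl, rfl⟩ := ha
    exact .copy x y q pc x' h₁ h₂
  | assign x f ys =>
    simp only [Stmt.next, List.mem_singleton, Prod.mk.injEq] at hn
    obtain ⟨rfl, rfl⟩ := hn
    obtain ⟨x', h₁, h₂, rfl, rfl⟩ := ha
    exact .assign x f ys q pc x' h₁ h₂
  | assume b =>
    simp only [Stmt.next, List.mem_singleton, Prod.mk.injEq] at hn
    obtain ⟨rfl, rfl⟩ := hn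
    obtain ⟨h, rfl, rfl⟩ := ha
    exact .assume b _ pc h
  | seq s₁ s₂ ih₁ ih₂ =>
    simp only [Stmt.next, List.mem_append, List.mem_map] at hn
    obtain hn | ⟨⟨a', t⟩, ht, hn⟩ := hn
    · split_ifs at hn with h
      · rw [Stmt.isSkip_iff] at h
        simp only [List.mem_singleton, Prod.mk.injEq] at hn
        obtain ⟨rfl, rfl⟩ := hn
        obtain ⟨rfl, rfl⟩ := ha
        subst h
        exact .skip_seq _ _ _
      · simp at hn
    · simp only [Prod.mk.injEq] at hn
      obtain ⟨rfl, rfl⟩ := hn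
      exact .seq s₂ (ih₁ ht)
  | ite b s₁ s₂ _ _ =>
    simp only [Stmt.next, List.mem_cons, Prod.mk.injEq, List.not_mem_nil, or_false] at hn
    obtain ⟨rfl, rfl⟩ | ⟨rfl, rfl⟩ := hn <;> obtain ⟨rfl, rfl⟩ := ha
    · exact .ite_true b s₁ s₂ _ _
    · exact .ite_false b s₁ s₂ _ _
  | loop b s _ =>
    simp only [Stmt.next, List.mem_singleton, Prod.mk.injEq] at hn
    obtain ⟨rfl, rfl⟩ := hn
    obtain ⟨rfl, rfl⟩ := ha
    exact .loop b s _ _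

/-- Coherence constrains `head`; this makes its conditions available for every action other than
`skip`. -/
theorem Stmt.head_of_next {a s s' : Stmt S} (h : (a, s') ∈ s.next) : a = skip ∨ s.head = a := by
  induction s generalizing s' with
  | skip => simp [next] at h
  | copy x y => simp only [next, List.mem_singleton, Prod.mk.injEq] at h; exact Or.inr h.1.symm
  | assign x f ys => simp only [next, List.mem_singleton, Prod.mk.injEq] at h; exact Or.inr h.1.symm
  | assume b => simp only [next, List.mem_singleton, Prod.mk.injEq] at h; exact Or.inr h.1.symm
  | seq s₁ s₂ ih₁ ih₂ =>
    simp only [next, List.mem_append, List.mem_map] at h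
    obtain h | ⟨⟨a', t⟩, ht, h⟩ := h
    · split_ifs at h
      · simp only [List.mem_singleton, Prod.mk.injEq] at h
        exact Or.inl h.1
      · simp at h
    · simp only [Prod.mk.injEq] at h
      obtain ⟨rfl, -⟩ := h
      exact ih₁ ht
  | ite b s₁ s₂ _ _ =>
    simp only [next, List.mem_cons, Prod.mk.injEq, List.not_mem_nil, or_false] at h
    exact Or.inl (h.elim And.left And.left)
  | loop b s _ => simp only [next, List.mem_singleton, Prod.mk.injEq] at h; exact Or.inl h.1

/-- Only finitely many statements are reachable from a statement. -/
theorem Stmt.exists_finite_closed (s : Stmt S) :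
    ∃ R : Set (Stmt S), R.Finite ∧ s ∈ R ∧ ∀ t ∈ R, ∀ p ∈ t.next, p.2 ∈ R := by
  have atom : ∀ a : Stmt S, a.next = [(a, skip)] → ∃ R : Set (Stmt S), R.Finite ∧ a ∈ R ∧
      ∀ t ∈ R, ∀ p ∈ t.next, p.2 ∈ R := by
    intro a ha
    refine ⟨{a, skip}, by simp, by simp, ?_⟩
    rintro t (rfl | rfl) p hp
    · rw [ha] at hp
      simp only [List.mem_singleton] at hp
      subst hp
      simp
    · simp [next] at hp
  have seq' : ∀ {s₁ : Stmt S} {R₁ R₂ : Set (Stmt S)} {s₂ : Stmt S},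
      (∀ t ∈ R₁, ∀ p ∈ t.next, p.2 ∈ R₁) → s₂ ∈ R₂ → (∀ t ∈ R₂, ∀ p ∈ t.next, p.2 ∈ R₂) →
      ∀ t ∈ (fun t => seq t s₂) '' R₁ ∪ R₂, ∀ p ∈ t.next, p.2 ∈ (fun t => seq t s₂) '' R₁ ∪ R₂ := by
    rintro - R₁ R₂ s₂ h₁ hs h₂ t (⟨t, ht, rfl⟩ | ht) p hp
    · simp only [next, List.mem_append, List.mem_map] at hp
      obtain hp | ⟨p', hp', rfl⟩ := hp
      · split_ifs at hp
        · simp only [List.mem_singleton] at hp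
          subst hp
          exact Or.inr hs
        · simp at hp
      · exact Or.inl ⟨_, h₁ t ht p' hp', rfl⟩
    · exact Or.inr (h₂ t ht p hp)
  have assumes : ∀ b : Cond S, ∀ t ∈ ({assume b, skip} : Set (Stmt S)), ∀ p ∈ t.next,
      p.2 ∈ ({assume b, skip} : Set (Stmt S)) := by
    rintro b t (rfl | rfl) p hp
    · simp only [next, List.mem_singleton] at hp
      subst hp
      simp
    · simp [next] at hp
  -- The exception in the last hypothesis serves loops: a statement of `R` may step to the
  -- conditional itself, as the loop inside its own unfolding does.
  have ite' : ∀ (b : Cond S) (s₁ s₂ : Stmt S) (R : Set (Stmt S)), R.Finite →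
      s₁ ∈ R → s₂ ∈ R → (∀ t ∈ R, (∀ p ∈ t.next, p.2 ∈ R) ∨ t.next = [(skip, ite b s₁ s₂)]) →
      ∃ R' : Set (Stmt S), R'.Finite ∧ ite b s₁ s₂ ∈ R' ∧ R ⊆ R' ∧
        ∀ t ∈ R', ∀ p ∈ t.next, p.2 ∈ R' := by
    intro b s₁ s₂ R hR h₁ h₂ h
    refine ⟨{ite b s₁ s₂} ∪ ((fun t => seq t s₁) '' {assume b, skip} ∪
      ((fun t => seq t s₂) '' {assume b.neg, skip} ∪ R)), ?_, by simp, ?_, ?_⟩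
    · exact (Set.finite_singleton _).union (((Set.toFinite _).image _).union
        (((Set.toFinite _).image _).union hR))
    · exact fun t ht => Or.inr (Or.inr (Or.inr ht))
    rintro t (rfl | ⟨t, ht, rfl⟩ | ⟨t, ht, rfl⟩ | ht) p hp
    · simp only [next, List.mem_cons, List.not_mem_nil, or_false] at hp
      obtain rfl | rfl := hp
      · exact Or.inr (Or.inl ⟨_, by simp, rfl⟩)
      · exact Or.inr (Or.inr (Or.inl ⟨_, by simp, rfl⟩))
    · simp only [next, List.mem_append, List.mem_map] at hp
      obtain hp | ⟨p', hp', rfl⟩ := hp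
      · split_ifs at hp
        · simp only [List.mem_singleton] at hp
          subst hp
          exact Or.inr (Or.inr (Or.inr h₁))
        · simp at hp
      · exact Or.inr (Or.inl ⟨_, assumes b t ht p' hp', rfl⟩)
    · simp only [next, List.mem_append, List.mem_map] at hp
      obtain hp | ⟨p', hp', rfl⟩ := hp
      · split_ifs at hp
        · simp only [List.mem_singleton] at hp
          subst hp
          exact Or.inr (Or.inr (Or.inr h₂))
        · simp at hp
      · exact Or.inr (Or.inr (Or.inl ⟨_, assumes b.neg t ht p' hp', rfl⟩))
    · obtain h | h := h t ht
      · exact Or.inr (Or.inr (Or.inr (h p hp)))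
      · rw [h, List.mem_singleton] at hp
        subst hp
        exact Or.inl rfl
  induction s with
  | skip => exact ⟨{skip}, by simp, by simp, by simp [next]⟩
  | copy x y => exact atom _ rfl
  | assign x f ys => exact atom _ rfl
  | assume b => exact atom _ rfl
  | seq s₁ s₂ ih₁ ih₂ =>
    obtain ⟨R₁, f₁, m₁, h₁⟩ := ih₁
    obtain ⟨R₂, f₂, m₂, h₂⟩ := ih₂
    exact ⟨_, (f₁.image _).union f₂, Or.inl ⟨_, m₁, rfl⟩, seq' (s₁ := s₁) h₁ m₂ h₂⟩
  | ite b s₁ s₂ ih₁ ih₂ =>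
    obtain ⟨R₁, f₁, m₁, h₁⟩ := ih₁
    obtain ⟨R₂, f₂, m₂, h₂⟩ := ih₂
    obtain ⟨R, hf, hm, -, hR⟩ := ite' b s₁ s₂ (R₁ ∪ R₂) (f₁.union f₂) (Or.inl m₁) (Or.inr m₂) (by
      rintro t (ht | ht)
      · exact Or.inl fun p hp => Or.inl (h₁ t ht p hp)
      · exact Or.inl fun p hp => Or.inr (h₂ t ht p hp))
    exact ⟨R, hf, hm, hR⟩
  | loop b s ih =>
    obtain ⟨R, hf, hm, h⟩ := ih
    obtain ⟨R', hf', -, hRR', hR'⟩ := ite' b (seq s (loop b s)) skip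
      ((fun t => seq t (loop b s)) '' R ∪ {loop b s, skip})
      ((hf.image _).union (Set.toFinite _)) (Or.inl ⟨_, hm, rfl⟩) (by simp) (by
        rintro t (⟨t, ht, rfl⟩ | rfl | rfl)
        · refine Or.inl fun p hp => ?_
          simp only [next, List.mem_append, List.mem_map] at hp
          obtain hp | ⟨p', hp', rfl⟩ := hp
          · split_ifs at hp
            · simp only [List.mem_singleton] at hp
              subst hp
              exact Or.inr (by simp)
            · simp at hp
          · exact Or.inl ⟨_, h t ht p' hp', rfl⟩
        · exact Or.inr rfl
        · exact Or.inl (by simp [next]))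
    exact ⟨R', hf', hRR' (Or.inr (by simp)), hR'⟩

/-! ### Actions on keys -/

/-- The key of a configuration. -/
def Config.key (c : Config S) : Key S (Fin S.vars) := keyOf c.pc fun v => .const (c.state v)

open scoped Classical in
/-- The effect of an action on the key. -/
noncomputable def post : Stmt S → Key S (Fin S.vars) → Option (Key S (Fin S.vars))
  | .copy x y, κ => some (κ.restrict (Function.update id x y))
  | .assign x f ys, κ =>
    if h : ∃ v, ∃ Z ∈ κ.C f, (v, fun i => some (ys i)) ∈ Z then
      some (κ.restrict (Function.update id x h.choose))
    else some ((κ.extend f ys).restrict fun u => if u = x then none else some u)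
  | .assume ⟨true, x, y⟩, κ =>
    if ∃ u v, κ.D u v ∧ (κ.addEq x y).Cl u v then none else some (κ.addEq x y).sat
  | .assume ⟨false, x, y⟩, κ => if κ.E x y then none else some (κ.addNe x y)
  | _, κ => some κ

/-- Invariants of reachable configurations. Finiteness gives fresh constants and bases,
satisfiability makes entailment and derivability agree, and injectivity lets variables stand for the
constants of the state. -/
structure Config.Regular (c : Config S) : Prop where
  finite : c.pc.Finite
  sat : Satisfiable c.pc
  inj : Function.Injective c.state

theorem satisfiable_empty : Satisfiable (∅ : Set (Lit S)) := satisfiable_iff.2 (by simp)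

theorem satisfiable_insert_def {Γ : Set (Lit S)} {x' : ℕ} {T : Term S} (hΓ : Satisfiable Γ)
    (hx : x' ∉ constsOf Γ) (hT : Term.const x' ∉ T.subterms) :
    Satisfiable (insert (Lit.eq (.const x') T) Γ) := by
  rw [satisfiable_iff] at hΓ ⊢
  rintro s t (h | h) hd
  · cases h
  · rw [Deq, derives_insert_def hx hT] at hd
    have : ∀ r ∈ termsOf Γ, r.bind (Function.update Term.const x' T) = r := fun r hr =>
      Term.bind_eq_self fun c hc => by
        rw [Function.update_of_ne]
        rintro rfl
        exact hx (termsOf_subterm hr hc)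
    rw [Lit.bind, this s (mem_termsOf_ne h).1, this t (mem_termsOf_ne h).2] at hd
    exact hΓ s t h hd

theorem appValue_subterms {q : Fin S.vars → ℕ} {f : Fin S.funs} {ys : Fin (S.arity f) → Fin S.vars}
    {x' : ℕ} (hx : x' ∉ Set.range q) : Term.const x' ∉ (appValue q f ys).subterms := by
  simp only [appValue, Term.subterms, Set.mem_union, Set.mem_singleton_iff, Set.mem_iUnion]
  rintro (h | ⟨i, h⟩)
  · cases h
  · cases h
    exact hx ⟨_, rfl⟩

theorem update_injective {q : X → ℕ} [DecidableEq X] (hq : Function.Injective q) {x : X} {x' : ℕ}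
    (hx : x' ∉ Set.range q) : Function.Injective (Function.update q x x') := by
  intro u v h
  by_cases hu : u = x <;> by_cases hv : v = x
  · rw [hu, hv]
  · subst hu
    rw [Function.update_self, Function.update_of_ne hv] at h
    exact absurd ⟨v, h.symm⟩ hx
  · subst hv
    rw [Function.update_self, Function.update_of_ne hu] at h
    exact absurd ⟨u, h⟩ hx
  · rw [Function.update_of_ne hu, Function.update_of_ne hv] at h
    exact hq h

theorem Config.Regular.step {c c' : Config S} (hc : c.Regular) (h : Step c c') : c'.Regular := by
  obtain ⟨a, -, ha⟩ := h.exists_next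
  obtain ⟨s, q, pc⟩ := c
  obtain ⟨s', q', pc'⟩ := c'
  obtain ⟨h₁, h₂, h₃⟩ := hc
  simp only at h₁ h₂ h₃ ha
  cases a with
  | copy x y =>
    obtain ⟨x', hx, hx', rfl, rfl⟩ := ha
    refine ⟨h₁.insert _, satisfiable_insert_def h₂ hx ?_, update_injective h₃ hx'⟩
    rintro h
    cases h
    exact hx' ⟨_, rfl⟩
  | assign x f ys =>
    obtain ⟨x', hx, hx', rfl, rfl⟩ := ha
    exact ⟨h₁.insert _, satisfiable_insert_def h₂ hx (appValue_subterms hx'),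
      update_injective h₃ hx'⟩
  | assume b =>
    obtain ⟨hs, rfl, rfl⟩ := ha
    exact ⟨h₁.insert _, hs, h₃⟩
  | _ =>
    obtain ⟨rfl, rfl⟩ := ha
    exact ⟨h₁, h₂, h₃⟩

theorem reachable_regular {P : Stmt S} {c : Config S} (h : (progTS P).Reachable c) :
    c.Regular := by
  induction h with
  | refl => exact ⟨Set.finite_empty, satisfiable_empty, Fin.val_injective⟩
  | tail _ h ih => exact ih.step h

theorem keyOf_congr {Γ : Set (Lit S)} {Q Q' : X → Term S} (h : ∀ u, Deq Γ (Q u) (Q' u)) :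
    keyOf Γ Q = keyOf Γ Q' := by
  have hctx : ∀ f N p, ctxSet Γ Q f N p = ctxSet Γ Q' f N p := by
    intro f N p
    ext z
    refine and_congr_right fun _ => ?_
    have h' := deq_app_fill (f := f) (p := p) (h := z.2) h fun _ _ => .refl _
    exact ⟨fun hd => (h _).symm.trans (hd.trans h'), fun hd => (h _).trans (hd.trans h'.symm)⟩
  apply Key.ext
  · funext u v
    exact propext ⟨fun hd => (h u).symm.trans (hd.trans (h v)),
      fun hd => (h u).trans (hd.trans (h v).symm)⟩
  · funext u v
    exact propext ⟨fun hd => hd.ne_congr (h u) (h v), fun hd => hd.ne_congr (h u).symm (h v).symm⟩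
  · funext f
    simp only [keyOf, hctx]
    ext Z
    refine exists_congr fun N => exists_congr fun p => and_congr_right fun _ =>
      and_congr_left fun _ => forall_congr' fun i => forall_congr' fun _ => forall_congr' fun u =>
      not_congr ⟨fun hd => (h u).symm.trans hd, fun hd => (h u).trans hd⟩

theorem occurs_params {Γ : Set (Lit S)} {Q : X → Term S}
    (hQ : ∀ u, (∃ c, Q u = .const c) ∨ Occurs Γ (Q u)) (f N p) :
    ∀ z ∈ ctxSet Γ Q f N p, (∀ i ∈ N, ∀ u, ¬ Deq Γ (Q u) (p i)) → ∀ i ∈ N, Occurs Γ (p i) := by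
  intro z hz _
  refine occurs_param hz ?_
  obtain ⟨c, hc⟩ | h := hQ z.1
  · have := hz.2
    rw [hc] at this
    exact this.occurs_of_const
  · exact Deq.occurs hz.2 h

/-- The contexts without holes show which variables store a given application, so `post` can tell
the two cases of an assignment apart. -/
theorem keyOf_C_full {Γ : Set (Lit S)} {q : Fin S.vars → ℕ} {f : Fin S.funs}
    {ys : Fin (S.arity f) → Fin S.vars} {v : Fin S.vars} :
    (∃ Z ∈ (keyOf Γ fun v => Term.const (q v)).C f, (v, fun i => some (ys i)) ∈ Z) ↔
      Deq Γ (.const (q v)) (appValue q f ys) := by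
  constructor
  · rintro ⟨Z, ⟨N, p, -, -, rfl, -⟩, h⟩
    exact h.2
  · intro h
    have hmem : (v, fun i => some (ys i)) ∈
        ctxSet Γ (fun v => Term.const (q v)) f ∅ fun _ => .const 0 := ⟨by simp, h⟩
    exact ⟨_, ⟨∅, _, ⟨⟨0, S.arity_pos f⟩, by simp⟩, by simp, rfl, _, hmem⟩, hmem⟩

theorem bind_update_const {q : X → ℕ} [DecidableEq X] {x : X} {x' : ℕ} {T : Term S}
    (hx : x' ∉ Set.range q) (u : X) :
    (Term.const (Function.update q x x' u)).bind (Function.update Term.const x' T) =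
      if u = x then T else .const (q u) := by
  by_cases hu : u = x
  · subst hu
    simp [Term.bind]
  · rw [Function.update_of_ne hu, Term.bind, Function.update_of_ne, if_neg hu]
    rintro rfl
    exact hx ⟨u, rfl⟩

/-- Keys after a definition whose value is already stored. -/
theorem keyOf_define_stored {Γ : Set (Lit S)} {q : Fin S.vars → ℕ} {x y : Fin S.vars} {x' : ℕ}
    {T : Term S} (hx : x' ∉ constsOf Γ) (hx' : x' ∉ Set.range q) (hT : Term.const x' ∉ T.subterms)
    (hTo : (∃ c, T = .const c) ∨ Occurs Γ T) (hTy : Deq Γ (.const (q y)) T) :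
    keyOf (insert (Lit.eq (.const x') T) Γ) (fun v => .const (Function.update q x x' v)) =
      (keyOf Γ fun v => .const (q v)).restrict (Function.update id x y) := by
  rw [keyOf_insert_def hx hT (bind_update_const hx')
    (occurs_params fun u => by
      split_ifs
      · exact hTo
      · exact Or.inl ⟨_, rfl⟩), ← keyOf_restrict]
  refine keyOf_congr fun u => ?_
  by_cases hu : u = x
  · subst hu
    simpa using hTy.symm
  · simpa [hu] using Derives.refl _

/-- Keys after a definition whose value is a new term. -/
theorem keyOf_define_new {Γ : Set (Lit S)} {q : Fin S.vars → ℕ} {x : Fin S.vars} {x' : ℕ}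
    {f : Fin S.funs} {ys : Fin (S.arity f) → Fin S.vars} (hx : x' ∉ constsOf Γ)
    (hx' : x' ∉ Set.range q) (hT : ¬ Occurs Γ (appValue q f ys)) :
    keyOf (insert (Lit.eq (.const x') (appValue q f ys)) Γ)
        (fun v => .const (Function.update q x x' v)) =
      ((keyOf Γ fun v => .const (q v)).extend f ys).restrict
        fun u => if u = x then none else some u := by
  rw [← keyOf_extend hT]
  -- The new family first gains the index `none` for the fresh constant and then forgets the old
  -- value of `x`, whose place `none` takes.
  have : (fun v => (Term.const (Function.update q x x' v) : Term S)) =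
      (fun o : Option (Fin S.vars) => .const (o.elim x' q)) ∘
        fun u => if u = x then none else some u := by
    funext v
    by_cases hv : v = x
    · subst hv
      simp
    · simp [hv]
  rw [this, keyOf_restrict]
  congr 1
  refine keyOf_insert_def hx (appValue_subterms hx') (fun u => ?_) ?_
  · cases u with
    | none => simp [Term.bind, extendFam, appValue]
    | some u =>
      simp only [Option.elim, Term.bind, extendFam]
      rw [Function.update_of_ne]
      rintro rfl
      exact hx' ⟨u, rfl⟩
  · intro f' N p z hz hns
    obtain ⟨-, ⟨-, -, ho⟩ | ⟨-, rfl, -⟩⟩ := extendFam_ctx hT hz fun i hi u => hns i hi (some u)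
    · exact occurs_param hz ho
    · simp

section

variable {c : Config S} {a s' : Stmt S}

/-- The coherence condition speaks of terms of the path condition; terms that occur up to congruence
are first replaced by such terms. Entailed equalities are derivable since the path condition is
satisfiable. -/
theorem storedSupers_of_early (hc : c.Regular) (he : c.EarlyAssume) {x y : Fin S.vars}
    (ha : c.stmt.head = .assume ⟨true, x, y⟩) : StoredSupers c.pc c.state x y := by
  rintro t ht ⟨s, hs, hd⟩
  obtain ⟨t', ht', hd'⟩ := ht.exists_mem
  obtain ⟨v, hv⟩ := he x y ha t' ht' s hs ((entails_eq_iff hc.sat).2 (hd'.symm.trans hd))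
  exact ⟨v, ((entails_eq_iff hc.sat).1 hv).trans hd'.symm⟩

theorem not_occurs_of_memoizing (hc : c.Regular) (hm : c.Memoizing) {x : Fin S.vars}
    {f : Fin S.funs} {ys : Fin (S.arity f) → Fin S.vars} (ha : c.stmt.head = .assign x f ys)
    (h : ¬ ∃ v, Deq c.pc (.const (c.state v)) (appValue c.state f ys)) :
    ¬ Occurs c.pc (appValue c.state f ys) := by
  intro ho
  obtain ⟨t, ht, hd⟩ := ho.exists_mem
  obtain ⟨v, hv⟩ := hm x f ys ha t ht ((entails_eq_iff hc.sat).2 hd.symm)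
  exact h ⟨v, ((entails_eq_iff hc.sat).1 hv).trans hd.symm⟩

/-- The key after an action of a coherent program is determined by the key before. -/
theorem post_of_act (hc : c.Regular) (hm : c.Memoizing) (he : c.EarlyAssume)
    (hn : (a, s') ∈ c.stmt.next) {q' : Fin S.vars → ℕ} {pc' : Set (Lit S)}
    (h : Act a c.state c.pc q' pc') : post a c.key = some (keyOf pc' fun v => .const (q' v)) := by
  have hhead := Stmt.head_of_next hn
  cases a with
  | copy x y =>
    obtain ⟨x', hx, hx', rfl, rfl⟩ := h
    rw [keyOf_define_stored hx hx' ?_ (Or.inl ⟨_, rfl⟩) (.refl _)]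
    · rfl
    · rintro h
      cases h
      exact hx' ⟨_, rfl⟩
  | assign x f ys =>
    obtain ⟨x', hx, hx', rfl, rfl⟩ := h
    simp only [post]
    split_ifs with hv
    · have hd := keyOf_C_full.1 hv.choose_spec
      rw [keyOf_define_stored hx hx' (appValue_subterms hx') (Or.inr hd.occurs_of_const) hd]
      rfl
    · rw [keyOf_define_new hx hx']
      · rfl
      · refine not_occurs_of_memoizing hc hm (hhead.resolve_left (by simp)) ?_
        rintro ⟨v, hd⟩
        exact hv ⟨v, keyOf_C_full.2 hd⟩
  | assume b =>
    obtain ⟨hs, rfl, rfl⟩ := h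
    obtain ⟨_ | _, x, y⟩ := b
    · simp only [Cond.value, Bool.false_eq_true, if_false] at hs ⊢
      rw [satisfiable_insert_ne hc.sat] at hs
      rw [keyOf_insert_ne c.pc fun v => Term.const (c.state v)]
      exact if_neg hs
    · simp only [Cond.value, if_true] at hs ⊢
      have hss := storedSupers_of_early hc he (hhead.resolve_left (by simp))
      rw [satisfiable_assumeEq hc.sat hss] at hs
      rw [keyOf_assumeEq hss]
      exact if_neg hs
  | _ =>
    obtain ⟨rfl, rfl⟩ := h
    rfl

/-- An action of a coherent program is enabled if it is enabled on the key. -/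
theorem act_of_post (hc : c.Regular) (he : c.EarlyAssume)
    (hn : (a, s') ∈ c.stmt.next) (h : post a c.key ≠ none) :
    ∃ q' pc', Act a c.state c.pc q' pc' := by
  have hhead := Stmt.head_of_next hn
  obtain ⟨x', hx'⟩ := ((constsOf_finite hc.finite).union (Set.finite_range c.state)).exists_notMem
  simp only [Set.mem_union, not_or] at hx'
  cases a with
  | copy x y => exact ⟨_, _, x', hx'.1, hx'.2, rfl, rfl⟩
  | assign x f ys => exact ⟨_, _, x', hx'.1, hx'.2, rfl, rfl⟩
  | assume b =>
    refine ⟨_, _, ?_, rfl, rfl⟩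
    obtain ⟨_ | _, x, y⟩ := b
    · simp only [Cond.value, Bool.false_eq_true, if_false]
      rw [satisfiable_insert_ne hc.sat]
      simp only [post] at h
      split_ifs at h with hd
      · simp at h
      · exact hd
    · simp only [Cond.value, if_true]
      rw [satisfiable_assumeEq hc.sat (storedSupers_of_early hc he (hhead.resolve_left (by simp)))]
      simp only [post] at h
      split_ifs at h with hd
      · simp at h
      · exact hd
  | _ => exact ⟨_, _, rfl, rfl⟩

end

/-- Steps of statements and keys. -/
def KeyStep (x y : Stmt S × Key S (Fin S.vars)) : Prop :=
  ∃ a, (a, y.1) ∈ x.1.next ∧ post a x.2 = some y.2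

section

variable {P : Stmt S} {c : Config S}

theorem keyStep_of_step (hP : Coherent P) (hc : (progTS P).Reachable c) {c' : Config S}
    (h : Step c c') :
    KeyStep (c.stmt, c.key) (c'.stmt, c'.key) := by
  obtain ⟨a, ha, h⟩ := h.exists_next
  exact ⟨a, ha, post_of_act (reachable_regular hc) (hP c hc).1 (hP c hc).2 ha h⟩

/-- Together with `keyStep_of_step`: on reachable configurations, passing to the statement and the
key is a functional bisimulation. The choice of the fresh constant has no effect on the key. -/
theorem step_of_keyStep (hP : Coherent P) (hc : (progTS P).Reachable c)
    {y : Stmt S × Key S (Fin S.vars)} (h : KeyStep (c.stmt, c.key) y) :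
    ∃ c', Step c c' ∧ (c'.stmt, c'.key) = y := by
  obtain ⟨a, ha, h⟩ := h
  obtain ⟨q', pc', hact⟩ := act_of_post (reachable_regular hc) (hP c hc).2 ha (by simp [h])
  refine ⟨⟨y.1, q', pc'⟩, step_of_next ha hact, ?_⟩
  have := post_of_act (reachable_regular hc) (hP c hc).1 (hP c hc).2 ha hact
  rw [h] at this
  exact Prod.ext rfl (Option.some.inj this).symm

end

theorem reachable_stmt_finite (P : Stmt S) :
    {s | ∃ c, (progTS P).Reachable c ∧ c.stmt = s}.Finite := by
  obtain ⟨R, hR, hP, hcl⟩ := P.exists_finite_closed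
  refine hR.subset ?_
  rintro _ ⟨c, hc, rfl⟩
  induction hc with
  | refl => exact hP
  | tail _ h ih =>
    obtain ⟨a, ha, -⟩ := Step.exists_next h
    exact hcl _ ih _ ha

end UP

/-! ### Flat literals and normalization in terms of keys -/

namespace UP

variable {S : Sig} {X : Type}

/-! ### Keys of flat literals -/

theorem flat_inj {v v' : ℕ} {f f' : Fin S.funs} {a : Fin (S.arity f) → ℕ}
    {a' : Fin (S.arity f') → ℕ} (h : Lit.flat v f a = Lit.flat v' f' a') :
    v = v' ∧ (⟨f, a⟩ : Σ f : Fin S.funs, Fin (S.arity f) → ℕ) = ⟨f', a'⟩ := by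
  simp only [Lit.flat, Lit.eq.injEq, Term.const.injEq, Term.app.injEq] at h
  obtain ⟨rfl, rfl, h⟩ := h
  refine ⟨rfl, ?_⟩
  congr 1
  funext i
  have := congrFun (eq_of_heq h) i
  simpa using this

/-- The holed literal with indices replaced by constants. -/
def enc (q : X → ℕ) (f : Fin S.funs) (z : HLit S X f) : Holed S := ⟨q z.1, f, fun i => (z.2 i).map q⟩

/-- The context of `f(a)` in `L`, in terms of indices. -/
def rawCtx (q : X → ℕ) (L : Set (Lit S)) (f : Fin S.funs) (a : Fin (S.arity f) → ℕ) :
    Set (HLit S X f) :=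
  {z | enc q f z ∈ context (Set.range q) L f a}

/-- The literals of `L` as a key. -/
def raw (q : X → ℕ) (L : Set (Lit S)) : Key S X where
  E u v := Lit.eq (.const (q u)) (.const (q v)) ∈ L
  D u v := Lit.ne (.const (q u)) (.const (q v)) ∈ L
  C f := {Z | ∃ v a, Lit.flat v f a ∈ L ∧ Z = rawCtx q L f a}

/-- The shape of the literals of a base. -/
def BaseShape (V : Set ℕ) (L : Set (Lit S)) : Prop :=
  ∀ l ∈ L, (∃ u v, u ∈ V ∧ v ∈ V ∧ l = Lit.eq (.const u) (.const v)) ∨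
    (∃ u v, u ∈ V ∧ v ∈ V ∧ l = Lit.ne (.const u) (.const v)) ∨
    (∃ v f a, v ∈ V ∧ (∃ i, a i ∈ V) ∧ l = Lit.flat v f a)

theorem BaseShape.flat {V : Set ℕ} {L : Set (Lit S)} (hL : BaseShape V L) {v : ℕ}
    {f : Fin S.funs} {a : Fin (S.arity f) → ℕ} (h : Lit.flat v f a ∈ L) :
    v ∈ V ∧ ∃ i, a i ∈ V := by
  obtain ⟨_, _, -, -, h'⟩ | ⟨_, _, -, -, h'⟩ | ⟨v', f', a', hv, ha, h'⟩ := hL _ h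
  · cases h'
  · cases h'
  · obtain ⟨rfl, h''⟩ := flat_inj h'
    obtain rfl : f = f' := congrArg Sigma.fst h''
    obtain rfl := eq_of_heq (Sigma.mk.inj h'').2
    exact ⟨hv, ha⟩

/-- `h` is obtained from `b` by digging holes for the constants outside `q(X)`. -/
def Digs (q : X → ℕ) {k : ℕ} (h : Fin k → Option X) (b : Fin k → ℕ) : Prop :=
  ∀ i, (h i = none ∧ b i ∉ Set.range q) ∨ ∃ y, h i = some y ∧ b i = q y

theorem exists_digs (q : X → ℕ) {k : ℕ} (b : Fin k → ℕ) : ∃ h, Digs q h b := by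
  have : ∀ i, ∃ o : Option X, (o = none ∧ b i ∉ Set.range q) ∨ ∃ y, o = some y ∧ b i = q y := by
    intro i
    by_cases hi : b i ∈ Set.range q
    · obtain ⟨y, hy⟩ := hi
      exact ⟨some y, Or.inr ⟨y, rfl, hy.symm⟩⟩
    · exact ⟨none, Or.inl ⟨rfl, hi⟩⟩
  choose h hh using this
  exact ⟨h, hh⟩

theorem Digs.none_iff {q : X → ℕ} {k : ℕ} {h : Fin k → Option X} {b : Fin k → ℕ}
    (hd : Digs q h b) (i : Fin k) : h i = none ↔ b i ∉ Set.range q := by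
  obtain ⟨h₁, h₂⟩ | ⟨y, h₁, h₂⟩ := hd i
  · simp [h₁, h₂]
  · simp [h₁, h₂]

theorem Digs.some {q : X → ℕ} {k : ℕ} {h : Fin k → Option X} {b : Fin k → ℕ}
    (hd : Digs q h b) {i : Fin k} {y : X} (hy : h i = some y) : b i = q y := by
  obtain ⟨h₁, -⟩ | ⟨y', h₁, h₂⟩ := hd i
  · rw [h₁] at hy
    cases hy
  · rw [h₁] at hy
    cases hy
    exact h₂

theorem template_eq_iff {V : Set ℕ} {k : ℕ} {a b : Fin k → ℕ} :
    template V b = template V a ↔ ∀ i, (b i ∈ V ∧ a i ∈ V) ∨ (b i = a i ∧ a i ∉ V) := by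
  rw [funext_iff]
  refine forall_congr' fun i => ?_
  unfold template
  by_cases h₁ : b i ∈ V <;> by_cases h₂ : a i ∈ V
  · simp [h₁, h₂]
  · simp only [h₁, h₂, if_true, if_false]
    simp only [reduceCtorEq, and_false, not_false_eq_true, and_true, false_or, false_iff]
    rintro h
    exact h₂ (h ▸ h₁)
  · simp only [h₁, h₂, if_true, if_false]
    simp
  · simp [h₁, h₂]

theorem enc_eq_dig {q : X → ℕ} {f : Fin S.funs} {z : HLit S X f} {b : Fin (S.arity f) → ℕ}
    (h : Digs q z.2 b) : enc q f z = dig (Set.range q) (q z.1) f b := by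
  unfold enc dig
  congr 1
  funext i
  obtain ⟨h₁, h₂⟩ | ⟨y, h₁, h₂⟩ := h i
  · rw [h₁, if_neg h₂]
    rfl
  · rw [h₁, h₂, if_pos ⟨y, rfl⟩]
    rfl

theorem digs_of_enc_eq_dig {q : X → ℕ} {f : Fin S.funs} {z : HLit S X f} {v : ℕ}
    {b : Fin (S.arity f) → ℕ} (h : enc q f z = dig (Set.range q) v f b) :
    q z.1 = v ∧ Digs q z.2 b := by
  unfold enc dig at h
  simp only [Holed.mk.injEq, heq_eq_eq, true_and] at h
  refine ⟨h.1, fun i => ?_⟩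
  have hi := congrFun h.2 i
  cases hz : z.2 i with
  | none =>
    rw [hz] at hi
    split_ifs at hi with hb
    · cases hi
    · exact Or.inl ⟨rfl, hb⟩
  | some y =>
    rw [hz] at hi
    split_ifs at hi with hb
    · exact Or.inr ⟨y, rfl, (Option.some.inj hi).symm⟩
    · cases hi

theorem mem_rawCtx {q : X → ℕ} {L : Set (Lit S)} {f : Fin S.funs} {a : Fin (S.arity f) → ℕ}
    {z : HLit S X f} : z ∈ rawCtx q L f a ↔ ∃ b, Lit.flat (q z.1) f b ∈ L ∧
      template (Set.range q) b = template (Set.range q) a ∧ Digs q z.2 b := by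
  constructor
  · rintro ⟨v, b, hb, ht, h⟩
    obtain ⟨rfl, hd⟩ := digs_of_enc_eq_dig h
    exact ⟨b, hb, ht, hd⟩
  · rintro ⟨b, hb, ht, hd⟩
    exact ⟨_, b, hb, ht, enc_eq_dig hd⟩

/-- The templates of index contexts are uniform. -/
theorem none_iff_of_mem_rawCtx {q : X → ℕ} {L : Set (Lit S)} {f : Fin S.funs}
    {a : Fin (S.arity f) → ℕ} {z : HLit S X f} (hz : z ∈ rawCtx q L f a) (i : Fin (S.arity f)) :
    z.2 i = none ↔ a i ∉ Set.range q := by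
  obtain ⟨b, -, ht, hd⟩ := mem_rawCtx.1 hz
  rw [hd.none_iff]
  obtain ⟨h₁, h₂⟩ | ⟨h₁, h₂⟩ := template_eq_iff.1 ht i
  · simp [h₁, h₂]
  · rw [h₁]

/-! ### Derivable equalities in flat literals -/

section

variable {q : X → ℕ} {L : Set (Lit S)}

/-- The equivalence on constants that extends one on indices. -/
def constSetoid (q : X → ℕ) (hq : Function.Injective q) (κ : Key S X) : Setoid ℕ where
  r c c' := c = c' ∨ ∃ u v, κ.Cl u v ∧ c = q u ∧ c' = q v
  iseqv := by
    refine ⟨fun s => Or.inl rfl, ?_, ?_⟩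
    · rintro s t (rfl | ⟨u, v, h, hs, ht⟩)
      · exact Or.inl rfl
      · exact Or.inr ⟨v, u, h.symm, ht, hs⟩
    · rintro s t r (rfl | ⟨u, v, h, rfl, rfl⟩) (rfl | ⟨u', v', h', hs', rfl⟩)
      · exact Or.inl rfl
      · exact Or.inr ⟨u', v', h', hs', rfl⟩
      · exact Or.inr ⟨u, v, h, rfl, rfl⟩
      · obtain rfl := hq hs'
        exact Or.inr ⟨u, v', h.trans h', rfl, rfl⟩

open scoped Classical in
/-- The class of a constant, or of the value of an application. -/
noncomputable def flatClass (q : X → ℕ) (hq : Function.Injective q) (L : Set (Lit S)) :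
    Term S → Quotient (constSetoid q hq (raw q L))
  | .const c => Quotient.mk _ c
  | .app f ts =>
    if h : ∃ v a, Lit.flat v f a ∈ L ∧ ts = fun i => .const (a i) then Quotient.mk _ h.choose
    -- A junk value: the normal form only looks up applications that occur in the literals.
    else Quotient.mk _ 0

theorem flatClass_const_iff (hq : Function.Injective q) {u v : X} :
    flatClass q hq L (.const (q u)) = flatClass q hq L (.const (q v)) ↔ (raw q L).Cl u v := by
  have : flatClass q hq L (.const (q u)) = flatClass q hq L (.const (q v)) ↔
      (constSetoid q hq (raw q L)).r (q u) (q v) := Quotient.eq (r := constSetoid q hq (raw q L))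
  rw [this]
  constructor
  · rintro (h | ⟨u', v', h, hu, hv⟩)
    · rw [hq h]
      exact .refl _
    · rw [hq hu, hq hv]
      exact h
  · exact fun h => Or.inr ⟨u, v, h, rfl, rfl⟩

/-- Constants outside `q` are alone in their classes, so arguments with equal classes have equal
templates. The two literals then lie in one context, and the closure relates their values. -/
theorem flat_value_cl (hq : Function.Injective q) {f : Fin S.funs} {v v' : X}
    {a a' : Fin (S.arity f) → ℕ} (ha : Lit.flat (q v) f a ∈ L) (ha' : Lit.flat (q v') f a' ∈ L)
    (h : ∀ i, flatClass q hq L (.const (a i)) = flatClass q hq L (.const (a' i))) :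
    (raw q L).Cl v v' := by
  have h' : ∀ i, a i = a' i ∨ ∃ u v, (raw q L).Cl u v ∧ a i = q u ∧ a' i = q v := fun i =>
    (Quotient.eq (r := constSetoid q hq (raw q L))).1 (h i)
  obtain ⟨o, ho⟩ := exists_digs q a
  obtain ⟨o', ho'⟩ := exists_digs q a'
  refine .ctx (f := f) (Z := rawCtx q L f a) ⟨_, a, ha, rfl⟩ (h := o) (h' := o')
    (mem_rawCtx.2 ⟨a, ha, rfl, ho⟩) (mem_rawCtx.2 ⟨a', ha', ?_, ho'⟩) ?_
  · rw [template_eq_iff]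
    intro i
    obtain h | ⟨u, v, -, hu, hv⟩ := h' i
    · rw [h]
      by_cases hi : a' i ∈ Set.range q
      · exact Or.inl ⟨hi, hi⟩
      · exact Or.inr ⟨rfl, hi⟩
    · rw [hu, hv]
      exact Or.inl ⟨⟨v, rfl⟩, ⟨u, rfl⟩⟩
  · intro i y y' hy hy'
    have h₁ := ho.some hy
    have h₂ := ho'.some hy'
    have := h i
    rw [h₁, h₂] at this
    exact (flatClass_const_iff hq).1 this

theorem flatClass_flat (hL : BaseShape (Set.range q) L) (hq : Function.Injective q) {f : Fin S.funs}
    {v : ℕ} {a : Fin (S.arity f) → ℕ} (ha : Lit.flat v f a ∈ L) :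
    flatClass q hq L (.app f fun i => .const (a i)) = flatClass q hq L (.const v) := by
  have hex : ∃ v' a', Lit.flat v' f a' ∈ L ∧
      (fun i => (Term.const (a i) : Term S)) = fun i => .const (a' i) := ⟨v, a, ha, rfl⟩
  have heq : flatClass q hq L (.app f fun i => .const (a i)) = Quotient.mk _ hex.choose :=
    dif_pos hex
  rw [heq]
  obtain ⟨a', ha', h⟩ := hex.choose_spec
  obtain ⟨⟨u, rfl⟩, -⟩ := hL.flat ha
  obtain ⟨⟨u', hu'⟩, -⟩ := hL.flat ha'
  rw [← hu'] at ha' ⊢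
  refine (flatClass_const_iff hq).2 (flat_value_cl hq ha' ha fun i => ?_)
  rw [← congrFun h i]

theorem mem_termsOf_app (hL : BaseShape (Set.range q) L) {f : Fin S.funs}
    {ts : Fin (S.arity f) → Term S} (h : Term.app f ts ∈ termsOf L) :
    ∃ v a, Lit.flat v f a ∈ L ∧ ts = fun i => .const (a i) := by
  obtain ⟨l, hl, ht⟩ := h
  obtain ⟨u, v, -, -, rfl⟩ | ⟨u, v, -, -, rfl⟩ | ⟨v, g, a, -, -, rfl⟩ := hL l hl
  · simp [Lit.terms, Term.subterms] at ht
  · simp [Lit.terms, Term.subterms] at ht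
  · simp only [Lit.flat, Lit.terms, Term.subterms, Set.mem_union, Set.mem_singleton_iff,
      Set.mem_iUnion, reduceCtorEq, false_or, exists_false, or_false] at ht
    obtain ⟨rfl, ht⟩ := Term.app.inj ht
    exact ⟨v, a, hl, eq_of_heq ht⟩

/-- Derivability of equalities between constants of the state from flat literals. -/
theorem deq_iff_cl (hL : BaseShape (Set.range q) L) (hq : Function.Injective q) {u v : X} :
    Deq L (.const (q u)) (.const (q v)) ↔ (raw q L).Cl u v := by
  -- Normal forms over these classes separate all constants that the closure does not relate.
  have hcompat : Compat L (flatClass q hq L) := by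
    intro f zs zs' hz hz' h
    obtain ⟨v, a, ha, rfl⟩ := mem_termsOf_app hL hz
    obtain ⟨v', a', ha', rfl⟩ := mem_termsOf_app hL hz'
    rw [flatClass_flat hL hq ha, flatClass_flat hL hq ha']
    obtain ⟨⟨u, rfl⟩, -⟩ := hL.flat ha
    obtain ⟨⟨u', rfl⟩, -⟩ := hL.flat ha'
    exact (flatClass_const_iff hq).2 (flat_value_cl hq ha ha' h)
  constructor
  · intro h
    have := nf_eq_of_deq (Γ := L) (ι := flatClass q hq L) ?_ h
    · simp only [nf] at this
      injection this with this
      exact (flatClass_const_iff hq).1 this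
    · intro s t hst
      rw [nf_of_mem hcompat (mem_termsOf_eq hst).1, nf_of_mem hcompat (mem_termsOf_eq hst).2]
      congr 1
      obtain ⟨_, _, ⟨u, rfl⟩, ⟨v, rfl⟩, h⟩ | ⟨u, v, -, -, h⟩ | ⟨v, g, a, -, -, h⟩ := hL _ hst
      · cases h
        exact (flatClass_const_iff hq).2 (.base hst)
      · cases h
      · cases h
        exact (flatClass_flat hL hq hst).symm
  · intro h
    induction h with
    | base h => exact .ax h
    | refl u => exact .refl _
    | symm _ ih => exact ih.symm
    | trans _ _ ih₁ ih₂ => exact ih₁.trans ih₂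
    | @ctx f Z v v' h h' hZ hv hv' _ ih =>
      obtain ⟨_, a, -, rfl⟩ := hZ
      obtain ⟨b, hb, ht, hd⟩ := mem_rawCtx.1 hv
      obtain ⟨b', hb', ht', hd'⟩ := mem_rawCtx.1 hv'
      refine (Derives.ax hb).trans (Derives.trans (.cong fun i => ?_) (Derives.ax hb').symm)
      obtain ⟨h₁, h₂⟩ | ⟨y, h₁, h₂⟩ := hd i
      · obtain ⟨h₃, -⟩ | ⟨h₃, h₄⟩ := template_eq_iff.1 (ht.trans ht'.symm) i
        · exact absurd h₃ h₂
        · rw [h₃]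
          exact .refl _
      · obtain ⟨h₃, h₄⟩ | ⟨y', h₃, h₄⟩ := hd' i
        · obtain ⟨-, h₅⟩ | ⟨h₅, -⟩ := template_eq_iff.1 (ht.trans ht'.symm) i
          · exact absurd h₅ h₄
          · exact absurd (h₅ ▸ h₂ ▸ ⟨y, rfl⟩) h₄
        · rw [h₂, h₄]
          exact ih i y y' h₁ h₃

theorem derives_ne_iff_cl (hL : BaseShape (Set.range q) L) (hq : Function.Injective q) {u v : X} :
    Derives L (Lit.ne (.const (q u)) (.const (q v))) ↔ (raw q L).sat.D u v := by
  rw [derives_ne_iff]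
  constructor
  · rintro ⟨a, b, hab, h⟩
    obtain ⟨_, _, -, -, h'⟩ | ⟨_, _, ⟨u', rfl⟩, ⟨v', rfl⟩, h'⟩ | ⟨_, g, c, -, -, h'⟩ := hL _ hab
    · cases h'
    · cases h'
      simp only [deq_iff_cl hL hq] at h
      exact ⟨u', v', hab, h⟩
    · cases h'
  · rintro ⟨u', v', hab, h⟩
    refine ⟨_, _, hab, ?_⟩
    simpa only [deq_iff_cl hL hq] using h

end

/-! ### Normalization in terms of keys -/

/-- The literals described by a key, with parameters `w`. -/
def ofKey (q : X → ℕ) (w : ∀ f : Fin S.funs, Set (HLit S X f) → ℕ) (κ : Key S X) : Set (Lit S) :=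
  {l | (∃ u v, κ.E u v ∧ l = Lit.eq (.const (q u)) (.const (q v))) ∨
    (∃ u v, κ.D u v ∧ l = Lit.ne (.const (q u)) (.const (q v))) ∨
    ∃ f, ∃ Z ∈ κ.C f, ∃ z ∈ Z, l = Lit.flat (q z.1) f fun i => (z.2 i).elim (w f Z) q}

/-- The parameter for a context in the normalization. -/
noncomputable def canon (q : X → ℕ) (f : Fin S.funs) (Z : Set (HLit S X f)) : ℕ :=
  ctxConst (Set.range q) (enc q f '' Z)

/-- The properties of keys of flat literals. -/
structure Key.Valid (κ : Key S X) : Prop where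
  nonempty : ∀ f, ∀ Z ∈ κ.C f, Z.Nonempty
  uniform : ∀ f, ∀ Z ∈ κ.C f, ∀ z ∈ Z, ∀ z' ∈ Z, ∀ i, z.2 i = none ↔ z'.2 i = none
  some : ∀ f, ∀ Z ∈ κ.C f, ∀ z ∈ Z, ∃ i, z.2 i ≠ none
  full : ∀ f, ∀ Z ∈ κ.C f, ∀ Z' ∈ κ.C f, ∀ z ∈ Z, ∀ z' ∈ Z', (∀ i, z.2 i ≠ none) →
    (∀ i, z'.2 i ≠ none) → Z = Z'

section

variable {q : X → ℕ} {L : Set (Lit S)}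

theorem raw_valid (hL : BaseShape (Set.range q) L) : (raw q L).Valid where
  nonempty := by
    rintro f _ ⟨v, a, h, rfl⟩
    obtain ⟨⟨u, rfl⟩, -⟩ := hL.flat h
    obtain ⟨o, ho⟩ := exists_digs q a
    exact ⟨(u, o), mem_rawCtx.2 ⟨a, h, rfl, ho⟩⟩
  uniform := by
    rintro f _ ⟨v, a, h, rfl⟩ z hz z' hz' i
    rw [none_iff_of_mem_rawCtx hz, none_iff_of_mem_rawCtx hz']
  some := by
    rintro f _ ⟨v, a, h, rfl⟩ z hz
    obtain ⟨-, i, hi⟩ := hL.flat h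
    refine ⟨i, fun h' => ?_⟩
    exact (none_iff_of_mem_rawCtx hz i).1 h' hi
  -- A template without any constant outside the state consists of holes only, so literals over the
  -- state form one single context.
  full := by
    rintro f _ ⟨v, a, h, rfl⟩ _ ⟨v', a', h', rfl⟩ z hz z' hz' hf hf'
    have : template (Set.range q) a = template (Set.range q) a' := by
      rw [template_eq_iff]
      intro i
      have h₁ := hf i
      have h₂ := hf' i
      rw [Ne, none_iff_of_mem_rawCtx hz, not_not] at h₁
      rw [Ne, none_iff_of_mem_rawCtx hz', not_not] at h₂
      exact Or.inl ⟨h₁, h₂⟩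
    unfold rawCtx context
    rw [this]

theorem enc_image_rawCtx (hL : BaseShape (Set.range q) L) (f : Fin S.funs)
    (a : Fin (S.arity f) → ℕ) : enc q f '' rawCtx q L f a = context (Set.range q) L f a := by
  ext z
  constructor
  · rintro ⟨w, hw, rfl⟩
    exact hw
  · rintro ⟨v, b, hb, ht, rfl⟩
    obtain ⟨⟨u, rfl⟩, -⟩ := hL.flat hb
    obtain ⟨o, ho⟩ := exists_digs q b
    exact ⟨(u, o), mem_rawCtx.2 ⟨b, hb, ht, ho⟩, enc_eq_dig ho⟩

open scoped Classical in
theorem Digs.elim_eq {k : ℕ} {o : Fin k → Option X} {b : Fin k → ℕ} (h : Digs q o b) (w : ℕ) :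
    (fun i => (o i).elim w q) = fun i => if b i ∈ Set.range q then b i else w := by
  funext i
  obtain ⟨h₁, h₂⟩ | ⟨y, h₁, h₂⟩ := h i
  · rw [h₁, if_neg h₂]
    rfl
  · rw [h₁, h₂, if_pos ⟨y, rfl⟩]
    rfl

theorem flat_consts_subset {V : Set ℕ} {v : ℕ} {f : Fin S.funs} {a : Fin (S.arity f) → ℕ} :
    (Lit.flat v f a).consts ⊆ V ↔ v ∈ V ∧ ∀ i, a i ∈ V := by
  constructor
  · intro h
    refine ⟨h ?_, fun i => h ?_⟩
    · exact Or.inl (Term.self_mem_subterms _)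
    · exact Or.inr (Term.arg_mem_subterms i (Term.self_mem_subterms _))
  · rintro ⟨h₁, h₂⟩ c hc
    simp only [Lit.consts, Lit.flat, Lit.terms, Term.subterms, Set.mem_union, Set.mem_ofPred_eq,
      Set.mem_singleton_iff, Set.mem_iUnion, Term.const.injEq, reduceCtorEq, false_or] at hc
    obtain rfl | ⟨i, rfl⟩ := hc
    · exact h₁
    · exact h₂ i

/-- A context without holes never uses its parameter, so `ofKey` reproduces from it the flat
literals that normalization keeps unchanged. The other contexts get the same constants on both
sides. -/
theorem normalize_eq_ofKey (hL : BaseShape (Set.range q) L) :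
    normalize (Set.range q) L = ofKey q (canon q) (raw q L) := by
  ext l
  constructor
  · rintro (⟨hl, hc⟩ | ⟨Z, ⟨v₀, f, a₀, h₀, -, rfl⟩, v, f', a, ha, hdig, rfl⟩)
    · obtain ⟨_, _, ⟨u, rfl⟩, ⟨v, rfl⟩, rfl⟩ | ⟨_, _, ⟨u, rfl⟩, ⟨v, rfl⟩, rfl⟩ |
        ⟨v, f, a, ⟨u, rfl⟩, -, rfl⟩ := hL l hl
      · exact Or.inl ⟨u, v, hl, rfl⟩
      · exact Or.inr (Or.inl ⟨u, v, hl, rfl⟩)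
      · have h := (flat_consts_subset.1 hc).2
        choose ys hys using h
        refine Or.inr (Or.inr ⟨f, _, ⟨_, a, hl, rfl⟩, (u, fun i => some (ys i)),
          mem_rawCtx.2 ⟨a, hl, rfl, fun i => Or.inr ⟨_, rfl, (hys i).symm⟩⟩, ?_⟩)
        simp [hys]
    · obtain ⟨v', b, hb, ht, h⟩ := hdig
      obtain ⟨rfl, rfl, -⟩ := Holed.mk.inj h
      obtain ⟨⟨u, rfl⟩, -⟩ := hL.flat ha
      obtain ⟨o, ho⟩ := exists_digs q a
      refine Or.inr (Or.inr ⟨f', _, ⟨_, a₀, h₀, rfl⟩, (u, o), ?_, ?_⟩)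
      · refine ⟨_, b, hb, ht, ?_⟩
        rw [← h]
        exact enc_eq_dig ho
      · rw [ho.elim_eq, canon, enc_image_rawCtx hL]
  · rintro (⟨u, v, h, rfl⟩ | ⟨u, v, h, rfl⟩ | ⟨f, _, ⟨v, a, ha, rfl⟩, z, hz, rfl⟩)
    · refine Or.inl ⟨h, ?_⟩
      rintro c (hc | hc) <;> cases hc
      exacts [⟨u, rfl⟩, ⟨v, rfl⟩]
    · refine Or.inl ⟨h, ?_⟩
      rintro c (hc | hc) <;> cases hc
      exacts [⟨u, rfl⟩, ⟨v, rfl⟩]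
    · obtain ⟨b, hb, ht, hd⟩ := mem_rawCtx.1 hz
      rw [hd.elim_eq]
      by_cases hall : ∀ i, a i ∈ Set.range q
      · have hb' : ∀ i, b i ∈ Set.range q := by
          intro i
          obtain h | h := template_eq_iff.1 ht i
          · exact h.1
          · exact absurd (hall i) h.2
        simp only [hb', if_true]
        exact Or.inl ⟨hb, flat_consts_subset.2 ⟨⟨_, rfl⟩, hb'⟩⟩
      · push Not at hall
        refine Or.inr ⟨_, ⟨v, f, a, ha, hall, rfl⟩, _, f, b, hb, ⟨_, b, hb, ht, rfl⟩, ?_⟩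
        rw [canon, enc_image_rawCtx hL]

theorem ofKey_baseShape {w : ∀ f : Fin S.funs, Set (HLit S X f) → ℕ} {κ : Key S X} (hκ : κ.Valid) :
    BaseShape (Set.range q) (ofKey q w κ) := by
  rintro l (⟨u, v, h, rfl⟩ | ⟨u, v, h, rfl⟩ | ⟨f, Z, hZ, z, hz, rfl⟩)
  · exact Or.inl ⟨_, _, ⟨u, rfl⟩, ⟨v, rfl⟩, rfl⟩
  · exact Or.inr (Or.inl ⟨_, _, ⟨u, rfl⟩, ⟨v, rfl⟩, rfl⟩)
  · refine Or.inr (Or.inr ⟨_, f, _, ⟨_, rfl⟩, ?_, rfl⟩)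
    obtain ⟨i, hi⟩ := hκ.some f Z hZ z hz
    obtain ⟨y, hy⟩ := Option.ne_none_iff_exists'.1 hi
    exact ⟨i, y, by simp [hy]⟩

theorem digs_elim {k : ℕ} (o : Fin k → Option X) {w : ℕ}
    (hw : ∀ i, o i = none → w ∉ Set.range q) : Digs q o fun i => (o i).elim w q := by
  intro i
  cases h : o i with
  | none => exact Or.inl ⟨rfl, by simpa [h] using hw i h⟩
  | some y => exact Or.inr ⟨y, rfl, by simp [h]⟩

theorem Digs.unique (hq : Function.Injective q) {k : ℕ} {o o' : Fin k → Option X} {b : Fin k → ℕ}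
    (h : Digs q o b) (h' : Digs q o' b) : o = o' := by
  funext i
  obtain ⟨h₁, h₂⟩ | ⟨y, h₁, h₂⟩ := h i <;> obtain ⟨h₃, h₄⟩ | ⟨y', h₃, h₄⟩ := h' i
  · rw [h₁, h₃]
  · exact absurd ⟨y', h₄.symm⟩ h₂
  · exact absurd ⟨y, h₂.symm⟩ h₄
  · rw [h₁, h₃, hq (h₂.symm.trans h₄)]

/-- The parameters lie outside the state and differ between contexts with a common hole, so the
template of a literal leads back to its context. Contexts without holes have no parameter to
distinguish them, which is why `Valid` allows at most one of them for each function symbol. -/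
theorem raw_ofKey (hq : Function.Injective q) {w : ∀ f : Fin S.funs, Set (HLit S X f) → ℕ}
    {κ : Key S X} (hκ : κ.Valid)
    (hw : ∀ f, ∀ Z ∈ κ.C f, ∀ z ∈ Z, ∀ i, z.2 i = none → w f Z ∉ Set.range q)
    (hinj : ∀ f, ∀ Z ∈ κ.C f, ∀ Z' ∈ κ.C f, ∀ z ∈ Z, ∀ z' ∈ Z', ∀ i, z.2 i = none →
      z'.2 i = none → w f Z = w f Z' → Z = Z') : raw q (ofKey q w κ) = κ := by
  have hctx : ∀ f, ∀ Z ∈ κ.C f, ∀ z ∈ Z,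
      rawCtx q (ofKey q w κ) f (fun i => (z.2 i).elim (w f Z) q) = Z := by
    intro f Z hZ z hz
    ext z'
    rw [mem_rawCtx]
    constructor
    · rintro ⟨b, hb, ht, hd⟩
      obtain ⟨_, _, _, h⟩ | ⟨_, _, _, h⟩ | ⟨f', Z', hZ', z'', hz'', h⟩ := hb
      · simp [Lit.flat] at h
      · simp [Lit.flat] at h
      obtain ⟨hv, h⟩ := flat_inj h
      obtain rfl : f = f' := congrArg Sigma.fst h
      obtain rfl := eq_of_heq (Sigma.mk.inj h).2
      have h₁ := hq hv
      have h₂ := hd.unique hq (digs_elim z''.2 (hw f Z' hZ' z'' hz''))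
      obtain rfl : z' = z'' := Prod.ext h₁ h₂
      suffices Z' = Z by rwa [← this]
      by_cases hfull : ∀ i, z.2 i ≠ none
      · refine hκ.full f Z' hZ' Z hZ z' hz'' z hz (fun i hi => ?_) hfull
        obtain ⟨h₃, -⟩ | ⟨-, h₄⟩ := template_eq_iff.1 ht i
        · simp only [hi, Option.elim] at h₃
          exact hw f Z' hZ' z' hz'' i hi h₃
        · obtain ⟨y, hy⟩ := Option.ne_none_iff_exists'.1 (hfull i)
          simp [hy] at h₄
      · push Not at hfull
        obtain ⟨i, hi⟩ := hfull
        have hwZ := hw f Z hZ z hz i hi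
        obtain ⟨-, h₃⟩ | ⟨h₃, -⟩ := template_eq_iff.1 ht i
        · simp only [hi, Option.elim] at h₃
          exact absurd h₃ hwZ
        · simp only [hi, Option.elim] at h₃
          cases hi' : z'.2 i with
          | none => exact hinj f Z' hZ' Z hZ z' hz'' z hz i hi' hi (by simpa [hi'] using h₃)
          | some y => exact absurd ⟨y, by simpa [hi'] using h₃⟩ hwZ
    · intro hz'
      refine ⟨_, Or.inr (Or.inr ⟨f, Z, hZ, z', hz', rfl⟩), ?_,
        digs_elim _ (hw f Z hZ z' hz')⟩
      rw [template_eq_iff]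
      intro i
      have := hκ.uniform f Z hZ z hz z' hz' i
      cases h₁ : z.2 i with
      | none =>
        rw [this.1 h₁]
        exact Or.inr ⟨rfl, hw f Z hZ z hz i h₁⟩
      | some y =>
        have hne : z'.2 i ≠ none := fun h => by simp [this.2 h] at h₁
        obtain ⟨y', hy'⟩ := Option.ne_none_iff_exists'.1 hne
        rw [hy']
        exact Or.inl ⟨⟨y', rfl⟩, ⟨y, rfl⟩⟩
  apply Key.ext
  · funext u v
    refine propext ⟨?_, fun h => Or.inl ⟨u, v, h, rfl⟩⟩
    rintro (⟨u', v', h, h'⟩ | ⟨u', v', h, h'⟩ | ⟨f, Z, hZ, z, hz, h⟩)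
    · simp only [Lit.eq.injEq, Term.const.injEq] at h'
      rwa [hq h'.1, hq h'.2]
    · cases h'
    · simp [Lit.flat] at h
  · funext u v
    refine propext ⟨?_, fun h => Or.inr (Or.inl ⟨u, v, h, rfl⟩)⟩
    rintro (⟨u', v', h, h'⟩ | ⟨u', v', h, h'⟩ | ⟨f, Z, hZ, z, hz, h⟩)
    · cases h'
    · simp only [Lit.ne.injEq, Term.const.injEq] at h'
      rwa [hq h'.1, hq h'.2]
    · cases h
  · funext f
    ext Z
    constructor
    · rintro ⟨v, a, ⟨_, _, _, h⟩ | ⟨_, _, _, h⟩ | ⟨f', Z', hZ', z, hz, h⟩, rfl⟩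
      · simp [Lit.flat] at h
      · simp [Lit.flat] at h
      obtain ⟨hv, h⟩ := flat_inj h
      obtain rfl : f = f' := congrArg Sigma.fst h
      obtain rfl := eq_of_heq (Sigma.mk.inj h).2
      rwa [hctx f Z' hZ' z hz]
    · intro hZ
      obtain ⟨z, hz⟩ := hκ.nonempty f Z hZ
      exact ⟨_, _, Or.inr (Or.inr ⟨f, Z, hZ, z, hz, rfl⟩), (hctx f Z hZ z hz).symm⟩

theorem map_ofKey (σ : ℕ → ℕ) (w : ∀ f : Fin S.funs, Set (HLit S X f) → ℕ) (κ : Key S X) :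
    Lit.map σ '' ofKey q w κ = ofKey (σ ∘ q) (fun f Z => σ (w f Z)) κ := by
  have hflat : ∀ (f : Fin S.funs) (Z : Set (HLit S X f)) (z : HLit S X f),
      (Lit.flat (q z.1) f fun i => (z.2 i).elim (w f Z) q).map σ =
        Lit.flat ((σ ∘ q) z.1) f fun i => (z.2 i).elim (σ (w f Z)) (σ ∘ q) := by
    intro f Z z
    simp only [Lit.flat, Lit.map, Term.map, Function.comp]
    congr 2
    funext i
    cases z.2 i <;> rfl
  ext l
  constructor
  · rintro ⟨_, ⟨u, v, h, rfl⟩ | ⟨u, v, h, rfl⟩ | ⟨f, Z, hZ, z, hz, rfl⟩, rfl⟩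
    · exact Or.inl ⟨u, v, h, rfl⟩
    · exact Or.inr (Or.inl ⟨u, v, h, rfl⟩)
    · exact Or.inr (Or.inr ⟨f, Z, hZ, z, hz, hflat f Z z⟩)
  · rintro (⟨u, v, h, rfl⟩ | ⟨u, v, h, rfl⟩ | ⟨f, Z, hZ, z, hz, rfl⟩)
    · exact ⟨_, Or.inl ⟨u, v, h, rfl⟩, rfl⟩
    · exact ⟨_, Or.inr (Or.inl ⟨u, v, h, rfl⟩), rfl⟩
    · exact ⟨_, Or.inr (Or.inr ⟨f, Z, hZ, z, hz, rfl⟩), hflat f Z z⟩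

theorem Holed.code_injective : Function.Injective (Holed.code (S := S)) := by
  rintro ⟨v, f, a⟩ ⟨v', f', a'⟩ h
  have h := Encodable.encode_injective h
  simp only [Prod.mk.injEq] at h
  obtain ⟨rfl, hf, ha⟩ := h
  obtain rfl := Fin.ext hf
  rw [List.ofFn_injective ha]

theorem ctxConst_notMem {V : Set ℕ} (hV : V.Finite) (Z : Set (Holed S)) : ctxConst V Z ∉ V := by
  intro h
  have := le_csSup hV.bddAbove h
  unfold ctxConst at this
  omega

/-- The sum is the number whose binary digits mark the codes of the elements of the context. -/
theorem ctxConst_inj {V : Set ℕ} {Z Z' : Set (Holed S)} (hZ : Z.Finite) (hZ' : Z'.Finite)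
    (h : ctxConst V Z = ctxConst V Z') : Z = Z' := by
  classical
  have key : ∀ (Z : Set (Holed S)) (hZ : Z.Finite),
      ∑ᶠ z ∈ Z, 2 ^ z.code = ∑ i ∈ hZ.toFinset.image Holed.code, 2 ^ i := by
    intro Z hZ
    rw [finsum_mem_eq_finite_toFinset_sum _ hZ,
      Finset.sum_image fun _ _ _ _ h => Holed.code_injective h]
  have h' : ∑ᶠ z ∈ Z, 2 ^ z.code = ∑ᶠ z ∈ Z', 2 ^ z.code := by
    unfold ctxConst at h
    omega
  rw [key Z hZ, key Z' hZ'] at h'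
  have h'' := Finset.image_injective Holed.code_injective (Finset.geomSum_injective le_rfl h')
  exact hZ.toFinset_inj.1 h''

theorem canon_notMem [Finite X] (f : Fin S.funs) (Z : Set (HLit S X f)) :
    canon q f Z ∉ Set.range q := ctxConst_notMem (Set.finite_range q) _

theorem canon_injective [Finite X] (hq : Function.Injective q) (f : Fin S.funs) :
    Function.Injective (canon (S := S) q f) := by
  have henc : Function.Injective (enc (S := S) q f) := by
    rintro ⟨v, o⟩ ⟨v', o'⟩ h
    simp only [enc, Holed.mk.injEq, heq_eq_eq, true_and] at h
    obtain rfl := hq h.1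
    have : o = o' := funext fun i => Option.map_injective hq (congrFun h.2 i)
    rw [this]
  intro Z Z' h
  exact henc.image_injective (ctxConst_inj (Set.toFinite _) (Set.toFinite _) h)

theorem raw_ofKey_canon [Finite X] (hq : Function.Injective q) {κ : Key S X} (hκ : κ.Valid) :
    raw q (ofKey q (canon q) κ) = κ :=
  raw_ofKey hq hκ (fun f Z _ _ _ _ _ => canon_notMem f Z)
    fun f _ _ _ _ _ _ _ _ _ _ _ h => canon_injective hq f h

theorem ofKey_finite [Finite X] (w : ∀ f : Fin S.funs, Set (HLit S X f) → ℕ) (κ : Key S X) :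
    (ofKey q w κ).Finite := by
  refine ((Set.finite_range fun u : X × X => Lit.eq (S := S) (.const (q u.1)) (.const (q u.2))).union
    ((Set.finite_range fun u : X × X => Lit.ne (S := S) (.const (q u.1)) (.const (q u.2))).union
    (Set.finite_range fun u : Σ f : Fin S.funs, Set (HLit S X f) × HLit S X f =>
      Lit.flat (S := S) (q u.2.2.1) u.1 fun i => (u.2.2.2 i).elim (w u.1 u.2.1) q))).subset ?_
  rintro l (⟨u, v, h, rfl⟩ | ⟨u, v, h, rfl⟩ | ⟨f, Z, hZ, z, hz, rfl⟩)
  · exact Or.inl ⟨(u, v), rfl⟩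
  · exact Or.inr (Or.inl ⟨(u, v), rfl⟩)
  · exact Or.inr (Or.inr ⟨⟨f, Z, z⟩, rfl⟩)

end

/-- The double normalization with a renaming in between keeps the key of the literals. -/
theorem abstraction_eq_ofKey {q : Fin S.vars → ℕ} (hq : Function.Injective q) {L : Set (Lit S)}
    (hL : BaseShape (Set.range q) L) {σ : ℕ → ℕ}
    (hσ : IsInitRenaming q (normalize (Set.range q) L) σ) :
    normalize (Set.range (initState S)) (Lit.map σ '' normalize (Set.range q) L) =
      ofKey (initState S) (canon (initState S)) (raw q L) := by
  have hv := raw_valid hL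
  have hσq : σ ∘ q = initState S := funext hσ.init
  have hi : Function.Injective (initState S) := Fin.val_injective
  have h₁ := normalize_eq_ofKey hL
  rw [h₁] at hσ
  rw [h₁, map_ofKey, hσq, normalize_eq_ofKey (ofKey_baseShape hv)]
  -- the parameters that occur are constants of the normalized set
  have hmem : ∀ f, ∀ Z ∈ (raw q L).C f, (∃ z ∈ Z, ∃ i, z.2 i = none) →
      canon q f Z ∈ constsOf (ofKey q (canon q) (raw q L)) := by
    rintro f Z hZ ⟨z, hz, i, hi⟩
    refine ⟨_, Or.inr (Or.inr ⟨f, Z, hZ, z, hz, rfl⟩), Or.inr (Term.arg_mem_subterms i ?_)⟩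
    simp [hi, Term.subterms]
  have hq' : ∀ v, q v ∈ constsOf (ofKey q (canon q) (raw q L)) ∪ Set.range q := fun v => Or.inr ⟨v, rfl⟩
  rw [raw_ofKey hi hv]
  · rintro f Z hZ z hz i hzi ⟨v, h⟩
    rw [← hσ.init] at h
    exact canon_notMem (q := q) f Z ⟨v, hσ.inj (hq' v) (Or.inl (hmem f Z hZ ⟨z, hz, i, hzi⟩)) h⟩
  · intro f Z hZ Z' hZ' z hz z' hz' i hi hi' h
    exact canon_injective hq f
      (hσ.inj (Or.inl (hmem f Z hZ ⟨z, hz, i, hi⟩)) (Or.inl (hmem f Z' hZ' ⟨z', hz', i, hi'⟩)) h)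

end UP

/-! ### Bases determine the key, and bases exist -/

namespace UP

variable {S : Sig} {X : Type}

/-! ### Bases and keys -/

theorem Interp.eval_withCon {M : Interp S} {con' : ℕ → M.U} {t : Term S}
    (h : ∀ c, Term.const c ∈ t.subterms → con' c = M.con c) :
    (M.withCon con').eval t = M.eval t := by
  induction t with
  | const c => exact h c (Term.self_mem_subterms _)
  | app f ts ih =>
    simp only [eval]
    exact congrArg (M.fn f) (funext fun i => ih i fun c hc => h c (Term.arg_mem_subterms i hc))

namespace IsBasis

variable {Γ : Set (Lit S)} {q : X → ℕ} {W : Set ℕ} {β δ : Set (Lit S)}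

theorem satisfiable {V : Set ℕ} (hb : IsBasis Γ V W β δ) (hΓ : Satisfiable Γ) :
    Satisfiable (β ∪ δ) := by
  obtain ⟨M, hM⟩ := hΓ
  obtain ⟨con', -, h⟩ := (hb.equiv M).1 hM
  exact ⟨_, h⟩

theorem deq_union {V : Set ℕ} (hb : IsBasis Γ V W β δ) (hΓ : Satisfiable Γ) {s t : Term S}
    (h : Deq Γ s t) : Deq (β ∪ δ) s t :=
  (entails_eq_iff (hb.satisfiable hΓ)).1 fun M hM =>
    h.sound M ((hb.equiv M).2 ⟨M.con, fun _ _ => rfl, hM⟩)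

/-- By the equivalence in `IsBasis`, a model of `Γ` becomes one of `β ∪ δ` after reinterpreting the
constants of `W`, which does not affect terms free of them. -/
theorem deq_of_union {V : Set ℕ} (hb : IsBasis Γ V W β δ) (hΓ : Satisfiable Γ) {s t : Term S}
    (h : Deq (β ∪ δ) s t) (hs : ∀ c ∈ W, Term.const c ∉ s.subterms)
    (ht : ∀ c ∈ W, Term.const c ∉ t.subterms) : Deq Γ s t := by
  refine (entails_eq_iff hΓ).1 fun M hM => ?_
  obtain ⟨con', hc, hM'⟩ := (hb.equiv M).1 hM
  have := h.sound _ hM'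
  simp only [Interp.Sat] at this ⊢
  rwa [Interp.eval_withCon fun c hcs => hc c fun hcW => hs c hcW hcs,
    Interp.eval_withCon fun c hct => hc c fun hcW => ht c hcW hct] at this

theorem baseShape {V : Set ℕ} (hb : IsBasis Γ V W β δ) : BaseShape V β := by
  intro l hl
  obtain h | h | ⟨v, f, a, hv, -, ha, rfl⟩ := hb.shape_base l hl
  · exact Or.inl h
  · exact Or.inr (Or.inl h)
  · exact Or.inr (Or.inr ⟨v, f, a, hv, ha, rfl⟩)

theorem notMem_fresh {V : Set ℕ} (hb : IsBasis Γ V W β δ) {c : ℕ} (hc : c ∈ V) : c ∉ W :=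
  fun h => Set.disjoint_left.1 hb.fresh h (Or.inr hc)

theorem notMem_terms {V : Set ℕ} (hb : IsBasis Γ V W β δ) {t : Term S} (ht : t ∈ termsOf Γ) :
    ∀ c ∈ W, Term.const c ∉ t.subterms :=
  fun _ hc h => Set.disjoint_left.1 hb.fresh hc (Or.inl (termsOf_subterm ht h))

/-- Flat terms of a basis whose value is an index and some argument is an index. -/
theorem exists_flat (hb : IsBasis Γ (Set.range q) W β δ) {v : X} {f : Fin S.funs}
    {ts : Fin (S.arity f) → Term S} (h : Deq (β ∪ δ) (.const (q v)) (.app f ts))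
    {i₀ : Fin (S.arity f)} {y : X} (hi₀ : Deq (β ∪ δ) (.const (q y)) (ts i₀)) :
    ∃ v' b, Lit.flat (q v') f b ∈ β ∧ Deq (β ∪ δ) (.const (q v)) (.const (q v')) ∧
      ∀ i, Deq (β ∪ δ) (ts i) (.const (b i)) ∧ b i ∈ Set.range q ∪ W := by
  obtain ⟨zs, ⟨l, hl, hz⟩, hts⟩ := h.occurs_of_const
  have hflat : ∀ v' g (b : Fin (S.arity g) → ℕ), l = Lit.flat v' g b → v' ∈ Set.range q ∪ W →
      (∀ i, b i ∈ Set.range q ∪ W) → (v' ∈ Set.range q → (∃ i, b i ∈ Set.range q) → l ∈ β) →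
      ∃ v' b, Lit.flat (q v') f b ∈ β ∧ Deq (β ∪ δ) (.const (q v)) (.const (q v')) ∧
      ∀ i, Deq (β ∪ δ) (ts i) (.const (b i)) ∧ b i ∈ Set.range q ∪ W := by
    rintro v' g b rfl hv' hb' hβ
    simp only [Lit.flat, Lit.terms, Term.subterms, Set.mem_union, Set.mem_singleton_iff,
      Set.mem_iUnion, reduceCtorEq, false_or, exists_false, or_false] at hz
    obtain ⟨rfl, hz⟩ := Term.app.inj hz
    obtain rfl := eq_of_heq hz
    have hd : Deq (β ∪ δ) (.const (q v)) (.const v') :=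
      Derives.trans h (Derives.trans (.cong hts) (Derives.ax hl).symm)
    have hv'V : v' ∈ Set.range q := hv'.resolve_right fun hW => hb.sep_base _ ⟨v, rfl⟩ _ hW hd
    have hbi : b i₀ ∈ Set.range q :=
      (hb' i₀).resolve_right fun hW => hb.sep_base _ ⟨y, rfl⟩ _ hW (hi₀.trans (hts i₀))
    have hβ' := hβ hv'V ⟨i₀, hbi⟩
    obtain ⟨v'', rfl⟩ := hv'V
    exact ⟨v'', b, hβ', hd, fun i => ⟨hts i, hb' i⟩⟩
  obtain hl | hl := hl
  · obtain ⟨u, v, -, -, rfl⟩ | ⟨u, v, -, -, rfl⟩ | ⟨v', g, b, hv', hb', -, hlb⟩ := hb.shape_base l hl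
    · simp [Lit.terms, Term.subterms] at hz
    · simp [Lit.terms, Term.subterms] at hz
    · exact hflat v' g b hlb (Or.inl hv') hb' fun _ _ => hl
  · obtain ⟨u, v, -, -, rfl⟩ | ⟨u, v, -, -, rfl⟩ | ⟨v', g, b, hv', hb', hW, hlb⟩ :=
      hb.shape_rest l hl
    · simp [Lit.terms, Term.subterms] at hz
    · simp [Lit.terms, Term.subterms] at hz
    · refine hflat v' g b hlb hv' hb' ?_
      rintro h₁ ⟨i, h₂⟩
      exact absurd (hW h₁ i) (hb.notMem_fresh h₂)

theorem cl_iff (hb : IsBasis Γ (Set.range q) W β δ) (hq : Function.Injective q) {u v : X} :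
    (raw q β).Cl u v ↔ Deq Γ (.const (q u)) (.const (q v)) := by
  rw [← deq_iff_cl hb.baseShape hq]
  exact (hb.eq_iff _ ⟨u, rfl⟩ _ ⟨v, rfl⟩).symm

/-- The contexts of `Γ` are the closures of those of the base. -/
theorem ctxSet_eq_closeCtx (hb : IsBasis Γ (Set.range q) W β δ) (hΓ : Satisfiable Γ)
    (hq : Function.Injective q) {f : Fin S.funs} {a : Fin (S.arity f) → ℕ}
    {t : Fin (S.arity f) → Term S} {N : Set (Fin (S.arity f))}
    (hN : ∀ i, i ∈ N ↔ a i ∉ Set.range q) (hNe : ∃ i, i ∉ N)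
    (ht : ∀ i ∈ N, t i ∈ termsOf Γ ∧ a i ∈ W ∧ Deq (β ∪ δ) (.const (a i)) (t i)) :
    ctxSet Γ (fun u => .const (q u)) f N t = closeCtx (raw q β).Cl (rawCtx q β f a) := by
  ext ⟨v, o⟩
  constructor
  · rintro ⟨hm, hd⟩
    obtain ⟨i₀, hi₀⟩ := hNe
    obtain ⟨y, hy⟩ := Option.ne_none_iff_exists'.1 fun h => hi₀ ((hm i₀).1 h)
    obtain ⟨v', b, hfb, hv, hts⟩ := hb.exists_flat (hb.deq_union hΓ hd) (i₀ := i₀) (y := y) (by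
      rw [fill, show (v, o).2 i₀ = some y from hy]
      exact .refl _)
    obtain ⟨o', ho'⟩ := exists_digs q b
    have hconst : ∀ u, ∀ c ∈ W, (Term.const c : Term S) ∉ (Term.const (q u)).subterms := by
      rintro u c hc h
      cases h
      exact hb.notMem_fresh ⟨u, rfl⟩ hc
    have hcl : ∀ {u u' : X}, Deq (β ∪ δ) (.const (q u)) (.const (q u')) → (raw q β).Cl u u' :=
      fun h => (hb.cl_iff hq).2 (hb.deq_of_union hΓ h (hconst _) (hconst _))
    -- At a hole, `b i` equals the constant `a i` of `W`. It cannot belong to the state by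
    -- `sep_base`, and `sep_fresh` makes the two constants identical.
    have hbN : ∀ i ∈ N, b i = a i := by
      intro i hi
      obtain ⟨-, haW, hda⟩ := ht i hi
      have h₁ := (hts i).1
      rw [fill, show (v, o).2 i = none from (hm i).2 hi] at h₁
      have h₂ : Deq (β ∪ δ) (.const (a i)) (.const (b i)) := hda.trans h₁
      obtain ⟨u, hu⟩ | hbW := (hts i).2
      · rw [← hu] at h₂
        exact absurd h₂.symm (hb.sep_base _ ⟨u, rfl⟩ _ haW)
      · by_contra hne
        exact hb.sep_fresh _ haW _ hbW (Ne.symm hne) h₂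
    have hbN' : ∀ i ∉ N, ∃ y y', o i = some y ∧ b i = q y' ∧ (raw q β).Cl y' y := by
      intro i hi
      obtain ⟨y, hy⟩ := Option.ne_none_iff_exists'.1 fun h => hi ((hm i).1 h)
      have h₁ := (hts i).1
      rw [fill, show (v, o).2 i = some y from hy] at h₁
      obtain ⟨y', hy'⟩ | hbW := (hts i).2
      · rw [← hy'] at h₁
        exact ⟨y, y', hy, hy'.symm, (hcl h₁).symm⟩
      · exact absurd h₁ (hb.sep_base _ ⟨y, rfl⟩ _ hbW)
    refine ⟨(v', o'), mem_rawCtx.2 ⟨b, hfb, ?_, ho'⟩, (hcl hv).symm, fun i => ?_⟩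
    · rw [template_eq_iff]
      intro i
      by_cases hi : i ∈ N
      · exact Or.inr ⟨hbN i hi, (hN i).1 hi⟩
      · obtain ⟨y, y', -, h, -⟩ := hbN' i hi
        refine Or.inl ⟨⟨y', h.symm⟩, ?_⟩
        by_contra h'
        exact hi ((hN i).2 h')
    · by_cases hi : i ∈ N
      · have h₁ : o' i = none := by
          rw [ho'.none_iff, hbN i hi]
          exact (hN i).1 hi
        have h₂ : o i = none := (hm i).2 hi
        simp only [h₁, h₂]
        exact ⟨Iff.rfl, by simp⟩
      · obtain ⟨y, y', h₁, h₂, h₃⟩ := hbN' i hi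
        have h₄ : o' i = some y' := by
          obtain ⟨-, h₅⟩ | ⟨y'', h₅, h₆⟩ := ho' i
          · exact absurd ⟨y', h₂.symm⟩ h₅
          · rw [h₅, hq (h₂.symm.trans h₆)]
        simp only [h₁, h₄]
        refine ⟨by simp, ?_⟩
        rintro _ _ ⟨⟩ ⟨⟩
        exact h₃
  · rintro ⟨⟨v', o'⟩, hmem, hv, ho⟩
    obtain ⟨b, hfb, htb, hd⟩ := mem_rawCtx.1 hmem
    have hmask : ∀ i, o' i = none ↔ i ∈ N := fun i => by
      rw [none_iff_of_mem_rawCtx hmem i, hN]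
    have hmask' : ∀ i, o i = none ↔ i ∈ N := fun i => (ho i).1.symm.trans (hmask i)
    refine ⟨hmask', ?_⟩
    refine ((hb.cl_iff hq).1 hv).symm.trans ?_
    refine Derives.trans (t := .app f (fill (fun u => .const (q u)) t o')) ?_
      (deq_fill_of_holeRel fun i => ⟨(ho i).1, fun y y' h₁ h₂ =>
        (hb.cl_iff hq).1 ((ho i).2 y y' h₁ h₂)⟩)
    refine hb.deq_of_union hΓ ?_ ?_ ?_
    · refine Derives.trans (.ax (Or.inl hfb)) (.cong fun i => ?_)
      unfold fill
      obtain ⟨h₁, h₂⟩ | ⟨y, h₁, h₂⟩ := hd i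
      · rw [show o' i = none from h₁]
        obtain ⟨h₃, -⟩ | ⟨h₃, -⟩ := template_eq_iff.1 htb i
        · exact absurd h₃ h₂
        · rw [h₃]
          exact (ht i ((hmask i).1 h₁)).2.2
      · rw [show o' i = some y from h₁, h₂]
        exact .refl _
    · rintro c hc h
      cases h
      exact hb.notMem_fresh ⟨v', rfl⟩ hc
    · rintro c hc h
      simp only [Term.subterms, Set.mem_union, Set.mem_singleton_iff, reduceCtorEq, false_or,
        Set.mem_iUnion] at h
      obtain ⟨i, h⟩ := h
      unfold fill at h
      cases hi : o' i with
      | none =>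
        rw [hi] at h
        exact hb.notMem_terms (ht i ((hmask i).1 hi)).1 c hc h
      | some y =>
        rw [hi] at h
        cases h
        exact hb.notMem_fresh ⟨y, rfl⟩ hc

/-- The reason why every choice of bases works. Since `sep_base` separates `W` from the state and
`represents` gives each constant of `W` a term of `Γ`, these constants serve as unstored parameters;
by `sep_fresh`, equal parameters are the same constant. So the contexts of `β` are those of `Γ` up
to the equalities between state constants. -/
theorem keyOf_eq_sat (hb : IsBasis Γ (Set.range q) W β δ) (hΓ : Satisfiable Γ)
    (hq : Function.Injective q) : keyOf Γ (fun u => .const (q u)) = (raw q β).sat := by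
  apply Key.ext
  · funext u v
    exact propext (hb.cl_iff hq).symm
  · funext u v
    refine propext (Iff.trans ?_ (derives_ne_iff_cl hb.baseShape hq))
    exact hb.ne_iff _ ⟨u, rfl⟩ _ ⟨v, rfl⟩
  · funext f
    ext Z
    constructor
    · rintro ⟨N, p, ⟨i₀, hi₀⟩, hns, rfl, ⟨v, o⟩, hz⟩
      have hp := occurs_param hz (Deq.occurs_of_const hz.2)
      have hex : ∀ i, ∃ t, i ∈ N → t ∈ termsOf Γ ∧ Deq Γ (p i) t := by
        intro i
        by_cases hi : i ∈ N
        · obtain ⟨t, ht⟩ := (hp i hi).exists_mem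
          exact ⟨t, fun _ => ht⟩
        · exact ⟨p i, fun h => absurd h hi⟩
      choose t ht using hex
      rw [ctxSet_congr fun i hi => (ht i hi).2] at hz ⊢
      obtain ⟨y, hy⟩ := Option.ne_none_iff_exists'.1 fun h => hi₀ ((hz.1 i₀).1 h)
      obtain ⟨v', b, hfb, hv, hts⟩ := hb.exists_flat (hb.deq_union hΓ hz.2) (i₀ := i₀) (y := y) (by
        rw [fill, show (v, o).2 i₀ = some y from hy]
        exact .refl _)
      have hbN : ∀ i ∈ N, b i ∈ W ∧ Deq (β ∪ δ) (.const (b i)) (t i) := by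
        intro i hi
        have h₁ := (hts i).1
        rw [fill, show (v, o).2 i = none from (hz.1 i).2 hi] at h₁
        refine ⟨(hts i).2.resolve_left ?_, h₁.symm⟩
        rintro ⟨u, hu⟩
        rw [← hu] at h₁
        refine hns i hi u ((hb.deq_of_union hΓ h₁ (hb.notMem_terms (ht i hi).1) ?_).symm.trans
          (ht i hi).2.symm)
        rintro c hc h
        cases h
        exact hb.notMem_fresh ⟨u, rfl⟩ hc
      have hbN' : ∀ i ∉ N, b i ∈ Set.range q := by
        intro i hi
        obtain ⟨y, hy⟩ := Option.ne_none_iff_exists'.1 fun h => hi ((hz.1 i).1 h)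
        have h₁ := (hts i).1
        rw [fill, show (v, o).2 i = some y from hy] at h₁
        exact (hts i).2.resolve_right fun hbW => hb.sep_base _ ⟨y, rfl⟩ _ hbW h₁
      refine ⟨rawCtx q β f b, ⟨_, b, hfb, rfl⟩, hb.ctxSet_eq_closeCtx hΓ hq (fun i => ?_) ⟨i₀, hi₀⟩
        fun i hi => ⟨(ht i hi).1, hbN i hi⟩⟩
      constructor
      · exact fun hi h => hb.notMem_fresh h (hbN i hi).1
      · intro h
        by_contra hi
        exact h (hbN' i hi)
    · rintro ⟨_, ⟨w, a, hfa, rfl⟩, rfl⟩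
      obtain ⟨⟨v, rfl⟩, i₀, hi₀⟩ := hb.baseShape.flat hfa
      have haW : ∀ i, a i ∈ Set.range q ∪ W := by
        obtain ⟨_, _, -, -, h'⟩ | ⟨_, _, -, -, h'⟩ | ⟨v', f', a', -, ha', -, h'⟩ :=
          hb.shape_base _ hfa
        · simp [Lit.flat] at h'
        · simp [Lit.flat] at h'
        · obtain ⟨-, h''⟩ := flat_inj h'
          obtain rfl : f = f' := congrArg Sigma.fst h''
          obtain rfl := eq_of_heq (Sigma.mk.inj h'').2
          exact ha'
      have hex : ∀ i, ∃ t : Term S, a i ∉ Set.range q → t ∈ termsOf Γ ∧ a i ∈ W ∧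
          Deq (β ∪ δ) (.const (a i)) t := by
        intro i
        obtain h | h := haW i
        · exact ⟨.const 0, fun h' => absurd h h'⟩
        · obtain ⟨t, ht, hd⟩ := hb.represents _ h
          exact ⟨t, fun _ => ⟨ht, h, hd⟩⟩
      choose t ht using hex
      have hc := hb.ctxSet_eq_closeCtx hΓ hq (f := f) (a := a) (t := t)
        (N := {i | a i ∉ Set.range q}) (fun i => Iff.rfl) ⟨i₀, by simpa using hi₀⟩ ht
      refine ⟨_, t, ⟨i₀, by simpa using hi₀⟩, fun i hi u hu => ?_, hc.symm, ?_⟩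
      · exact hb.sep_base _ ⟨u, rfl⟩ _ (ht i hi).2.1 ((hb.deq_union hΓ hu).trans (ht i hi).2.2.symm)
      · obtain ⟨o, ho⟩ := exists_digs q a
        refine ⟨(v, o), (v, o), mem_rawCtx.2 ⟨a, hfa, rfl, ho⟩, .refl _, fun i => ⟨Iff.rfl, ?_⟩⟩
        intro y y' h₁ h₂
        rw [h₁] at h₂
        cases h₂
        exact .refl _

end IsBasis

/-! ### Existence of bases -/

section

variable {Γ : Set (Lit S)} {q : X → ℕ}

/-- The representative of the class of a term. -/
noncomputable def repr (Γ : Set (Lit S)) (t : Term S) : Term S :=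
  (Quotient.mk (eqSetoid Γ) t).out

theorem repr_deq (Γ : Set (Lit S)) (t : Term S) : Deq Γ (repr Γ t) t :=
  Quotient.mk_out (s := eqSetoid Γ) t

theorem repr_congr {s t : Term S} (h : Deq Γ s t) : repr Γ s = repr Γ t := by
  unfold repr
  rw [Quotient.sound (s := eqSetoid Γ) h]

theorem bind_flat {θ : ℕ → Term S} {v : ℕ} {f : Fin S.funs} {a : Fin (S.arity f) → ℕ} :
    (Lit.flat v f a).bind θ = Lit.eq (θ v) (.app f fun i => θ (a i)) := rfl

/-- A basis that contains all derivable literals of the right shape. -/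
theorem exists_basis [Finite X] (hΓ : Γ.Finite) (q : X → ℕ) : ∃ W β δ,
    IsBasis Γ (Set.range q) W β δ ∧ raw q β = keyOf Γ fun u => .const (q u) := by
  classical
  set V := Set.range q with hV
  -- the classes of terms that are not stored get fresh constants
  set NS : Set (Term S) := repr Γ '' {t ∈ termsOf Γ | ∀ u, ¬ Deq Γ (.const (q u)) t} with hNS
  have hNSfin : NS.Finite := ((termsOf_finite hΓ).subset fun t ht => ht.1).image _
  obtain ⟨j₀, hj₀⟩ := Set.countable_iff_exists_injOn.1 hNSfin.countable
  -- Constants above `B` are fresh for `Γ` and for the state.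
  obtain ⟨B, hB⟩ := ((constsOf_finite hΓ).union (Set.finite_range q)).bddAbove
  set j : Term S → ℕ := fun t => B + 1 + j₀ t with hj
  have hjinj : ∀ s ∈ NS, ∀ t ∈ NS, j s = j t → s = t := by
    intro s hs t ht h
    exact hj₀ hs ht (by simpa [hj] using h)
  have hjfresh : ∀ t, j t ∉ constsOf Γ ∪ V := by
    intro t ht
    have := hB ht
    simp only [hj] at this
    omega
  set W := j '' NS with hW
  -- `θ` expands each fresh constant to the term that it names.
  set θ : ℕ → Term S := fun c => if h : ∃ t ∈ NS, j t = c then h.choose else .const c with hθ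
  have hθj : ∀ t ∈ NS, θ (j t) = t := by
    intro t ht
    have hex : ∃ s ∈ NS, j s = j t := ⟨t, ht, rfl⟩
    simp only [hθ]
    rw [dif_pos hex]
    exact hjinj _ hex.choose_spec.1 _ ht hex.choose_spec.2
  have hθc : ∀ c, c ∈ constsOf Γ ∪ V → θ c = .const c := by
    intro c hc
    refine dif_neg ?_
    rintro ⟨t, -, rfl⟩
    exact hjfresh t hc
  have hθq : ∀ u, θ (q u) = .const (q u) := fun u => hθc _ (Or.inr ⟨u, rfl⟩)
  have hθW : ∀ w ∈ W, (∀ u, ¬ Deq Γ (.const (q u)) (θ w)) ∧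
      ∃ t ∈ termsOf Γ, Deq Γ (θ w) t ∧ repr Γ t = θ w := by
    rintro _ ⟨_, ⟨t, ⟨ht, hns⟩, rfl⟩, rfl⟩
    rw [hθj _ ⟨t, ⟨ht, hns⟩, rfl⟩]
    exact ⟨fun u hu => hns u (hu.trans (repr_deq Γ t)), t, ht, repr_deq Γ t, rfl⟩
  have hfreshV : ∀ w ∈ W, w ∉ V := by
    rintro _ ⟨t, -, rfl⟩ h
    exact hjfresh t (Or.inr h)
  -- representing constants
  have hrep : ∀ t, Occurs Γ t → ∃ c, Deq Γ (θ c) t ∧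
      ((∃ u, c = q u) ∨ (c ∈ W ∧ ∀ u, ¬ Deq Γ (.const (q u)) t)) := by
    intro t ho
    by_cases hst : ∃ u, Deq Γ (.const (q u)) t
    · obtain ⟨u, hu⟩ := hst
      exact ⟨q u, by rwa [hθq], Or.inl ⟨u, rfl⟩⟩
    · push Not at hst
      obtain ⟨s, hs, hd⟩ := ho.exists_mem
      have hmem : repr Γ s ∈ NS := ⟨s, ⟨hs, fun u hu => hst u (hu.trans hd.symm)⟩, rfl⟩
      refine ⟨j (repr Γ s), ?_, Or.inr ⟨⟨_, hmem, rfl⟩, hst⟩⟩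
      rw [hθj _ hmem]
      exact (repr_deq Γ s).trans hd.symm
  -- Both `β` and `δ` contain every literal of an admissible shape whose expansion is derivable.
  -- Hence no closure step is missing in `β`, and its raw key needs no saturation.
  set β : Set (Lit S) := {l | Derives Γ (l.bind θ) ∧
    ((∃ u v, u ∈ V ∧ v ∈ V ∧ l = Lit.eq (.const u) (.const v)) ∨
    (∃ u v, u ∈ V ∧ v ∈ V ∧ l = Lit.ne (.const u) (.const v)) ∨
    (∃ v f a, v ∈ V ∧ (∀ i, a i ∈ V ∪ W) ∧ (∃ i, a i ∈ V) ∧ l = Lit.flat v f a))} with hβ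
  set δ : Set (Lit S) := {l | Derives Γ (l.bind θ) ∧
    ((∃ w u, w ∈ V ∪ W ∧ u ∉ V ∪ W ∧ l = Lit.eq (.const w) (.const u)) ∨
    (∃ u w, u ∈ W ∧ w ∈ W ∪ V ∧ l = Lit.ne (.const u) (.const w)) ∨
    (∃ v f a, v ∈ V ∪ W ∧ (∀ i, a i ∈ V ∪ W) ∧ (v ∈ V → ∀ i, a i ∈ W) ∧ l = Lit.flat v f a))}
    with hδ
  have hback : ∀ {l}, Derives (β ∪ δ) l → Derives Γ (l.bind θ) := fun h =>
    h.bind (by rintro l (hl | hl) <;> exact hl.1)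
  have hVW : ∀ {c t}, ((∃ u, c = q u) ∨ (c ∈ W ∧ ∀ u, ¬ Deq Γ (.const (q u)) t)) → c ∈ V ∪ W := by
    rintro c t (⟨u, rfl⟩ | ⟨h, -⟩)
    exacts [Or.inl ⟨u, rfl⟩, Or.inr h]
  have hflat : ∀ v f a, v ∈ V ∪ W → (∀ i, a i ∈ V ∪ W) →
      Deq Γ (θ v) (.app f fun i => θ (a i)) → Lit.flat v f a ∈ β ∪ δ := by
    intro v f a hv ha hd
    by_cases h : v ∈ V ∧ ∃ i, a i ∈ V
    · exact Or.inl ⟨hd, Or.inr (Or.inr ⟨v, f, a, h.1, ha, h.2, rfl⟩)⟩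
    · refine Or.inr ⟨hd, Or.inr (Or.inr ⟨v, f, a, hv, ha, fun hv' i => ?_, rfl⟩)⟩
      exact (ha i).resolve_left fun hi => h ⟨hv', i, hi⟩
  -- every term is equal to its representing constant
  have hterm : ∀ t ∈ termsOf Γ, ∀ c, Deq Γ (θ c) t →
      ((∃ u, c = q u) ∨ (c ∈ W ∧ ∀ u, ¬ Deq Γ (.const (q u)) t)) → Deq (β ∪ δ) (.const c) t := by
    intro t
    induction t with
    | const k =>
      intro ht c hd hc
      by_cases hk : k ∈ V
      · obtain ⟨u, hu⟩ := hk
        obtain ⟨u', rfl⟩ | ⟨-, h⟩ := hc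
        · rw [← hu] at hd ⊢
          refine .ax (Or.inl ⟨?_, Or.inl ⟨_, _, ⟨u', rfl⟩, ⟨u, rfl⟩, rfl⟩⟩)
          simp only [Lit.bind, Term.bind, hθq]
          rwa [hθq] at hd
        · rw [← hu] at h
          exact absurd (.refl _) (h u)
      · refine .ax (Or.inr ⟨?_, Or.inl ⟨c, k, hVW hc, ?_, rfl⟩⟩)
        · simp only [Lit.bind, Term.bind]
          rwa [hθc k (Or.inl ht)]
        · rintro (h | ⟨s, -, hs⟩)
          · exact hk h
          · exact hjfresh s (Or.inl (hs ▸ ht))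
    | app f ts ih =>
      intro ht c hd hc
      have hr := fun i => hrep (ts i) (.of_mem (termsOf_arg ht i))
      choose b hb hb' using hr
      refine Derives.trans (.ax (hflat c f b (hVW hc) (fun i => hVW (hb' i)) ?_)) (.cong fun i => ?_)
      · exact hd.trans (.cong fun i => (hb i).symm)
      · exact ih i (termsOf_arg ht i) (b i) (hb i) (hb' i)
  have hforth : ∀ l ∈ Γ, Derives (β ∪ δ) l := by
    intro l hl
    cases l with
    | eq s t =>
      have hm := mem_termsOf_eq hl
      obtain ⟨c, hc, hc'⟩ := hrep s (.of_mem hm.1)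
      have hc'' : (∃ u, c = q u) ∨ (c ∈ W ∧ ∀ u, ¬ Deq Γ (.const (q u)) t) :=
        hc'.imp_right fun h => ⟨h.1, fun u hu => h.2 u (hu.trans (Derives.ax hl).symm)⟩
      exact (hterm s hm.1 c hc hc').symm.trans (hterm t hm.2 c (hc.trans (.ax hl)) hc'')
    | ne s t =>
      have hm := mem_termsOf_ne hl
      obtain ⟨c, hc, hc'⟩ := hrep s (.of_mem hm.1)
      obtain ⟨d, hd, hd'⟩ := hrep t (.of_mem hm.2)
      have hcd : Derives Γ (Lit.ne (θ c) (θ d)) := (Derives.ax hl).ne_congr hc.symm hd.symm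
      have : Derives (β ∪ δ) (Lit.ne (.const c) (.const d)) := by
        rcases hc' with ⟨u, rfl⟩ | ⟨hcW, -⟩
        · rcases hd' with ⟨v, rfl⟩ | ⟨hdW, -⟩
          · exact .ax (Or.inl ⟨hcd, Or.inr (Or.inl ⟨_, _, ⟨u, rfl⟩, ⟨v, rfl⟩, rfl⟩)⟩)
          · exact .ne_symm (.ax (Or.inr ⟨hcd.ne_symm,
              Or.inr (Or.inl ⟨_, _, hdW, Or.inr ⟨u, rfl⟩, rfl⟩)⟩))
        · exact .ax (Or.inr ⟨hcd, Or.inr (Or.inl ⟨_, _, hcW, (hVW hd').symm, rfl⟩)⟩)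
      exact this.ne_congr (hterm s hm.1 c hc hc') (hterm t hm.2 d hd hd')
  have hβeq : ∀ {u v}, Lit.eq (.const (q u)) (.const (q v)) ∈ β ↔
      Deq Γ (.const (q u)) (.const (q v)) := by
    intro u v
    constructor
    · rintro ⟨h, -⟩
      simpa only [Lit.bind, Term.bind, hθq] using h
    · intro h
      refine ⟨?_, Or.inl ⟨_, _, ⟨u, rfl⟩, ⟨v, rfl⟩, rfl⟩⟩
      simpa only [Lit.bind, Term.bind, hθq] using h
  have hβne : ∀ {u v}, Lit.ne (.const (q u)) (.const (q v)) ∈ β ↔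
      Derives Γ (Lit.ne (.const (q u)) (.const (q v))) := by
    intro u v
    constructor
    · rintro ⟨h, -⟩
      simpa only [Lit.bind, Term.bind, hθq] using h
    · intro h
      refine ⟨?_, Or.inr (Or.inl ⟨_, _, ⟨u, rfl⟩, ⟨v, rfl⟩, rfl⟩)⟩
      simpa only [Lit.bind, Term.bind, hθq] using h
  refine ⟨W, β, δ, ⟨?_, ?_, fun l hl => hl.2, fun l hl => hl.2, ?_, ?_, ?_, ?_, ?_⟩, ?_⟩
  · rw [Set.disjoint_left]
    rintro _ ⟨t, -, rfl⟩
    exact hjfresh t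
  · intro M
    have hev : ∀ t : Term S, (M.withCon fun c => M.eval (θ c)).eval t = M.eval (t.bind θ) := by
      intro t
      induction t with
      | const c => rfl
      | app f ts ih =>
        simp only [Interp.eval, Term.bind]
        exact congrArg (M.fn f) (funext ih)
    constructor
    · intro hM
      -- Each fresh constant is interpreted as the value of the term that it names.
      refine ⟨fun c => M.eval (θ c), fun c hc => ?_, fun l hl => ?_⟩
      · have : θ c = .const c := by
          refine dif_neg ?_
          rintro ⟨t, ht, rfl⟩
          exact hc ⟨t, ht, rfl⟩
        show M.eval (θ c) = M.con c
        rw [this]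
        rfl
      · have : Derives Γ (l.bind θ) := by
          rcases hl with hl | hl <;> exact hl.1
        have := this.sound M hM
        cases l <;>
        · simp only [Interp.Sat, Lit.bind, hev] at this ⊢
          exact this
    · rintro ⟨con', hc, hM⟩ l hl
      have := (hforth l hl).sound _ hM
      have hev' : ∀ t ∈ termsOf Γ, (M.withCon con').eval t = M.eval t := by
        intro t ht
        refine Interp.eval_withCon fun c hct => hc c ?_
        rintro ⟨s, -, rfl⟩
        exact hjfresh s (Or.inl (termsOf_subterm ht hct))
      cases l with
      | eq s t =>
        have hm := mem_termsOf_eq hl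
        simp only [Interp.Sat, hev' s hm.1, hev' t hm.2] at this ⊢
        exact this
      | ne s t =>
        have hm := mem_termsOf_ne hl
        simp only [Interp.Sat, hev' s hm.1, hev' t hm.2] at this ⊢
        exact this
  · rintro _ ⟨u, rfl⟩ w hw h
    have := hback h
    simp only [Lit.bind, Term.bind, hθq] at this
    exact (hθW w hw).1 u this
  · intro w₁ h₁ w₂ h₂ hne h
    have hd : Deq Γ (θ w₁) (θ w₂) := hback h
    obtain ⟨-, t₁, -, hd₁, hr₁⟩ := hθW w₁ h₁
    obtain ⟨-, t₂, -, hd₂, hr₂⟩ := hθW w₂ h₂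
    have heq : θ w₁ = θ w₂ := by
      rw [← hr₁, ← hr₂]
      exact repr_congr (hd₁.symm.trans (hd.trans hd₂))
    obtain ⟨s₁, hs₁, rfl⟩ := h₁
    obtain ⟨s₂, hs₂, rfl⟩ := h₂
    rw [hθj _ hs₁, hθj _ hs₂] at heq
    exact hne (by rw [heq])
  · rintro _ ⟨u, rfl⟩ _ ⟨v, rfl⟩
    refine ⟨fun h => .ax (hβeq.2 h), fun h => ?_⟩
    have := hback (h.mono Set.subset_union_left)
    simpa only [Lit.bind, Term.bind, hθq] using this
  · rintro _ ⟨u, rfl⟩ _ ⟨v, rfl⟩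
    refine ⟨fun h => .ax (hβne.2 h), fun h => ?_⟩
    have := hback (h.mono Set.subset_union_left)
    simpa only [Lit.bind, Term.bind, hθq] using this
  · intro w hw
    obtain ⟨hns, t, ht, hd, -⟩ := hθW w hw
    exact ⟨t, ht, hterm t ht w hd (Or.inr ⟨hw, fun u hu => hns u (hu.trans hd.symm)⟩)⟩
  · -- the contexts of the base
    have hctx : ∀ f (a : Fin (S.arity f) → ℕ), (∀ i, a i ∈ V ∪ W) → (∃ i, a i ∈ V) →
        rawCtx q β f a =
          ctxSet Γ (fun u => .const (q u)) f {i | a i ∉ V} fun i => θ (a i) := by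
      intro f a ha haV
      ext z
      constructor
      · intro hz
        have hm := none_iff_of_mem_rawCtx hz
        obtain ⟨b, hb, ht, hd⟩ := mem_rawCtx.1 hz
        refine ⟨hm, ?_⟩
        have hb' : Deq Γ (θ (q z.1)) (.app f fun i => θ (b i)) := hb.1
        rw [hθq] at hb'
        refine Derives.trans hb' (.cong fun i => ?_)
        unfold fill
        obtain ⟨h₁, h₂⟩ | ⟨y, h₁, h₂⟩ := hd i
        · rw [h₁]
          obtain ⟨h₃, -⟩ | ⟨h₃, -⟩ := template_eq_iff.1 ht i
          · exact absurd h₃ h₂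
          · rw [h₃]
            exact .refl _
        · rw [h₁, h₂, hθq]
          exact .refl _
      · rintro ⟨hm, hd⟩
        have hmask : ∀ i, z.2 i = none → a i ∉ Set.range q := fun i hi => (hm i).1 hi
        have hdigs : Digs q z.2 fun i => (z.2 i).elim (a i) q := by
          intro i
          cases h : z.2 i with
          | none => exact Or.inl ⟨rfl, by simpa [h] using hmask i h⟩
          | some y => exact Or.inr ⟨y, rfl, by simp [h]⟩
        refine mem_rawCtx.2 ⟨fun i => (z.2 i).elim (a i) q, ⟨?_, Or.inr (Or.inr ⟨_, f, _, ⟨_, rfl⟩,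
          fun i => ?_, ?_, rfl⟩)⟩, ?_, hdigs⟩
        · rw [bind_flat, hθq]
          refine Derives.trans hd (.cong fun i => ?_)
          unfold fill
          cases h : z.2 i with
          | none => exact .refl _
          | some y =>
            simp only [Option.elim, hθq]
            exact .refl _
        · cases h : z.2 i with
          | none => exact ha i
          | some y => exact Or.inl ⟨y, rfl⟩
        · obtain ⟨i, hi⟩ := haV
          obtain ⟨y, hy⟩ := Option.ne_none_iff_exists'.1 fun h => hmask i h hi
          exact ⟨i, y, by simp [hy]⟩
        · rw [template_eq_iff]
          intro i
          cases h : z.2 i with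
          | none => exact Or.inr ⟨rfl, hmask i h⟩
          | some y =>
            refine Or.inl ⟨⟨y, rfl⟩, ?_⟩
            by_contra h'
            simp [(hm i).2 h'] at h
    apply Key.ext
    · funext u v
      exact propext hβeq
    · funext u v
      exact propext hβne
    · funext f
      ext Z
      constructor
      · rintro ⟨v, a, ⟨hd, hsh⟩, rfl⟩
        obtain ⟨_, _, -, -, h'⟩ | ⟨_, _, -, -, h'⟩ | ⟨v', f', a', ⟨u, rfl⟩, ha', haV, h'⟩ := hsh
        · simp [Lit.flat] at h'
        · simp [Lit.flat] at h'
        obtain ⟨rfl, h''⟩ := flat_inj h'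
        obtain rfl : f = f' := congrArg Sigma.fst h''
        obtain rfl := eq_of_heq (Sigma.mk.inj h'').2
        obtain ⟨o, ho⟩ := exists_digs q a
        obtain ⟨i₀, hi₀⟩ := haV
        refine ⟨_, _, ⟨i₀, by simpa using hi₀⟩, fun i hi w hw => ?_, hctx f a ha' ⟨i₀, hi₀⟩, (u, o), ?_⟩
        · exact (hθW _ ((ha' i).resolve_left hi)).1 w hw
        · exact mem_rawCtx.2 ⟨a, ⟨hd, Or.inr (Or.inr ⟨_, f, a, ⟨u, rfl⟩, ha', ⟨i₀, hi₀⟩, rfl⟩)⟩,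
            rfl, ho⟩
      · rintro ⟨N, p, ⟨i₀, hi₀⟩, hns, rfl, ⟨v, o⟩, hz⟩
        have hp := occurs_param hz (Deq.occurs_of_const hz.2)
        -- Indices give constants of the state; a hole gets the constant of `W` that names the class
        -- of its parameter.
        have hex : ∀ i, ∃ c, (∀ y, o i = some y → c = q y) ∧
            (o i = none → c ∈ W ∧ Deq Γ (θ c) (p i)) := by
          intro i
          cases h : o i with
          | none =>
            have hi := (hz.1 i).1 h
            obtain ⟨c, hc, ⟨u, rfl⟩ | ⟨hcW, -⟩⟩ := hrep _ (hp i hi)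
            · rw [hθq] at hc
              exact absurd hc (hns i hi u)
            · exact ⟨c, by simp, fun _ => ⟨hcW, hc⟩⟩
          | some y => exact ⟨q y, by simp, by simp⟩
        choose a ha ha' using hex
        have haVW : ∀ i, a i ∈ V ∪ W := by
          intro i
          cases h : o i with
          | none => exact Or.inr (ha' i h).1
          | some y => exact Or.inl ⟨y, (ha i y h).symm⟩
        have hN : N = {i | a i ∉ V} := by
          ext i
          rw [← hz.1 i]
          cases h : o i with
          | none => simpa [h] using hfreshV _ (ha' i h).1
          | some y =>
            simp only [reduceCtorEq, Set.mem_ofPred_eq, false_iff, not_not, h]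
            exact ⟨y, (ha i y h).symm⟩
        have haV : ∃ i, a i ∈ V := by
          refine ⟨i₀, ?_⟩
          by_contra h
          exact hi₀ (hN ▸ h)
        have hZ : ctxSet Γ (fun u => .const (q u)) f N p = rawCtx q β f a := by
          rw [hctx f a haVW haV, ← hN]
          exact ctxSet_congr fun i hi => (ha' i ((hz.1 i).2 hi)).2.symm
        rw [hZ] at hz ⊢
        obtain ⟨b, hb, -, -⟩ := mem_rawCtx.1 hz
        refine ⟨q v, a, ⟨?_, Or.inr (Or.inr ⟨_, f, a, ⟨v, rfl⟩, haVW, haV, rfl⟩)⟩, rfl⟩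
        rw [← hZ] at hz
        rw [bind_flat, hθq]
        refine Derives.trans hz.2 (.cong fun i => ?_)
        unfold fill
        cases h : o i with
        | none =>
          simp only [h]
          exact (ha' i h).2.symm
        | some y =>
          simp only [h, ha i y h, hθq]
          exact .refl _

end

/-! ### The abstraction -/

theorem exists_initRenaming {q : Fin S.vars → ℕ} (hq : Function.Injective q) {Γ : Set (Lit S)}
    (hΓ : Γ.Finite) : ∃ σ, IsInitRenaming q Γ σ := by
  classical
  obtain ⟨B, hB⟩ := (constsOf_finite hΓ).bddAbove
  -- Initial constants that do not belong to the state are moved beyond all constants of `Γ` and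
  -- beyond all initial constants; this keeps `σ` injective where needed.
  set σ : ℕ → ℕ := fun c => if h : ∃ v, q v = c then h.choose.val else
    if c < S.vars then B + S.vars + 1 + c else c with hσ
  have h₁ : ∀ v, σ (q v) = v.val := by
    intro v
    have hex : ∃ u, q u = q v := ⟨v, rfl⟩
    simp only [hσ]
    rw [dif_pos hex, hq hex.choose_spec]
  have h₂ : ∀ c, c ∉ Set.range q → σ c = if c < S.vars then B + S.vars + 1 + c else c :=
    fun c hc => dif_neg hc
  refine ⟨σ, ⟨?_, h₁, ?_⟩⟩
  · intro c hc d hd hcd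
    have hc' : c ∉ Set.range q → c ≤ B := fun h => hB (hc.resolve_right h)
    have hd' : d ∉ Set.range q → d ≤ B := fun h => hB (hd.resolve_right h)
    by_cases hcq : c ∈ Set.range q <;> by_cases hdq : d ∈ Set.range q
    · obtain ⟨u, rfl⟩ := hcq
      obtain ⟨v, rfl⟩ := hdq
      rw [h₁, h₁] at hcd
      rw [Fin.ext hcd]
    · obtain ⟨u, rfl⟩ := hcq
      have := u.isLt
      rw [h₁, h₂ d hdq] at hcd
      split_ifs at hcd <;> omega
    · obtain ⟨u, rfl⟩ := hdq
      have := u.isLt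
      rw [h₁, h₂ c hcq] at hcd
      split_ifs at hcd <;> omega
    · have := hc' hcq
      have := hd' hdq
      rw [h₂ c hcq, h₂ d hdq] at hcd
      split_ifs at hcd <;> omega
  · intro c _ hc hc'
    rw [h₂ c hc, if_neg]
    exact fun h => hc' ⟨⟨c, h⟩, rfl⟩

/-- The abstract configuration for a statement and a key. -/
noncomputable def absConfig (s : Stmt S) (κ : Key S (Fin S.vars)) : Config S :=
  ⟨s, initState S, ofKey (initState S) (canon (initState S)) κ⟩

theorem initState_injective : Function.Injective (initState S) := Fin.val_injective

/-- `κ` is the raw key of the chosen base and may depend on it, but it can be read off the abstract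
path condition, and its saturation is the key of `c` in any case. -/
theorem AbstractsTo.exists_key {c a : Config S} (hc : c.Regular) (h : AbstractsTo c a) :
    ∃ κ, a = absConfig c.stmt κ ∧ c.key = (raw (initState S) a.pc).sat := by
  obtain ⟨W, β, δ, σ, hb, hσ, rfl⟩ := h
  refine ⟨raw c.state β, ?_, ?_⟩
  · rw [abstraction_eq_ofKey hc.inj hb.baseShape hσ]
    rfl
  · simp only
    rw [abstraction_eq_ofKey hc.inj hb.baseShape hσ,
      raw_ofKey_canon initState_injective (raw_valid hb.baseShape)]
    exact hb.keyOf_eq_sat hc.sat hc.inj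

/-- The basis from `exists_basis` makes the abstraction describe the key itself, so that it is a
function of the statement and the key. -/
theorem abstractsTo_absConfig {c : Config S} (hc : c.Regular) :
    AbstractsTo c (absConfig c.stmt c.key) ∧
      raw (initState S) (absConfig c.stmt c.key).pc = c.key := by
  obtain ⟨W, β, δ, hb, hk⟩ := exists_basis hc.finite c.state
  have hfin : (normalize (Set.range c.state) β).Finite := by
    rw [normalize_eq_ofKey hb.baseShape]
    exact ofKey_finite _ _
  obtain ⟨σ, hσ⟩ := exists_initRenaming hc.inj hfin
  have hk' : raw c.state β = c.key := hk
  constructor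
  · refine ⟨W, β, δ, σ, hb, hσ, ?_⟩
    rw [abstraction_eq_ofKey hc.inj hb.baseShape hσ, hk']
    rfl
  · rw [← hk']
    exact raw_ofKey_canon initState_injective (raw_valid hb.baseShape)

end UP

/-! ### The bisimulation between a program and its abstraction -/

namespace UP

variable {S : Sig}

/-! ### The abstract transition system -/

section

variable {P : Stmt S} {α : Config S → Config S}

theorem absTS_reachable_iff {a : Config S} :
    (absTS P α).Reachable a ↔ ∃ c, (progTS P).Reachable c ∧ a = α c := by
  constructor
  · intro h
    induction h with
    | refl => exact ⟨_, .refl, rfl⟩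
    | tail _ h _ =>
      obtain ⟨c, c', hc, hs, -, rfl⟩ := h
      exact ⟨c', hc.tail hs, rfl⟩
  · rintro ⟨c, hc, rfl⟩
    induction hc with
    | refl => exact .refl
    | tail hc h ih => exact ih.tail ⟨_, _, hc, h, rfl, rfl⟩

/-- The abstract configuration determines the statement and the key. -/
theorem IsAbstraction.key_eq (hα : IsAbstraction P α) {c d : Config S}
    (hc : (progTS P).Reachable c) (hd : (progTS P).Reachable d) (h : α c = α d) :
    c.stmt = d.stmt ∧ c.key = d.key := by
  obtain ⟨κ, h₁, h₂⟩ := (hα c hc).exists_key (reachable_regular hc)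
  obtain ⟨κ', h₃, h₄⟩ := (hα d hd).exists_key (reachable_regular hd)
  refine ⟨?_, ?_⟩
  · have := congrArg Config.stmt h
    rwa [h₁, h₃] at this
  · rw [h₂, h₄, h]

theorem IsAbstraction.stmt_eq (hα : IsAbstraction P α) {c : Config S}
    (hc : (progTS P).Reachable c) : (α c).stmt = c.stmt := by
  obtain ⟨κ, h, -⟩ := (hα c hc).exists_key (reachable_regular hc)
  rw [h]
  rfl

/-- Every abstract state comes from one of finitely many statements and one of finitely many raw
keys. -/
theorem IsAbstraction.finite (hα : IsAbstraction P α) :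
    {a | (absTS P α).Reachable a}.Finite := by
  refine (((reachable_stmt_finite P).prod (Set.finite_univ (α := Key S (Fin S.vars)))).image
    fun x => absConfig x.1 x.2).subset ?_
  intro a ha
  obtain ⟨c, hc, rfl⟩ := absTS_reachable_iff.1 ha
  obtain ⟨κ, h, -⟩ := (hα c hc).exists_key (reachable_regular hc)
  exact ⟨(c.stmt, κ), ⟨⟨c, hc, rfl⟩, trivial⟩, h.symm⟩

/-- A configuration is related to the abstractions of the configurations with the same key. -/
def SameKey (P : Stmt S) (α : Config S → Config S) (c a : Config S) : Prop :=
  (progTS P).Reachable c ∧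
    ∃ d, (progTS P).Reachable d ∧ d.stmt = c.stmt ∧ d.key = c.key ∧ a = α d

/-- Steps are transferred between configurations with equal statements and keys. The representative
`d` changes along the run, since the successor found from `d` need not have the same abstraction as
the successor of `c`. -/
theorem IsAbstraction.isBisimulation (hα : IsAbstraction P α) (hP : Coherent P) :
    IsBisimulation (progTS P) (absTS P α) (SameKey P α) where
  init := ⟨.refl, _, .refl, rfl, rfl, rfl⟩
  label := by
    rintro c _ ⟨-, d, hd, hs, -, rfl⟩
    show c.stmt.code = (α d).stmt.code
    rw [hα.stmt_eq hd, hs]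
  forth := by
    rintro c _ ⟨hc, d, hd, hs, hk, rfl⟩ c' h
    have h' := keyStep_of_step hP hc h
    rw [← hs, ← hk] at h'
    obtain ⟨d', hd', he⟩ := step_of_keyStep hP hd h'
    obtain ⟨h₁, h₂⟩ := Prod.mk.inj he
    exact ⟨α d', ⟨d, d', hd, hd', rfl, rfl⟩, hc.tail h, d', hd.tail hd', h₁, h₂, rfl⟩
  back := by
    rintro c _ ⟨hc, d, hd, hs, hk, rfl⟩ _ ⟨e, e', he, hee', h, rfl⟩
    -- The abstract transition may stem from a configuration `e` other than `d`; equality of the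
    -- abstract states still gives equal statements and keys.
    obtain ⟨h₁, h₂⟩ := hα.key_eq hd he h
    have h' := keyStep_of_step hP he hee'
    rw [← h₁, ← h₂, hs, hk] at h'
    obtain ⟨c', hc', hce⟩ := step_of_keyStep hP hc h'
    obtain ⟨h₃, h₄⟩ := Prod.mk.inj hce
    exact ⟨c', hc', hc.tail hc', e', he.tail hee', h₃.symm, h₄.symm, rfl⟩

theorem sameKey_self {c : Config S} (hc : (progTS P).Reachable c) : SameKey P α c (α c) :=
  ⟨hc, c, hc, rfl, rfl, rfl⟩

end

/-! ### The abstraction by keys -/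

/-- The abstraction that describes the key of a configuration. -/
noncomputable def keyAbs (c : Config S) : Config S := absConfig c.stmt c.key

theorem keyAbs_isAbstraction (P : Stmt S) : IsAbstraction P keyAbs :=
  fun _ hc => (abstractsTo_absConfig (reachable_regular hc)).1

/-- The key of the initial configurations. -/
def initKey (S : Sig) : Key S (Fin S.vars) := keyOf ∅ fun v => .const (initState S v)

section

variable {P : Stmt S}

theorem keyReachable_iff (hP : Coherent P) {y : Stmt S × Key S (Fin S.vars)} :
    Relation.ReflTransGen KeyStep (P, initKey S) y ↔
      ∃ c, (progTS P).Reachable c ∧ (c.stmt, c.key) = y := by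
  constructor
  · intro h
    induction h with
    | refl => exact ⟨_, .refl, rfl⟩
    | tail _ h ih =>
      obtain ⟨c, hc, rfl⟩ := ih
      obtain ⟨c', hs, he⟩ := step_of_keyStep hP hc h
      exact ⟨c', hc.tail hs, he⟩
  · rintro ⟨c, hc, rfl⟩
    induction hc with
    | refl => exact .refl
    | tail hc h ih => exact ih.tail (keyStep_of_step hP hc h)

theorem keyReachable_finite (hP : Coherent P) :
    {y | Relation.ReflTransGen KeyStep (P, initKey S) y}.Finite := by
  refine ((reachable_stmt_finite P).prod (Set.finite_univ (α := Key S (Fin S.vars)))).subset ?_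
  intro y hy
  obtain ⟨c, hc, rfl⟩ := (keyReachable_iff hP).1 hy
  exact ⟨⟨c, hc, rfl⟩, trivial⟩

theorem keyAbs_reachable_iff (hP : Coherent P) {a : Config S} :
    (absTS P keyAbs).Reachable a ↔
      ∃ y, Relation.ReflTransGen KeyStep (P, initKey S) y ∧ a = absConfig y.1 y.2 := by
  rw [absTS_reachable_iff]
  constructor
  · rintro ⟨c, hc, rfl⟩
    exact ⟨_, (keyReachable_iff hP).2 ⟨c, hc, rfl⟩, rfl⟩
  · rintro ⟨y, hy, rfl⟩
    obtain ⟨c, hc, rfl⟩ := (keyReachable_iff hP).1 hy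
    exact ⟨c, hc, rfl⟩

theorem absConfig_injOn (hP : Coherent P) {x y : Stmt S × Key S (Fin S.vars)}
    (hx : Relation.ReflTransGen KeyStep (P, initKey S) x)
    (hy : Relation.ReflTransGen KeyStep (P, initKey S) y)
    (h : absConfig x.1 x.2 = absConfig y.1 y.2) : x = y := by
  obtain ⟨c, hc, rfl⟩ := (keyReachable_iff hP).1 hx
  obtain ⟨d, hd, rfl⟩ := (keyReachable_iff hP).1 hy
  obtain ⟨h₁, h₂⟩ := (keyAbs_isAbstraction P).key_eq hc hd h
  exact Prod.ext h₁ h₂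

theorem keyAbs_step_iff (hP : Coherent P) {x y : Stmt S × Key S (Fin S.vars)}
    (hx : Relation.ReflTransGen KeyStep (P, initKey S) x)
    (hy : Relation.ReflTransGen KeyStep (P, initKey S) y) :
    (absTS P keyAbs).step (absConfig x.1 x.2) (absConfig y.1 y.2) ↔ KeyStep x y := by
  constructor
  · rintro ⟨c, c', hc, h, h₁, h₂⟩
    rw [absConfig_injOn hP hx ((keyReachable_iff hP).2 ⟨c, hc, rfl⟩) h₁,
      absConfig_injOn hP hy ((keyReachable_iff hP).2 ⟨c', hc.tail h, rfl⟩) h₂]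
    exact keyStep_of_step hP hc h
  · intro h
    obtain ⟨c, hc, rfl⟩ := (keyReachable_iff hP).1 hx
    obtain ⟨c', h', rfl⟩ := step_of_keyStep hP hc h
    exact ⟨c, c', hc, h', rfl, rfl⟩

end

end UP

/-! ### Computable search and recursion on numbers -/

namespace UP

/-! ### Exploration of a finite part of a computable graph -/

section

variable {α : Type} [DecidableEq α] {succs : α → List α}

/-- A successor of the list that is not in the list. -/
def frontier (succs : α → List α) (L : List α) : Option α :=
  ((L.flatMap succs).filter fun a => a ∉ L).head?

theorem frontier_eq_none {L : List α} :
    frontier succs L = none ↔ ∀ a ∈ L, ∀ b ∈ succs a, b ∈ L := by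
  simp only [frontier, List.head?_eq_none_iff, List.filter_eq_nil_iff, List.mem_flatMap,
    decide_eq_true_eq, not_not, forall_exists_index, and_imp]
  exact ⟨fun h a ha b hb => h b a ha hb, fun h b a ha hb => h a ha b hb⟩

theorem frontier_eq_some {L : List α} {b : α} (h : frontier succs L = some b) :
    b ∉ L ∧ ∃ a ∈ L, b ∈ succs a := by
  have := List.mem_of_mem_head? (Option.mem_def.2 h)
  simpa [and_comm] using this

/-- The list of the first elements found from `a`. -/
def explored (succs : α → List α) (a : α) (n : ℕ) : List α :=
  n.rec [a] fun _ L => L ++ (frontier succs L).toList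

theorem explored_succ (a : α) (n : ℕ) : explored succs a (n + 1) =
    explored succs a n ++ (frontier succs (explored succs a n)).toList := rfl

/-- As long as the frontier is not empty, each round adds exactly one new vertex. The length clause
therefore bounds the number of rounds when only finitely many vertices are reachable. -/
theorem explored_spec (a : α) (n : ℕ) :
    (explored succs a n).Nodup ∧ (explored succs a n)[0]? = some a ∧
    (∀ b ∈ explored succs a n, Relation.ReflTransGen (fun x y => y ∈ succs x) a b) ∧
    ((∀ m < n, frontier succs (explored succs a m) ≠ none) →
      (explored succs a n).length = n + 1) := by
  induction n with
  | zero => simp [explored]; exact .refl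
  | succ n ih =>
    obtain ⟨h₁, h₂, h₃, h₄⟩ := ih
    rw [explored_succ]
    cases hf : frontier succs (explored succs a n) with
    | none =>
      refine ⟨by simpa using h₁, by simpa using h₂, by simpa using h₃, fun h => ?_⟩
      exact absurd hf (h n (Nat.lt_succ_self n))
    | some b =>
      obtain ⟨hb, c, hc, hcb⟩ := frontier_eq_some hf
      refine ⟨?_, ?_, ?_, fun h => ?_⟩
      · simp only [Option.toList_some]
        rw [List.nodup_append]
        refine ⟨h₁, List.nodup_singleton b, ?_⟩
        simp only [List.mem_singleton]
        rintro x hx _ rfl rfl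
        exact hb hx
      · rw [List.getElem?_append_left, h₂]
        exact (List.getElem?_eq_some_iff.1 h₂).1
      · simp only [Option.toList_some, List.mem_append, List.mem_singleton]
        rintro x (hx | rfl)
        · exact h₃ x hx
        · exact (h₃ c hc).tail hcb
      · simp [h₄ fun m hm => h m (Nat.lt_succ_of_lt hm)]

/-- The transitions between the positions of a list. -/
def edges (succs : α → List α) (L : List α) : List (ℕ × ℕ) :=
  L.flatMap fun x => (succs x).map fun y => (L.idxOf x, L.idxOf y)

theorem mem_edges {L : List α} {i j : ℕ} : (i, j) ∈ edges succs L ↔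
    ∃ x ∈ L, ∃ y ∈ succs x, L.idxOf x = i ∧ L.idxOf y = j := by
  simp [edges]

theorem getElem?_idxOf_of_mem {L : List α} {x : α} (h : x ∈ L) : L[L.idxOf x]? = some x :=
  List.getElem?_idxOf h

theorem idxOf_of_getElem? {L : List α} (hL : L.Nodup) {i : ℕ} {x : α} (h : L[i]? = some x) :
    L.idxOf x = i := by
  obtain ⟨hi, rfl⟩ := List.getElem?_eq_some_iff.1 h
  exact hL.idxOf_getElem i hi

end

section

variable {α β σ : Type} [Primcodable α] [Primcodable β] [Primcodable σ]

/-- Strong recursion on the natural numbers, where the list of the earlier values is given. -/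
theorem exists_strongRec {g : α → List σ → σ} (hg : Primrec₂ g) :
    ∃ f : α → ℕ → σ, Primrec₂ f ∧ ∀ a n, f a n = g a ((List.range n).map (f a)) := by
  -- The list of the first `n` values is what plain primitive recursion can build; the value at `n`
  -- is computed from it.
  let L : α → ℕ → List σ := fun a n => n.rec [] fun _ l => l ++ [g a l]
  have hL : Primrec₂ L := by
    refine (Primrec.nat_rec (Primrec.const [])
      (g := fun a (p : ℕ × List σ) => p.2 ++ [g a p.2]) ?_)
    refine Primrec.list_append.comp (Primrec.snd.comp Primrec.snd) ?_
    exact Primrec.list_cons.comp (hg.comp Primrec.fst (Primrec.snd.comp Primrec.snd))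
      (Primrec.const [])
  refine ⟨fun a n => g a (L a n), hg.comp Primrec.fst hL, fun a n => ?_⟩
  suffices h : L a n = (List.range n).map fun n => g a (L a n) by rw [← h]
  induction n with
  | zero => rfl
  | succ n ih =>
    show L a n ++ [g a (L a n)] = _
    rw [List.range_succ, List.map_append, ← ih]
    rfl

theorem primrecPred_mem_list {f : β → α} {l : β → List α} (hf : Primrec f) (hl : Primrec l) :
    PrimrecPred fun b => f b ∈ l b := by
  have h : PrimrecRel fun (l : List α) (a : α) => ∃ b ∈ l, b = a :=
    PrimrecRel.exists_mem_list Primrec.eq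
  refine (PrimrecRel.comp h hl hf).of_eq fun b => ?_
  simp

theorem primrec_filter {p : β → α → Prop} [∀ b, DecidablePred (p b)] {l : β → List α}
    (hp : PrimrecRel p) (hl : Primrec l) : Primrec fun b => (l b).filter fun a => p b a := by
  have h : Primrec fun b => (l b).filterMap fun a => if p b a then some a else none :=
    Primrec.listFilterMap hl (Primrec.ite hp (Primrec.option_some.comp Primrec.snd)
      (Primrec.const none))
  refine h.of_eq fun b => ?_
  induction l b with
  | nil => rfl
  | cons a l ih =>
    by_cases ha : p b a <;> simp [ha, ih]

variable [DecidableEq α] {succs : α → List α}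

theorem primrec_frontier (hs : Primrec succs) : Primrec (frontier succs) := by
  refine Primrec.list_head?.comp (primrec_filter (p := fun L a => a ∉ L) ?_ ?_)
  · exact (primrecPred_mem_list Primrec.snd Primrec.fst).not
  · exact Primrec.list_flatMap Primrec.id (hs.comp₂ Primrec₂.right)

theorem primrec_explored (hs : Primrec succs) : Primrec₂ (explored succs) := by
  refine Primrec.nat_rec (Primrec.list_cons.comp Primrec.id (Primrec.const []))
    (g := fun _ (p : ℕ × List α) => p.2 ++ (frontier succs p.2).toList) ?_
  have h : Primrec fun p : α × ℕ × List α => p.2.2 := Primrec.snd.comp Primrec.snd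
  exact Primrec.list_append.comp h (Primrec.optionToList.comp ((primrec_frontier hs).comp h))

/-- The exploration of a finite part of the graph halts with the list of all its vertices. -/
theorem exists_explore (hs : Primrec succs) : ∃ F : α →. List α, Partrec F ∧
    ∀ a, {b | Relation.ReflTransGen (fun x y => y ∈ succs x) a b}.Finite → ∃ L ∈ F a,
      L.Nodup ∧ L[0]? = some a ∧
        ∀ b, b ∈ L ↔ Relation.ReflTransGen (fun x y => y ∈ succs x) a b := by
  have hp : PrimrecRel fun (a : α) n => frontier succs (explored succs a n) = none :=
    Primrec.eq.comp₂ ((primrec_frontier hs).comp (primrec_explored hs)) (Primrec₂.const none)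
  refine ⟨fun a => (Nat.rfind fun n => Part.some
    (decide (frontier succs (explored succs a n) = none))).map (explored succs a), ?_, ?_⟩
  · exact Partrec.map (Partrec.rfind hp.decide.to_comp.partrec₂) (primrec_explored hs).to_comp
  · intro a hfin
    -- Otherwise, after as many rounds as there are reachable vertices, the list would hold one
    -- vertex too many.
    have hex : ∃ n, frontier succs (explored succs a n) = none := by
      by_contra h
      push Not at h
      have hs := explored_spec (succs := succs) a hfin.toFinset.card
      have hlen := hs.2.2.2 fun m _ => h m
      have : (explored succs a hfin.toFinset.card).toFinset ⊆ hfin.toFinset := by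
        intro b hb
        exact hfin.mem_toFinset.2 (hs.2.2.1 b (List.mem_toFinset.1 hb))
      have := Finset.card_le_card this
      rw [List.toFinset_card_of_nodup hs.1, hlen] at this
      omega
    obtain ⟨n, hn⟩ := hex
    have hd : (Nat.rfind fun n => Part.some
        (decide (frontier succs (explored succs a n) = none))).Dom :=
      Nat.rfind_dom.2 ⟨n, by simp [hn], fun _ => trivial⟩
    obtain ⟨m, hm⟩ := Part.dom_iff_mem.1 hd
    have hm' : frontier succs (explored succs a m) = none := by
      simpa using Nat.rfind_spec hm
    obtain ⟨h₁, h₂, h₃, -⟩ := explored_spec (succs := succs) a m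
    refine ⟨_, Part.mem_map _ hm, h₁, h₂, fun b => ⟨h₃ b, fun h => ?_⟩⟩
    induction h with
    | refl => exact List.mem_of_getElem? h₂
    | tail _ h ih => exact frontier_eq_none.1 hm' _ ih _ h

theorem primrec_edges (hs : Primrec succs) : Primrec (edges succs) := by
  refine Primrec.list_flatMap Primrec.id (Primrec.list_map (hs.comp Primrec.snd) ?_)
  have hL : Primrec fun p : (List α × α) × α => p.1.1 := Primrec.fst.comp Primrec.fst
  exact Primrec.pair (Primrec.list_idxOf.comp (Primrec.snd.comp Primrec.fst) hL)
    (Primrec.list_idxOf.comp Primrec.snd hL)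

end

end UP

/-! ### Computing the abstract system -/

namespace UP

variable {S : Sig}

/-! ### Steps on Goedel numbers -/

theorem Cond.code_injective : Function.Injective (Cond.code (S := S)) := by
  rintro ⟨p, x, y⟩ ⟨p', x', y'⟩ h
  have h' := Encodable.encode_injective h
  simp only [Prod.mk.injEq] at h'
  obtain ⟨rfl, h₁, h₂⟩ := h'
  rw [Fin.ext h₁, Fin.ext h₂]

theorem Stmt.code_injective : Function.Injective (Stmt.code (S := S)) := by
  intro s
  induction s with
  | skip => intro t h; cases t <;> simp_all [code]
  | copy x y =>
    intro t h
    cases t <;> simp only [code, Nat.pair_eq_pair, false_and, OfNat.one_ne_ofNat,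
      one_ne_zero, true_and] at h
    rw [Fin.ext h.1, Fin.ext h.2]
  | assign x f ys =>
    intro t h
    cases t <;> simp only [code, Nat.pair_eq_pair, false_and, OfNat.ofNat_ne_one,
      OfNat.ofNat_ne_zero, true_and, Nat.reduceEqDiff] at h
    have h' := Encodable.encode_injective h
    simp only [Prod.mk.injEq] at h'
    obtain ⟨h₁, h₂, h₃⟩ := h'
    obtain rfl := Fin.ext h₁
    obtain rfl := Fin.ext h₂
    have h₄ := List.ofFn_injective h₃
    congr
    funext i
    exact Fin.ext (congrFun h₄ i)
  | assume b =>
    intro t h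
    cases t <;> simp only [code, Nat.pair_eq_pair, false_and, OfNat.ofNat_ne_one,
      OfNat.ofNat_ne_zero, true_and, Nat.reduceEqDiff] at h
    rw [Cond.code_injective h]
  | seq s₁ s₂ ih₁ ih₂ =>
    intro t h
    cases t <;> simp only [code, Nat.pair_eq_pair, false_and, OfNat.ofNat_ne_one,
      OfNat.ofNat_ne_zero, true_and, Nat.reduceEqDiff] at h
    rw [ih₁ h.1, ih₂ h.2]
  | ite b s₁ s₂ ih₁ ih₂ =>
    intro t h
    cases t <;> simp only [code, Nat.pair_eq_pair, false_and, OfNat.ofNat_ne_one,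
      OfNat.ofNat_ne_zero, true_and, Nat.reduceEqDiff] at h
    rw [Cond.code_injective h.1, ih₁ h.2.1, ih₂ h.2.2]
  | loop b s ih =>
    intro t h
    cases t <;> simp only [code, Nat.pair_eq_pair, false_and, OfNat.ofNat_ne_one,
      OfNat.ofNat_ne_zero, true_and, Nat.reduceEqDiff] at h
    rw [Cond.code_injective h.1, ih h.2]

/-- The number of the negation of a condition. -/
def negCode (b : ℕ) : ℕ := Nat.pair (1 - b.unpair.1) b.unpair.2

theorem negCode_code (b : Cond S) : negCode b.code = b.neg.code := by
  obtain ⟨p, x, y⟩ := b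
  cases p <;> simp [negCode, Cond.neg, Cond.code]

/-- One level of the recursion that computes the possible actions; `L` lists the values for the
smaller numbers. -/
def nextCodeAux (L : List (List (ℕ × ℕ))) : List (ℕ × ℕ) :=
  let n := L.length
  let k := n.unpair.1
  let m := n.unpair.2
  if k = 0 then []
  else if k = 4 then
    (if m.unpair.1 = 0 then [(0, m.unpair.2)] else []) ++
      (L.getD m.unpair.1 []).map fun p => (p.1, Nat.pair 4 (Nat.pair p.2 m.unpair.2))
  else if k = 5 then
    [(0, Nat.pair 4 (Nat.pair (Nat.pair 3 m.unpair.1) m.unpair.2.unpair.1)),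
      (0, Nat.pair 4 (Nat.pair (Nat.pair 3 (negCode m.unpair.1)) m.unpair.2.unpair.2))]
  else if k = 6 then
    [(0, Nat.pair 5 (Nat.pair m.unpair.1 (Nat.pair (Nat.pair 4 (Nat.pair m.unpair.2 n)) 0)))]
  else [(n, 0)]

theorem primrec_unpair_fst : Primrec fun n : ℕ => n.unpair.1 := Primrec.fst.comp Primrec.unpair

theorem primrec_unpair_snd : Primrec fun n : ℕ => n.unpair.2 := Primrec.snd.comp Primrec.unpair

theorem primrec_natPair {α : Type} [Primcodable α] {f g : α → ℕ} (hf : Primrec f)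
    (hg : Primrec g) : Primrec fun a => Nat.pair (f a) (g a) := Primrec₂.natPair.comp hf hg

theorem primrec_singleton {α β : Type} [Primcodable α] [Primcodable β] {f : α → β}
    (hf : Primrec f) : Primrec fun a => [f a] := Primrec.list_cons.comp hf (Primrec.const [])

theorem primrec_negCode : Primrec negCode :=
  primrec_natPair (Primrec.nat_sub.comp (Primrec.const 1) primrec_unpair_fst) primrec_unpair_snd

theorem primrec_nextCodeAux : Primrec nextCodeAux := by
  have hn : Primrec fun L : List (List (ℕ × ℕ)) => L.length := Primrec.list_length
  have hk : Primrec fun L : List (List (ℕ × ℕ)) => L.length.unpair.1 := primrec_unpair_fst.comp hn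
  have hm : Primrec fun L : List (List (ℕ × ℕ)) => L.length.unpair.2 := primrec_unpair_snd.comp hn
  have h₁ := primrec_unpair_fst.comp hm
  have h₂ := primrec_unpair_snd.comp hm
  have hc : ∀ j : ℕ, PrimrecPred fun L : List (List (ℕ × ℕ)) => L.length.unpair.1 = j :=
    fun j => PrimrecRel.comp Primrec.eq hk (Primrec.const j)
  refine Primrec.ite (hc 0) (Primrec.const []) (Primrec.ite (hc 4) ?_ (Primrec.ite (hc 5) ?_
    (Primrec.ite (hc 6) ?_ (primrec_singleton (Primrec.pair hn (Primrec.const 0))))))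
  · refine Primrec.list_append.comp (Primrec.ite (PrimrecRel.comp Primrec.eq h₁ (Primrec.const 0))
      (primrec_singleton (Primrec.pair (Primrec.const 0) h₂)) (Primrec.const [])) ?_
    refine Primrec.list_map ((Primrec.list_getD []).comp Primrec.id h₁) ?_
    exact Primrec.pair (Primrec.fst.comp Primrec.snd) (primrec_natPair (Primrec.const 4)
      (primrec_natPair (Primrec.snd.comp Primrec.snd) (h₂.comp Primrec.fst)))
  · exact Primrec.list_cons.comp (Primrec.pair (Primrec.const 0)
        (primrec_natPair (Primrec.const 4) (primrec_natPair (primrec_natPair (Primrec.const 3) h₁)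
          (primrec_unpair_fst.comp h₂))))
      (primrec_singleton (Primrec.pair (Primrec.const 0)
        (primrec_natPair (Primrec.const 4) (primrec_natPair (primrec_natPair (Primrec.const 3)
          (primrec_negCode.comp h₁)) (primrec_unpair_snd.comp h₂)))))
  · exact primrec_singleton (Primrec.pair (Primrec.const 0) (primrec_natPair (Primrec.const 5)
      (primrec_natPair h₁ (primrec_natPair (primrec_natPair (Primrec.const 4)
        (primrec_natPair h₂ hn)) (Primrec.const 0)))))

theorem snd_lt_pair {a b : ℕ} (ha : 0 < a) : b < Nat.pair a b := by
  have := Nat.add_le_pair a b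
  omega

theorem getD_map_range {σ : Type} {f : ℕ → σ} {d : σ} {i n : ℕ} (h : i < n) :
    ((List.range n).map f).getD i d = f i := by
  simp [List.getD_eq_getElem?_getD, h]

/-- Course-of-values recursion on the number of the statement: only the first part of a sequence is
inspected recursively, and its number is smaller. For atomic statements the action is the statement
itself, and `0`, the number of `skip`, remains. -/
theorem exists_nextCode : ∃ f : ℕ → List (ℕ × ℕ), Primrec f ∧
    ∀ {S : Sig} (s : Stmt S), f s.code = s.next.map fun p => (p.1.code, p.2.code) := by
  obtain ⟨f, hf, h⟩ := exists_strongRec (α := Unit) (g := fun _ L => nextCodeAux L)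
    (primrec_nextCodeAux.comp₂ Primrec₂.right)
  refine ⟨f (), hf.comp (Primrec.const ()) Primrec.id, fun s => ?_⟩
  have h0 : Nat.pair 0 0 = 0 := rfl
  induction s with
  | skip => rw [h]; simp [nextCodeAux, Stmt.code, h0, Stmt.next]
  | copy x y => rw [h]; simp [nextCodeAux, Stmt.code, h0, Stmt.next]
  | assign x f ys => rw [h]; simp [nextCodeAux, Stmt.code, h0, Stmt.next]
  | assume b => rw [h]; simp [nextCodeAux, Stmt.code, h0, Stmt.next]
  | seq s₁ s₂ ih₁ _ =>
    have hlt : s₁.code < (Stmt.seq s₁ s₂).code :=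
      (Nat.left_le_pair _ _).trans_lt (snd_lt_pair (by omega))
    -- Testing for `skip` by its number is correct because numbers determine statements.
    have hskip : s₁.code = 0 ↔ s₁.isSkip = true := by
      rw [Stmt.isSkip_iff]
      exact ⟨fun h => Stmt.code_injective h, fun h => by rw [h]; rfl⟩
    have hg := getD_map_range (f := f ()) (d := []) hlt
    rw [ih₁] at hg
    rw [h]
    simp only [Stmt.code, nextCodeAux, List.length_map, List.length_range, Nat.unpair_pair,
      Stmt.next, hskip] at hg ⊢
    rw [hg]
    by_cases hs : s₁.isSkip = true <;> simp [hs, h0, Stmt.code]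
  | ite b s₁ s₂ => rw [h]; simp [nextCodeAux, Stmt.code, h0, Stmt.next, negCode_code]
  | loop b s => rw [h]; simp [nextCodeAux, Stmt.code, h0, Stmt.next]

/-- The actions of programs. -/
def actions (S : Sig) : Set (Stmt S) := {a | ∃ (s s' : Stmt S), (a, s') ∈ s.next}

theorem actions_finite : (actions S).Finite := by
  refine (((Set.finite_singleton (Stmt.skip : Stmt S)).union
    (Set.finite_range fun p : Fin S.vars × Fin S.vars => Stmt.copy p.1 p.2)).union
    ((Set.finite_range fun p : Σ f : Fin S.funs, Fin S.vars × (Fin (S.arity f) → Fin S.vars) =>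
      Stmt.assign p.2.1 p.1 p.2.2).union
    (Set.finite_range fun p : Bool × Fin S.vars × Fin S.vars =>
      Stmt.assume ⟨p.1, p.2.1, p.2.2⟩))).subset ?_
  rintro a ⟨s, s', h⟩
  induction s generalizing s' with
  | skip => simp [Stmt.next] at h
  | copy x y =>
    simp only [Stmt.next, List.mem_singleton, Prod.mk.injEq] at h
    exact Or.inl (Or.inr ⟨(x, y), h.1.symm⟩)
  | assign x f ys =>
    simp only [Stmt.next, List.mem_singleton, Prod.mk.injEq] at h
    exact Or.inr (Or.inl ⟨⟨f, x, ys⟩, h.1.symm⟩)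
  | assume b =>
    simp only [Stmt.next, List.mem_singleton, Prod.mk.injEq] at h
    exact Or.inr (Or.inr ⟨(b.pos, b.lhs, b.rhs), h.1.symm⟩)
  | seq s₁ s₂ ih₁ _ =>
    simp only [Stmt.next, List.mem_append, List.mem_map, Prod.mk.injEq] at h
    obtain h | ⟨p, hp, rfl, -⟩ := h
    · split_ifs at h
      · simp only [List.mem_singleton, Prod.mk.injEq] at h
        exact Or.inl (Or.inl h.1)
      · simp at h
    · exact ih₁ p.2 hp
  | ite b s₁ s₂ =>
    simp only [Stmt.next, List.mem_cons, Prod.mk.injEq, List.not_mem_nil, or_false] at h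
    exact Or.inl (Or.inl (h.elim And.left And.left))
  | loop b s =>
    simp only [Stmt.next, List.mem_singleton, Prod.mk.injEq] at h
    exact Or.inl (Or.inl h.1)

/-- A numbering of the keys. -/
noncomputable def keyNum : Key S (Fin S.vars) ≃ Fin (Nat.card (Key S (Fin S.vars))) :=
  Finite.equivFin _

/-- The pair of numbers for a statement and a key. -/
noncomputable def pairCode (x : Stmt S × Key S (Fin S.vars)) : ℕ × ℕ :=
  (x.1.code, (keyNum x.2).val)

theorem pairCode_injective : Function.Injective (pairCode (S := S)) := by
  intro x y h
  obtain ⟨h₁, h₂⟩ := Prod.mk.inj h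
  exact Prod.ext (Stmt.code_injective h₁) (keyNum.injective (Fin.ext h₂))

/-- `post` is defined by classical choice, but for a fixed signature it concerns finitely many
actions and keys, so its graph can be built into the algorithm as a list. -/
theorem exists_table (S : Sig) : ∃ T : List ((ℕ × ℕ) × ℕ), ∀ t, t ∈ T ↔
    ∃ a ∈ actions S, ∃ κ κ', post a κ = some κ' ∧
      t = ((a.code, (keyNum κ).val), (keyNum κ').val) := by
  have hfin : {t : (ℕ × ℕ) × ℕ | ∃ a ∈ actions S, ∃ κ κ', post a κ = some κ' ∧
      t = ((a.code, (keyNum κ).val), (keyNum κ').val)}.Finite := by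
    refine (((actions_finite (S := S)).prod (Set.finite_univ (α := Key S (Fin S.vars) ×
      Key S (Fin S.vars)))).image fun x =>
        ((x.1.code, (keyNum x.2.1).val), (keyNum x.2.2).val)).subset ?_
    rintro _ ⟨a, ha, κ, κ', -, rfl⟩
    exact ⟨(a, κ, κ'), ⟨ha, trivial⟩, rfl⟩
  exact ⟨hfin.toFinset.toList, fun t => by simp⟩

/-- The step relation of statements and keys is computable. -/
theorem exists_succs (S : Sig) : ∃ succs : ℕ × ℕ → List (ℕ × ℕ), Primrec succs ∧
    ∀ (x : Stmt S × Key S (Fin S.vars)) (k : ℕ × ℕ),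
      k ∈ succs (pairCode x) ↔ ∃ y, KeyStep x y ∧ k = pairCode y := by
  obtain ⟨f, hf, hfs⟩ := exists_nextCode
  obtain ⟨T, hT⟩ := exists_table S
  refine ⟨fun x => (f x.1).flatMap fun p =>
    (T.filter fun t => t.1 = (p.1, x.2)).map fun t => (p.2, t.2), ?_, ?_⟩
  · refine Primrec.list_flatMap (hf.comp Primrec.fst) (Primrec.list_map
      (primrec_filter (p := fun (y : (ℕ × ℕ) × ℕ × ℕ) (t : (ℕ × ℕ) × ℕ) => t.1 = (y.2.1, y.1.2))
        ?_ (Primrec.const T)) ?_)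
    · exact PrimrecRel.comp Primrec.eq (Primrec.fst.comp Primrec.snd)
        (Primrec.pair (Primrec.fst.comp (Primrec.snd.comp Primrec.fst))
          (Primrec.snd.comp (Primrec.fst.comp Primrec.fst)))
    · exact Primrec.pair (Primrec.snd.comp (Primrec.snd.comp Primrec.fst))
        (Primrec.snd.comp Primrec.snd)
  · intro x k
    simp only [pairCode, hfs, List.mem_flatMap, List.mem_map, List.mem_filter]
    constructor
    · rintro ⟨_, ⟨⟨a, s'⟩, hn, rfl⟩, t, ⟨ht, he⟩, rfl⟩
      obtain ⟨a', -, κ, κ', hp, rfl⟩ := (hT t).1 ht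
      have he := Prod.mk.inj (of_decide_eq_true he)
      obtain rfl := Stmt.code_injective he.1
      obtain rfl := keyNum.injective (Fin.ext he.2)
      exact ⟨(s', κ'), ⟨a', hn, hp⟩, rfl⟩
    · rintro ⟨⟨s', κ'⟩, ⟨a, hn, hp⟩, rfl⟩
      exact ⟨_, ⟨(a, s'), hn, rfl⟩, _, ⟨(hT _).2 ⟨a, ⟨_, _, hn⟩, x.2, κ', hp, rfl⟩, decide_eq_true rfl⟩, rfl⟩

theorem reflTransGen_pairCode {succs : ℕ × ℕ → List (ℕ × ℕ)}
    (hs : ∀ (x : Stmt S × Key S (Fin S.vars)) (k : ℕ × ℕ),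
      k ∈ succs (pairCode x) ↔ ∃ y, KeyStep x y ∧ k = pairCode y)
    {x : Stmt S × Key S (Fin S.vars)} {k : ℕ × ℕ} :
    Relation.ReflTransGen (fun i j => j ∈ succs i) (pairCode x) k ↔
      ∃ y, Relation.ReflTransGen KeyStep x y ∧ k = pairCode y := by
  constructor
  · intro h
    induction h with
    | refl => exact ⟨x, .refl, rfl⟩
    | tail _ h ih =>
      obtain ⟨y, hy, rfl⟩ := ih
      obtain ⟨z, hz, rfl⟩ := (hs _ _).1 h
      exact ⟨z, hy.tail hz, rfl⟩
  · rintro ⟨y, hy, rfl⟩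
    induction hy with
    | refl => exact .refl
    | tail _ h ih => exact ih.tail ((hs _ _).2 ⟨_, h, rfl⟩)

/-- The list of the reachable pairs of statements and keys is computable for coherent programs. -/
theorem exists_reachable_list (S : Sig) : ∃ (succs : ℕ × ℕ → List (ℕ × ℕ)) (F : ℕ →. List (ℕ × ℕ)),
    Primrec succs ∧ Partrec F ∧
    (∀ (x : Stmt S × Key S (Fin S.vars)) (k : ℕ × ℕ),
      k ∈ succs (pairCode x) ↔ ∃ y, KeyStep x y ∧ k = pairCode y) ∧
    ∀ P : Stmt S, Coherent P → ∃ L ∈ F P.code, L.Nodup ∧ L[0]? = some (pairCode (P, initKey S)) ∧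
      ∀ k, k ∈ L ↔ ∃ y, Relation.ReflTransGen KeyStep (P, initKey S) y ∧ k = pairCode y := by
  obtain ⟨succs, hp, hs⟩ := exists_succs S
  obtain ⟨F, hF, h⟩ := exists_explore hp
  refine ⟨succs, fun p => F (p, (keyNum (initKey S)).val), hp,
    hF.comp (Computable.pair Computable.id (Computable.const _)), hs, fun P hP => ?_⟩
  have hset : ∀ k, Relation.ReflTransGen (fun i j => j ∈ succs i) (pairCode (P, initKey S)) k ↔
      ∃ y, Relation.ReflTransGen KeyStep (P, initKey S) y ∧ k = pairCode y :=
    fun k => reflTransGen_pairCode hs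
  obtain ⟨L, hL, h₁, h₂, h₃⟩ := h (pairCode (P, initKey S)) (by
    refine ((keyReachable_finite hP).image pairCode).subset ?_
    intro k hk
    obtain ⟨y, hy, rfl⟩ := (hset k).1 hk
    exact ⟨y, hy, rfl⟩)
  exact ⟨L, hL, h₁, h₂, fun k => (h₃ k).trans (hset k)⟩

theorem mem_edges_pairCode {P : Stmt S} {succs : ℕ × ℕ → List (ℕ × ℕ)} {L : List (ℕ × ℕ)}
    (hs : ∀ (x : Stmt S × Key S (Fin S.vars)) (k : ℕ × ℕ),
      k ∈ succs (pairCode x) ↔ ∃ y, KeyStep x y ∧ k = pairCode y)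
    (hL : L.Nodup) (hmem : ∀ k, k ∈ L ↔
      ∃ y, Relation.ReflTransGen KeyStep (P, initKey S) y ∧ k = pairCode y) {i j : ℕ} :
    (i, j) ∈ edges succs L ↔
      ∃ x y : Stmt S × Key S (Fin S.vars), KeyStep x y ∧ L[i]? = some (pairCode x) ∧ L[j]? = some (pairCode y) := by
  rw [mem_edges]
  constructor
  · rintro ⟨k, hk, k', hk', rfl, rfl⟩
    obtain ⟨x, hx, rfl⟩ := (hmem _).1 hk
    obtain ⟨y, hy, rfl⟩ := (hs _ _).1 hk'
    exact ⟨x, y, hy, getElem?_idxOf_of_mem hk,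
      getElem?_idxOf_of_mem ((hmem _).2 ⟨y, hx.tail hy, rfl⟩)⟩
  · rintro ⟨x, y, h, hi, hj⟩
    exact ⟨_, List.mem_of_getElem? hi, _, (hs _ _).2 ⟨y, h, rfl⟩, idxOf_of_getElem? hL hi,
      idxOf_of_getElem? hL hj⟩

/-- Another lookup table: the abstract path condition depends on the key alone and is finite. -/
theorem exists_literal_codes (S : Sig) : ∃ lits : ℕ → List ℕ, Primrec lits ∧
    ∀ (κ : Key S (Fin S.vars)) (s : Stmt S) (r : ℕ),
      r ∈ lits (keyNum κ).val ↔ ∃ l ∈ (absConfig s κ).pc, l.code = r := by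
  have hfin : ∀ κ : Key S (Fin S.vars),
      {r | ∃ l ∈ (absConfig Stmt.skip κ).pc, l.code = r}.Finite := fun κ =>
    ((ofKey_finite (canon (initState S)) κ).image Lit.code).subset fun r hr => hr
  set tab : List (List ℕ) := List.ofFn fun i => (hfin (keyNum.symm i)).toFinset.toList
  refine ⟨fun k => tab.getD k [], (Primrec.list_getD []).comp (Primrec.const tab) Primrec.id,
    fun κ s r => ?_⟩
  have : tab.getD (keyNum κ).val [] = (hfin κ).toFinset.toList := by
    simp [tab, List.getD_eq_getElem?_getD]
  simp only [this, Finset.mem_toList, Set.Finite.mem_toFinset]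
  rfl

/-- The abstract transition system is computable. -/
theorem exists_lists (S : Sig) : ∃ F : ℕ →. FinTS (ℕ × List ℕ), Partrec F ∧
    ∀ P : Stmt S, Coherent P → ∃ D ∈ F P.code, Lists D P keyAbs := by
  obtain ⟨succs, F, hp, hF, hs, h⟩ := exists_reachable_list S
  obtain ⟨lits, hl, hlits⟩ := exists_literal_codes S
  refine ⟨fun p => (F p).map fun L => (L.map fun k => (k.1, lits k.2), 0, edges succs L), ?_, ?_⟩
  · refine Partrec.map hF (Primrec₂.to_comp ?_)
    refine Primrec.pair (Primrec.list_map Primrec.snd ?_)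
      (Primrec.pair (Primrec.const 0) ((primrec_edges hp).comp Primrec.snd))
    exact Primrec.pair (Primrec.fst.comp Primrec.snd) (hl.comp (Primrec.snd.comp Primrec.snd))
  · intro P hP
    obtain ⟨L, hLF, hL, h0, hmem⟩ := h P hP
    refine ⟨_, Part.mem_map _ hLF, ?_⟩
    have hex : ∀ i : Fin L.length, ∃ y, Relation.ReflTransGen KeyStep (P, initKey S) y ∧
        L.get i = pairCode y := fun i => (hmem _).1 (List.get_mem L i)
    choose y hy hye using hex
    have hy0 : ∀ i x, L[i.val]? = some (pairCode x) → y i = x := by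
      intro i x hx
      rw [List.getElem?_eq_getElem i.isLt, ← List.get_eq_getElem, hye] at hx
      exact pairCode_injective (Option.some.inj hx)
    have hyi : ∀ i, L[i.val]? = some (pairCode (y i)) := by
      intro i
      rw [List.getElem?_eq_getElem i.isLt, ← List.get_eq_getElem, hye]
    -- Positions in the list, reachable pairs and abstract states correspond: the list has no
    -- duplicates, and on reachable pairs the abstract state determines the statement and the key.
    have hbij : Function.Bijective fun i : Fin L.length =>
        (⟨absConfig (y i).1 (y i).2, (keyAbs_reachable_iff hP).2 ⟨_, hy i, rfl⟩⟩ :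
          {a : Config S // (absTS P keyAbs).Reachable a}) := by
      constructor
      · intro i j hij
        have h₁ := absConfig_injOn hP (hy i) (hy j) (congrArg Subtype.val hij)
        refine hL.injective_get ?_
        rw [hye, hye, h₁]
      · rintro ⟨a, ha⟩
        obtain ⟨x, hx, rfl⟩ := (keyAbs_reachable_iff hP).1 ha
        obtain ⟨i, hi⟩ := List.mem_iff_get.1 ((hmem _).2 ⟨x, hx, rfl⟩)
        refine ⟨i, Subtype.ext ?_⟩
        have : y i = x := pairCode_injective (by rw [← hye, hi])
        simp only [this]
    have hlen : (L.map fun k => (k.1, lits k.2)).length = L.length := List.length_map _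
    refine ⟨(finCongr hlen).trans (Equiv.ofBijective _ hbij), fun i => ?_, ?_, ?_, fun i j => ?_⟩
    · have hi := hye (finCongr hlen i)
      refine ⟨rfl, ?_, fun r => ?_⟩
      · simp only [List.get_eq_getElem, List.getElem_map]
        exact congrArg Prod.fst hi
      · simp only [List.get_eq_getElem, List.getElem_map]
        rw [show L[i.val].2 = (keyNum (y (finCongr hlen i)).2).val from congrArg Prod.snd hi]
        exact hlits _ _ r
    · have hpos : 0 < L.length := (List.getElem?_eq_some_iff.1 h0).1
      refine ⟨⟨0, by simpa using hpos⟩, rfl, ?_⟩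
      show absConfig (y ⟨0, hpos⟩).1 (y ⟨0, hpos⟩).2 = _
      rw [hy0 ⟨0, hpos⟩ _ h0]
      rfl
    · rintro ⟨i, j⟩ hk
      obtain ⟨_, _, -, hi, hj⟩ := (mem_edges_pairCode hs hL hmem).1 hk
      rw [hlen]
      exact ⟨(List.getElem?_eq_some_iff.1 hi).1, (List.getElem?_eq_some_iff.1 hj).1⟩
    · refine (mem_edges_pairCode hs hL hmem).trans ?_
      refine Iff.trans ?_ (keyAbs_step_iff hP (hy (finCongr hlen i)) (hy (finCongr hlen j))).symm
      constructor
      · rintro ⟨x, x', hx, hi, hj⟩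
        rwa [hy0 (finCongr hlen i) x hi, hy0 (finCongr hlen j) x' hj]
      · exact fun h => ⟨_, _, h, hyi (finCongr hlen i), hyi (finCongr hlen j)⟩

/-- Decidable properties of finite transition systems that are invariant under bisimulation are
decidable on coherent programs. -/
theorem exists_decidesCoherent (S : Sig) {Φ : ℕ → TS → Prop}
    (hΦ : ∀ k T T', Bisimilar T T' → (Φ k T ↔ Φ k T'))
    (hdec : ComputablePred fun x : ℕ × FinTS ℕ => Φ x.1 (finTS x.2)) :
    ∃ g, DecidesCoherent S g fun P k => Φ k (progTS P) := by
  obtain ⟨succs, F, hp, hF, hs, h⟩ := exists_reachable_list S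
  obtain ⟨d, hd, hdΦ⟩ := ComputablePred.computable_iff.1 hdec
  refine ⟨fun x => (F x.1).map fun L => d (x.2, L.map Prod.fst, 0, edges succs L), ?_, ?_⟩
  · refine Partrec.map (hF.comp Computable.fst) (hd.comp (Primrec.to_comp ?_))
    exact Primrec.pair (Primrec.snd.comp Primrec.fst) (Primrec.pair
      (Primrec.list_map Primrec.snd (Primrec.fst.comp Primrec.snd))
      (Primrec.pair (Primrec.const 0) ((primrec_edges hp).comp Primrec.snd)))
  · intro P hP k
    obtain ⟨L, hLF, hL, h0, hmem⟩ := h P hP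
    refine ⟨_, Part.mem_map _ hLF, ?_⟩
    have hd' := congrFun hdΦ (k, L.map Prod.fst, 0, edges succs L)
    rw [← eq_iff_iff.1 hd']
    have hlab : ∀ (x : Stmt S × Key S (Fin S.vars)) (i : ℕ), L[i]? = some (pairCode x) →
        (L.map Prod.fst).getD i 0 = x.1.code := by
      intro x i hi
      rw [List.getD_eq_getElem?_getD, List.getElem?_map, hi]
      rfl
    -- A configuration is related to the position of its statement and key in the list, so the
    -- finite system can be fed to the decision procedure without building literals.
    refine (hΦ k _ _ ⟨fun (c : Config S) (i : ℕ) => (progTS P).Reachable c ∧ L[i]? = some (pairCode (c.stmt, c.key)),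
      ⟨⟨.refl, h0⟩, ?_, ?_, ?_⟩⟩).symm
    · rintro c i ⟨-, hi⟩
      exact (hlab _ _ hi).symm
    · rintro c i ⟨hc, hi⟩ c' hcc'
      have hk := keyStep_of_step hP hc hcc'
      have hc' : (progTS P).Reachable c' := hc.tail hcc'
      obtain ⟨j, hj⟩ := List.mem_iff_getElem?.1
        ((hmem _).2 ⟨_, (keyReachable_iff hP).2 ⟨c', hc', rfl⟩, rfl⟩)
      exact ⟨j, (mem_edges_pairCode hs hL hmem).2 ⟨_, _, hk, hi, hj⟩, hc', hj⟩
    · rintro c i ⟨hc, hi⟩ j hij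
      obtain ⟨x, y, hxy, hx, hy⟩ := (mem_edges_pairCode hs hL hmem).1 hij
      rw [hi] at hx
      obtain rfl := pairCode_injective (Option.some.inj hx)
      obtain ⟨c', hc', rfl⟩ := step_of_keyStep hP hc hxy
      exact ⟨c', hc', hc.tail hc', hy⟩

end UP

/-! ### Invariance of the mu-calculus, fixed points on finite sets, and general recursion -/

namespace UP

/-! ### Invariance of the mu-calculus under bisimulation -/

theorem IsBisimulation.swap {T T' : TS} {ρ : T.State → T'.State → Prop}
    (h : IsBisimulation T T' ρ) : IsBisimulation T' T fun d c => ρ c d where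
  init := h.init
  label d c hr := (h.label c d hr).symm
  forth d c hr := h.back c d hr
  back d c hr := h.forth c d hr

/-- One implication suffices, since bisimulations can be reversed. In positive normal form the
fixed-point variables occur only positively, so it is enough that the environments are compatible
along `ρ` in one direction. -/
theorem IsBisimulation.mem_sem {T T' : TS} {ρ : T.State → T'.State → Prop}
    (h : IsBisimulation T T' ρ) {φ : Mu} {e : ℕ → Set T.State} {e' : ℕ → Set T'.State}
    (he : ∀ i c d, ρ c d → c ∈ e i → d ∈ e' i) {c : T.State} {d : T'.State} (hcd : ρ c d)
    (hc : c ∈ φ.sem T e) : d ∈ φ.sem T' e' := by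
  have hpush : ∀ {e e'}, (∀ i c d, ρ c d → c ∈ e i → d ∈ e' i) → ∀ A A',
      (∀ c d, ρ c d → c ∈ A → d ∈ A') → ∀ i c d, ρ c d → c ∈ push A e i → d ∈ push A' e' i := by
    intro e e' he A A' hA i
    cases i with
    | zero => exact hA
    | succ i => exact he i
  induction φ generalizing e e' c d with
  | atom k => exact (h.label c d hcd).symm.trans hc
  | natom k => exact fun hd => hc ((h.label c d hcd).trans hd)
  | var i => exact he i c d hcd hc
  | and φ ψ ih₁ ih₂ => exact ⟨ih₁ he hcd hc.1, ih₂ he hcd hc.2⟩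
  | or φ ψ ih₁ ih₂ => exact hc.imp (ih₁ he hcd) (ih₂ he hcd)
  | dia φ ih =>
    obtain ⟨c', hs, hc'⟩ := hc
    obtain ⟨d', hd', hr⟩ := h.forth c d hcd c' hs
    exact ⟨d', hd', ih he hr hc'⟩
  | box φ ih =>
    intro d' hd'
    obtain ⟨c', hs, hr⟩ := h.back c d hcd d' hd'
    exact ih he hr (hc c' hs)
  | mu φ ih =>
    intro A' hA'
    -- The largest set compatible with `A'` along `ρ` is a prefixed point on the other side.
    refine hc {x | ∀ y, ρ x y → y ∈ A'} ?_ d hcd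
    intro x hx y hxy
    exact hA' (ih (hpush he {x | ∀ y, ρ x y → y ∈ A'} A' fun _ _ hr hm => hm _ hr) hxy hx)
  | nu φ ih =>
    obtain ⟨A, hA, hcA⟩ := hc
    -- Dually, the image of a postfixed point under `ρ` is a postfixed point.
    refine ⟨{y | ∃ x ∈ A, ρ x y}, ?_, c, hcA, hcd⟩
    rintro y ⟨x, hx, hxy⟩
    exact ih (hpush he A {y | ∃ x ∈ A, ρ x y} fun x y hr hm => ⟨x, hm, hr⟩) hxy (hA hx)

theorem Bisimilar.satisfies_iff {T T' : TS} (h : Bisimilar T T') (φ : Mu) :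
    T.Satisfies φ ↔ T'.Satisfies φ := by
  obtain ⟨ρ, h⟩ := h
  exact ⟨h.mem_sem (fun _ _ _ _ hm => hm.elim) h.init,
    h.swap.mem_sem (fun _ _ _ _ hm => hm.elim) h.init⟩

/-- Monotonicity is the case of the identity bisimulation with different environments. -/
theorem Mu.sem_mono (T : TS) (φ : Mu) {e e' : ℕ → Set T.State} (h : ∀ i, e i ⊆ e' i) :
    φ.sem T e ⊆ φ.sem T e' := by
  have hb : IsBisimulation T T Eq :=
    ⟨rfl, fun _ _ h => by rw [h], fun c d h c' hc => ⟨c', h ▸ hc, rfl⟩,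
      fun c d h d' hd => ⟨d', h ▸ hd, rfl⟩⟩
  exact fun c hc => hb.mem_sem (fun i x y hxy hx => hxy ▸ h i hx) rfl hc

theorem push_mono {X : Type} {A B : Set X} (h : A ⊆ B) (e : ℕ → Set X) (i : ℕ) :
    push A e i ⊆ push B e i := by
  cases i with
  | zero => exact h
  | succ i => exact Set.Subset.rfl

/-! ### Fixed points on finite sets -/

/-- The iterates from `∅` increase and stay below every prefixed point. A strict increase adds an
element, so they are stationary after `Nat.card X` steps. -/
theorem iterate_empty_eq {X : Type} [Finite X] {F : Set X → Set X} (hF : Monotone F) :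
    F^[Nat.card X] ∅ = ⋂₀ {A | F A ⊆ A} := by
  have hmono : ∀ n, F^[n] ∅ ⊆ F^[n + 1] ∅ := by
    intro n
    induction n with
    | zero => exact Set.empty_subset _
    | succ n ih =>
      rw [Function.iterate_succ_apply', Function.iterate_succ_apply' F (n + 1)]
      exact hF ih
  -- Either every step so far was strict, and then the iterate has at least `n` elements, or the
  -- iteration has stopped.
  have hstep : ∀ n, n ≤ (F^[n] ∅).ncard ∨ F (F^[n] ∅) = F^[n] ∅ := by
    intro n
    induction n with
    | zero => exact Or.inl (Nat.zero_le _)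
    | succ n ih =>
      by_cases h : F (F^[n] ∅) = F^[n] ∅
      · right
        rw [Function.iterate_succ_apply', h, h]
      · left
        have h₁ := ih.resolve_right h
        have h₂ : F^[n] ∅ ⊂ F^[n + 1] ∅ := by
          refine (hmono n).ssubset_of_ne fun h' => h ?_
          rw [Function.iterate_succ_apply'] at h'
          exact h'.symm
        exact h₁.trans_lt (Set.ncard_lt_ncard h₂ (Set.toFinite _))
  have hfix : F (F^[Nat.card X] ∅) = F^[Nat.card X] ∅ := by
    obtain h | h := hstep (Nat.card X)
    · have hu : F^[Nat.card X] ∅ = Set.univ := by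
        refine Set.eq_of_subset_of_ncard_le (Set.subset_univ _) ?_ (Set.toFinite _)
        rwa [Set.ncard_univ]
      have h' := hmono (Nat.card X)
      rw [Function.iterate_succ_apply', hu] at h'
      rw [hu]
      exact Set.univ_subset_iff.1 h'
    · exact h
  refine Set.Subset.antisymm (Set.subset_sInter fun A hA => ?_) (Set.sInter_subset_of_mem hfix.le)
  have : ∀ n, F^[n] ∅ ⊆ A := by
    intro n
    induction n with
    | zero => exact Set.empty_subset _
    | succ n ih =>
      rw [Function.iterate_succ_apply']
      exact (hF ih).trans hA
  exact this _

/-- Dual to `iterate_empty_eq` under complements. -/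
theorem iterate_univ_eq {X : Type} [Finite X] {F : Set X → Set X} (hF : Monotone F) :
    F^[Nat.card X] Set.univ = ⋃₀ {A | A ⊆ F A} := by
  have hG : Monotone fun A => (F Aᶜ)ᶜ := fun A B h =>
    Set.compl_subset_compl.2 (hF (Set.compl_subset_compl.2 h))
  have hit : ∀ n, F^[n] Set.univ = ((fun A => (F Aᶜ)ᶜ)^[n] ∅)ᶜ := by
    intro n
    induction n with
    | zero => exact Set.compl_empty.symm
    | succ n ih => rw [Function.iterate_succ_apply', Function.iterate_succ_apply', ih, compl_compl]
  rw [hit, iterate_empty_eq hG]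
  ext x
  simp only [Set.mem_compl_iff, Set.mem_sInter, Set.mem_ofPred_eq, Set.mem_sUnion, not_forall]
  constructor
  · rintro ⟨A, hA, hx⟩
    exact ⟨Aᶜ, Set.compl_subset_comm.1 hA, hx⟩
  · rintro ⟨A, hA, hx⟩
    exact ⟨Aᶜ, by rw [compl_compl]; exact Set.compl_subset_compl.2 hA, fun h => h hx⟩

/-! ### General recursion -/

section

open Nat.Partrec (Code)

variable {α σ : Type} [Primcodable α] [Primcodable σ]

/-- The partial function from `α` to `σ` that a code computes. -/
def evalAs (α σ : Type) [Primcodable α] [Primcodable σ] (c : Code) (a : α) : Part σ :=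
  (c.eval (Encodable.encode a)).bind fun n => (Encodable.decode n : Option σ)

theorem partrec_evalAs : Partrec₂ (evalAs α σ) := by
  refine Partrec.bind (Nat.Partrec.Code.eval_part.comp Computable.fst
    (Computable.encode.comp Computable.snd)) ?_
  exact Computable.ofOption (Computable.decode.comp Computable.snd)

/-- Partial recursive functions can be defined by general recursion. -/
theorem exists_recursive {f : Code → α →. σ} (hf : Partrec₂ f) :
    ∃ c, ∀ a, evalAs α σ c a = f c a := by
  obtain ⟨c, hc⟩ := Nat.Partrec.Code.fixed_point₂
    (f := fun c n => (Part.ofOption (Encodable.decode n : Option α)).bind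
      fun a => (f c a).map Encodable.encode) (by
    refine Partrec.bind (Computable.ofOption (Computable.decode.comp Computable.snd)) ?_
    exact Partrec.map (hf.comp (Computable.fst.comp Computable.fst) Computable.snd)
      (Computable.encode.comp Computable.snd))
  refine ⟨c, fun a => ?_⟩
  rw [evalAs, hc]
  simp [Part.bind_map]

end

end UP

/-! ### Model checking of finite transition systems -/

namespace UP

/-! ### Numbers of formulas -/

/-- One level of the recursion that recognizes the numbers of formulas. -/
def isFormulaAux (L : List Bool) : Bool :=
  let k := L.length.unpair.1
  let m := L.length.unpair.2
  if k < 3 then true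
  else if k < 5 then L.getD m.unpair.1 false && L.getD m.unpair.2 false
  else if k < 9 then L.getD m false
  else false

theorem primrec_isFormulaAux : Primrec isFormulaAux := by
  have hk : Primrec fun L : List Bool => L.length.unpair.1 :=
    primrec_unpair_fst.comp Primrec.list_length
  have hm : Primrec fun L : List Bool => L.length.unpair.2 :=
    primrec_unpair_snd.comp Primrec.list_length
  have hlt : ∀ n, PrimrecPred fun L : List Bool => L.length.unpair.1 < n :=
    fun n => PrimrecRel.comp Primrec.nat_lt hk (Primrec.const n)
  have hget : ∀ {f : List Bool → ℕ}, Primrec f → Primrec fun L : List Bool => L.getD (f L) false :=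
    fun hf => (Primrec.list_getD false).comp Primrec.id hf
  exact Primrec.ite (hlt 3) (Primrec.const true) (Primrec.ite (hlt 5)
    (Primrec.and.comp (hget (primrec_unpair_fst.comp hm)) (hget (primrec_unpair_snd.comp hm)))
    (Primrec.ite (hlt 9) (hget hm) (Primrec.const false)))

/-- Needed because the evaluator is meaningful only on numbers of formulas. Tags above `2` strictly
increase the pair, so the components are smaller numbers. -/
theorem exists_isFormula : ∃ v : ℕ → Bool, Primrec v ∧ ∀ n, v n = true ↔ ∃ φ : Mu, φ.code = n := by
  obtain ⟨v, hv, h⟩ := exists_strongRec (α := Unit) (g := fun _ L => isFormulaAux L)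
    (primrec_isFormulaAux.comp₂ Primrec₂.right)
  have hrec : ∀ k m, v () (Nat.pair k m) = if k < 3 then true
      else if k < 5 then v () m.unpair.1 && v () m.unpair.2
      else if k < 9 then v () m else false := by
    intro k m
    rw [h]
    simp only [isFormulaAux, List.length_map, List.length_range, Nat.unpair_pair]
    split_ifs with h₁ h₂ h₃
    · rfl
    · have := snd_lt_pair (a := k) (b := m) (by omega)
      rw [getD_map_range ((Nat.unpair_left_le m).trans_lt this),
        getD_map_range ((Nat.unpair_right_le m).trans_lt this)]
    · rw [getD_map_range (snd_lt_pair (by omega))]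
    · rfl
  refine ⟨v (), hv.comp (Primrec.const ()) Primrec.id, fun n => ⟨?_, ?_⟩⟩
  · induction n using Nat.strong_induction_on with
    | _ n ih =>
      obtain ⟨k, m, rfl⟩ : ∃ k m, n = Nat.pair k m := ⟨_, _, (Nat.pair_unpair n).symm⟩
      intro hn
      rw [hrec] at hn
      split_ifs at hn with h₁ h₂ h₃
      · interval_cases k
        exacts [⟨.atom m, rfl⟩, ⟨.natom m, rfl⟩, ⟨.var m, rfl⟩]
      · have := snd_lt_pair (a := k) (b := m) (by omega)
        rw [Bool.and_eq_true] at hn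
        obtain ⟨φ, hφ⟩ := ih _ ((Nat.unpair_left_le m).trans_lt this) hn.1
        obtain ⟨ψ, hψ⟩ := ih _ ((Nat.unpair_right_le m).trans_lt this) hn.2
        have hm : m = Nat.pair φ.code ψ.code := by rw [hφ, hψ, Nat.pair_unpair]
        rw [hm]
        obtain rfl | rfl : k = 3 ∨ k = 4 := by omega
        exacts [⟨.and φ ψ, rfl⟩, ⟨.or φ ψ, rfl⟩]
      · obtain ⟨φ, rfl⟩ := ih _ (snd_lt_pair (by omega)) hn
        obtain rfl | rfl | rfl | rfl : k = 5 ∨ k = 6 ∨ k = 7 ∨ k = 8 := by omega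
        exacts [⟨.dia φ, rfl⟩, ⟨.box φ, rfl⟩, ⟨.mu φ, rfl⟩, ⟨.nu φ, rfl⟩]
  · rintro ⟨φ, rfl⟩
    induction φ <;> simp_all [Mu.code]

/-! ### Model checking of finite transition systems -/

/-- A bound for the states that occur in a finite transition system. -/
def size (D : FinTS ℕ) : ℕ := D.2.2.foldl (fun n p => n + (p.1 + p.2)) (D.2.1 + 1)

theorem primrec_size : Primrec size := by
  refine Primrec.list_foldl (Primrec.snd.comp Primrec.snd)
    (Primrec.nat_add.comp (Primrec.fst.comp Primrec.snd) (Primrec.const 1))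
    (h := fun _ (p : ℕ × ℕ × ℕ) => p.1 + (p.2.1 + p.2.2)) ?_
  have h : Primrec fun x : FinTS ℕ × ℕ × ℕ × ℕ => x.2 := Primrec.snd
  exact Primrec.nat_add.comp (Primrec.fst.comp h) (Primrec.nat_add.comp
    (Primrec.fst.comp (Primrec.snd.comp h)) (Primrec.snd.comp (Primrec.snd.comp h)))

theorem le_foldl_add {L : List (ℕ × ℕ)} {n : ℕ} :
    n ≤ L.foldl (fun n p => n + (p.1 + p.2)) n ∧
      ∀ p ∈ L, n + p.2 ≤ L.foldl (fun n p => n + (p.1 + p.2)) n := by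
  induction L generalizing n with
  | nil => simp
  | cons p L ih =>
    obtain ⟨h₁, h₂⟩ := ih (n := n + (p.1 + p.2))
    refine ⟨by simp only [List.foldl_cons]; omega, ?_⟩
    intro p' hp
    simp only [List.foldl_cons]
    obtain rfl | hp := List.mem_cons.1 hp
    · omega
    · have := h₂ p' hp
      omega

theorem init_lt_size (D : FinTS ℕ) : D.2.1 < size D := le_foldl_add.1

theorem lt_size {D : FinTS ℕ} {p : ℕ × ℕ} (h : p ∈ D.2.2) : p.2 < size D := by
  have := (le_foldl_add (n := D.2.1 + 1)).2 p h
  unfold size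
  omega

/-- The finite transition system with finitely many states. -/
def boundTS (D : FinTS ℕ) : TS where
  State := Fin (size D)
  init := ⟨D.2.1, init_lt_size D⟩
  step i j := (i.val, j.val) ∈ D.2.2
  label i := D.1.getD i.val 0

/-- `finTS` has all natural numbers as states. The initial state and all targets of transitions lie
below `size D`, so the remaining states can be dropped. -/
theorem bisimilar_boundTS (D : FinTS ℕ) : Bisimilar (finTS D) (boundTS D) := by
  refine ⟨fun (i : ℕ) (j : Fin (size D)) => i = j.val, ⟨rfl, ?_, ?_, ?_⟩⟩
  · rintro _ j rfl
    rfl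
  · rintro _ j rfl i' h
    exact ⟨⟨i', lt_size h⟩, h, rfl⟩
  · rintro _ j rfl j' h
    exact ⟨j'.val, h, rfl⟩

/-- A formula and an environment, given by numbers, with a transition system. -/
abbrev EvalInput : Type := (ℕ × List (List ℕ)) × FinTS ℕ

/-- The meaning of a formula that is not a fixed point, given the meanings of the subformulas. -/
def Holds (y : EvalInput × List ℕ × List ℕ) (i : ℕ) : Prop :=
  let k := y.1.1.1.unpair.1
  let m := y.1.1.1.unpair.2
  (k = 0 ∧ y.1.2.1.getD i 0 = m) ∨ (k = 1 ∧ ¬ y.1.2.1.getD i 0 = m) ∨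
  (k = 2 ∧ i ∈ y.1.1.2.getD m []) ∨ (k = 3 ∧ i ∈ y.2.1 ∧ i ∈ y.2.2) ∨
  (k = 4 ∧ (i ∈ y.2.1 ∨ i ∈ y.2.2)) ∨ (k = 5 ∧ ∃ t ∈ y.1.2.2.2, t.1 = i ∧ t.2 ∈ y.2.1) ∨
  (k = 6 ∧ ∀ t ∈ y.1.2.2.2, t.1 = i → t.2 ∈ y.2.1)

instance : DecidableRel Holds := fun y i => by
  unfold Holds
  infer_instance

theorem primrecRel_holds : PrimrecRel Holds := by
  have hy : Primrec fun z : (EvalInput × List ℕ × List ℕ) × ℕ => z.1.1 :=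
    Primrec.fst.comp Primrec.fst
  have hi : Primrec fun z : (EvalInput × List ℕ × List ℕ) × ℕ => z.2 := Primrec.snd
  have hr₁ : Primrec fun z : (EvalInput × List ℕ × List ℕ) × ℕ => z.1.2.1 :=
    Primrec.fst.comp (Primrec.snd.comp Primrec.fst)
  have hr₂ : Primrec fun z : (EvalInput × List ℕ × List ℕ) × ℕ => z.1.2.2 :=
    Primrec.snd.comp (Primrec.snd.comp Primrec.fst)
  have hn : Primrec fun z : (EvalInput × List ℕ × List ℕ) × ℕ => z.1.1.1.1 :=
    Primrec.fst.comp (Primrec.fst.comp hy)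
  have he : Primrec fun z : (EvalInput × List ℕ × List ℕ) × ℕ => z.1.1.1.2 :=
    Primrec.snd.comp (Primrec.fst.comp hy)
  have hD : Primrec fun z : (EvalInput × List ℕ × List ℕ) × ℕ => z.1.1.2 := Primrec.snd.comp hy
  have hT : Primrec fun z : (EvalInput × List ℕ × List ℕ) × ℕ => z.1.1.2.2.2 :=
    Primrec.snd.comp (Primrec.snd.comp hD)
  have hm := primrec_unpair_snd.comp hn
  have hk : ∀ j : ℕ, PrimrecPred fun z : (EvalInput × List ℕ × List ℕ) × ℕ =>
      z.1.1.1.1.unpair.1 = j :=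
    fun j => PrimrecRel.comp Primrec.eq (primrec_unpair_fst.comp hn) (Primrec.const j)
  have hlab : PrimrecPred fun z : (EvalInput × List ℕ × List ℕ) × ℕ =>
      z.1.1.2.1.getD z.2 0 = z.1.1.1.1.unpair.2 :=
    PrimrecRel.comp Primrec.eq ((Primrec.list_getD 0).comp (Primrec.fst.comp hD) hi) hm
  have hmem₁ := primrecPred_mem_list hi hr₁
  have hmem₂ := primrecPred_mem_list hi hr₂
  have hq : PrimrecPred fun p : (ℕ × ℕ) × (EvalInput × List ℕ × List ℕ) × ℕ => p.1.1 = p.2.2 :=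
    PrimrecRel.comp Primrec.eq (Primrec.fst.comp Primrec.fst) (hi.comp Primrec.snd)
  have hq' : PrimrecPred fun p : (ℕ × ℕ) × (EvalInput × List ℕ × List ℕ) × ℕ =>
      p.1.2 ∈ p.2.1.2.1 :=
    primrecPred_mem_list (Primrec.snd.comp Primrec.fst) (hr₁.comp Primrec.snd)
  have hdia : PrimrecPred fun z : (EvalInput × List ℕ × List ℕ) × ℕ =>
      ∃ t ∈ z.1.1.2.2.2, t.1 = z.2 ∧ t.2 ∈ z.1.2.1 :=
    PrimrecRel.comp (PrimrecRel.exists_mem_list (hq.and hq').primrecRel) hT Primrec.id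
  have hbox : PrimrecPred fun z : (EvalInput × List ℕ × List ℕ) × ℕ =>
      ∀ t ∈ z.1.1.2.2.2, t.1 = z.2 → t.2 ∈ z.1.2.1 := by
    refine (PrimrecRel.comp (PrimrecRel.forall_mem_list (hq.not.or hq').primrecRel) hT
      Primrec.id).of_eq fun z => ?_
    simp only [imp_iff_not_or]
    rfl
  exact ((hk 0).and hlab).or (((hk 1).and hlab.not).or (((hk 2).and
    (primrecPred_mem_list hi ((Primrec.list_getD []).comp he hm))).or
    (((hk 3).and (hmem₁.and hmem₂)).or (((hk 4).and (hmem₁.or hmem₂)).or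
    (((hk 5).and hdia).or ((hk 6).and hbox))))))

/-- The states that satisfy a formula that is not a fixed point. -/
def combine (y : EvalInput × List ℕ × List ℕ) : List ℕ :=
  (List.range (size y.1.2)).filter fun i => Holds y i

theorem primrec_combine : Primrec combine :=
  primrec_filter primrecRel_holds
    (Primrec.list_range.comp (primrec_size.comp (Primrec.snd.comp Primrec.fst)))

/-- The first subformula, in its environment. -/
def leftInput (x : EvalInput) : EvalInput :=
  ((if x.1.1.unpair.1 < 5 then x.1.1.unpair.2.unpair.1 else x.1.1.unpair.2, x.1.2), x.2)

/-- The last subformula, in its environment. -/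
def rightInput (x : EvalInput) : EvalInput :=
  ((if x.1.1.unpair.1 < 5 then x.1.1.unpair.2.unpair.2 else x.1.1.unpair.2, x.1.2), x.2)

/-- The body of a fixed-point formula, in its environment. -/
def bodyInput (x : EvalInput) (X : List ℕ) : EvalInput :=
  ((x.1.1.unpair.2, X :: x.1.2), x.2)

/-- The start of the iteration for a fixed-point formula. -/
def startSet (x : EvalInput) : List ℕ :=
  if x.1.1.unpair.1 = 7 then [] else List.range (size x.2)

theorem primrec_tag : Primrec fun x : EvalInput => x.1.1.unpair.1 :=
  primrec_unpair_fst.comp (Primrec.fst.comp Primrec.fst)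

theorem primrec_arg : Primrec fun x : EvalInput => x.1.1.unpair.2 :=
  primrec_unpair_snd.comp (Primrec.fst.comp Primrec.fst)

theorem primrecPred_tag_lt (n : ℕ) : PrimrecPred fun x : EvalInput => x.1.1.unpair.1 < n :=
  PrimrecRel.comp Primrec.nat_lt primrec_tag (Primrec.const n)

theorem primrec_leftInput : Primrec leftInput :=
  Primrec.pair (Primrec.pair (Primrec.ite (primrecPred_tag_lt 5)
    (primrec_unpair_fst.comp primrec_arg) primrec_arg) (Primrec.snd.comp Primrec.fst)) Primrec.snd

theorem primrec_rightInput : Primrec rightInput :=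
  Primrec.pair (Primrec.pair (Primrec.ite (primrecPred_tag_lt 5)
    (primrec_unpair_snd.comp primrec_arg) primrec_arg) (Primrec.snd.comp Primrec.fst)) Primrec.snd

theorem primrec_bodyInput : Primrec₂ bodyInput :=
  Primrec.pair (Primrec.pair (primrec_arg.comp Primrec.fst) (Primrec.list_cons.comp Primrec.snd
    (Primrec.snd.comp (Primrec.fst.comp Primrec.fst)))) (Primrec.snd.comp Primrec.fst)

theorem primrec_startSet : Primrec startSet :=
  Primrec.ite (PrimrecRel.comp Primrec.eq primrec_tag (Primrec.const 7)) (Primrec.const [])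
    (Primrec.list_range.comp (primrec_size.comp Primrec.snd))

/-- Evaluation of a formula, where `ev` evaluates the subformulas. -/
def evalStep (ev : EvalInput → Part (List ℕ)) (x : EvalInput) : Part (List ℕ) :=
  bif decide (x.1.1.unpair.1 < 3) then Part.some (combine (x, [], []))
  else bif decide (x.1.1.unpair.1 < 7) then
    (ev (leftInput x)).bind fun r₁ => (ev (rightInput x)).map fun r₂ => combine (x, r₁, r₂)
  else (size x.2).rec (Part.some (startSet x)) fun _ X => X.bind fun X => ev (bodyInput x X)

theorem partrec_evalStep : Partrec₂ fun (c : Nat.Partrec.Code) (x : EvalInput) =>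
    evalStep (evalAs EvalInput (List ℕ) c) x := by
  have hbase : Partrec fun z : Nat.Partrec.Code × EvalInput =>
      Part.some (combine (z.2, [], [])) :=
    (primrec_combine.comp (Primrec.pair Primrec.snd
      (Primrec.const (([] : List ℕ), ([] : List ℕ))))).to_comp.partrec
  have hleft : Partrec fun z : Nat.Partrec.Code × EvalInput =>
      evalAs EvalInput (List ℕ) z.1 (leftInput z.2) :=
    partrec_evalAs.comp Computable.fst (primrec_leftInput.to_comp.comp Computable.snd)
  have hright : Partrec fun z : Nat.Partrec.Code × EvalInput =>
      evalAs EvalInput (List ℕ) z.1 (rightInput z.2) :=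
    partrec_evalAs.comp Computable.fst (primrec_rightInput.to_comp.comp Computable.snd)
  have hcomb : Computable₂ fun (w : (Nat.Partrec.Code × EvalInput) × List ℕ) (r : List ℕ) =>
      combine (w.1.2, w.2, r) :=
    (primrec_combine.comp (Primrec.pair (Primrec.snd.comp (Primrec.fst.comp Primrec.fst))
      (Primrec.pair (Primrec.snd.comp Primrec.fst) Primrec.snd))).to_comp
  have hbin : Partrec fun z : Nat.Partrec.Code × EvalInput =>
      (evalAs EvalInput (List ℕ) z.1 (leftInput z.2)).bind fun r₁ =>
        (evalAs EvalInput (List ℕ) z.1 (rightInput z.2)).map fun r₂ => combine (z.2, r₁, r₂) :=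
    Partrec.bind hleft (Partrec.map (hright.comp Computable.fst) hcomb)
  have hbody : Partrec₂ fun (z : Nat.Partrec.Code × EvalInput) (p : ℕ × List ℕ) =>
      evalAs EvalInput (List ℕ) z.1 (bodyInput z.2 p.2) :=
    partrec_evalAs.comp (Computable.fst.comp Computable.fst)
      (primrec_bodyInput.to_comp.comp (Computable.snd.comp Computable.fst)
        (Computable.snd.comp Computable.snd))
  have hfix := Partrec.nat_rec (primrec_size.comp (Primrec.snd.comp
    (Primrec.snd (α := Nat.Partrec.Code) (β := EvalInput)))).to_comp
    (primrec_startSet.comp Primrec.snd).to_comp.partrec hbody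
  exact Partrec.cond ((primrecPred_tag_lt 3).decide.comp Primrec.snd).to_comp hbase
    (Partrec.cond ((primrecPred_tag_lt 7).decide.comp Primrec.snd).to_comp hbin hfix)

/-- The set of states in a list. -/
def listSet (D : FinTS ℕ) (X : List ℕ) : Set (boundTS D).State :=
  {i : Fin (size D) | i.val ∈ X}

/-- The environment given by lists of states. -/
def listEnv (D : FinTS ℕ) (e : List (List ℕ)) (j : ℕ) : Set (boundTS D).State :=
  listSet D (e.getD j [])

theorem push_listEnv (D : FinTS ℕ) (X : List ℕ) (e : List (List ℕ)) :
    push (listSet D X) (listEnv D e) = listEnv D (X :: e) := by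
  funext j
  cases j <;> rfl

theorem listSet_nil (D : FinTS ℕ) : listSet D [] = ∅ :=
  Set.eq_empty_of_forall_notMem fun _ h => List.not_mem_nil h

theorem listEnv_nil (D : FinTS ℕ) : listEnv D [] = fun _ => ∅ := funext fun _ => listSet_nil D

theorem mem_combine {e : List (List ℕ)} {m : ℕ} {D : FinTS ℕ} {r₁ r₂ : List ℕ} {i : Fin (size D)} :
    i ∈ listSet D (combine (((m, e), D), r₁, r₂)) ↔ Holds (((m, e), D), r₁, r₂) i.val := by
  show i.val ∈ combine _ ↔ _
  simp [combine]

section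

variable {D : FinTS ℕ}

/-- The list computed for a formula is the set of states that satisfy it. -/
def Correct (ev : EvalInput → Part (List ℕ)) (D : FinTS ℕ) (φ : Mu) (e : List (List ℕ)) : Prop :=
  ∃ X ∈ ev ((φ.code, e), D), listSet D X = φ.sem (boundTS D) (listEnv D e)

/-- The iteration on lists computes the iteration on sets, as extending the list of the environment
is `push`. -/
theorem exists_iterate {ev : EvalInput → Part (List ℕ)} {φ : Mu} (ih : ∀ e, Correct ev D φ e)
    (e : List (List ℕ)) (X₀ : List ℕ) (n : ℕ) :
    ∃ X ∈ (n.rec (Part.some X₀) fun _ X => X.bind fun X => ev ((φ.code, X :: e), D) :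
      Part (List ℕ)), listSet D X =
        (fun A => φ.sem (boundTS D) (push A (listEnv D e)))^[n] (listSet D X₀) := by
  induction n with
  | zero => exact ⟨X₀, Part.mem_some _, rfl⟩
  | succ n ihn =>
    obtain ⟨X, hX, hs⟩ := ihn
    obtain ⟨Y, hY, hi⟩ := ih (X :: e)
    refine ⟨Y, Part.mem_bind hX hY, ?_⟩
    rw [Function.iterate_succ_apply', ← hs, push_listEnv, hi]

instance : Finite (boundTS D).State := inferInstanceAs (Finite (Fin (size D)))

theorem card_boundTS : Nat.card (boundTS D).State = size D := Nat.card_fin (size D)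

theorem monotone_sem (φ : Mu) (e : ℕ → Set (boundTS D).State) :
    Monotone fun A => φ.sem (boundTS D) (push A e) :=
  fun _ _ h => φ.sem_mono (boundTS D) (push_mono h e)

/-- Only the recursive equation for `ev` is given; that the evaluation halts is proved together with
its correctness, by induction on the formula. A fixed point takes `size D` rounds, the number of
states of `boundTS D`. -/
theorem eval_spec {ev : EvalInput → Part (List ℕ)} (hev : ∀ x, ev x = evalStep ev x) (φ : Mu)
    (e : List (List ℕ)) : Correct ev D φ e := by
  induction φ generalizing e with
  | atom k =>
    refine ⟨combine (((Mu.code (.atom k), e), D), [], []), ?_, Set.ext fun i => mem_combine.trans ?_⟩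
    · rw [hev]
      simp [evalStep, Mu.code]
    · refine Iff.trans ?_ (Iff.rfl : D.1.getD (Fin.val i) 0 = k ↔ _)
      simp [Holds, Mu.code]
  | natom k =>
    refine ⟨combine (((Mu.code (.natom k), e), D), [], []), ?_,
      Set.ext fun i => mem_combine.trans ?_⟩
    · rw [hev]
      simp [evalStep, Mu.code]
    · refine Iff.trans ?_ (Iff.rfl : ¬ D.1.getD (Fin.val i) 0 = k ↔ _)
      simp [Holds, Mu.code]
  | var j =>
    refine ⟨combine (((Mu.code (.var j), e), D), [], []), ?_, Set.ext fun i => mem_combine.trans ?_⟩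
    · rw [hev]
      simp [evalStep, Mu.code]
    · refine Iff.trans ?_ (Iff.rfl : Fin.val i ∈ e.getD j [] ↔ _)
      simp [Holds, Mu.code]
  | and φ ψ ih₁ ih₂ =>
    obtain ⟨r₁, h₁, h₁'⟩ := ih₁ e
    obtain ⟨r₂, h₂, h₂'⟩ := ih₂ e
    refine ⟨combine (((Mu.code (.and φ ψ), e), D), r₁, r₂), ?_,
      Set.ext fun i => mem_combine.trans ?_⟩
    · rw [hev]
      simp [evalStep, leftInput, rightInput, Mu.code]
      exact ⟨r₁, h₁, r₂, h₂, rfl⟩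
    · rw [Mu.sem, ← h₁', ← h₂']
      refine Iff.trans ?_ (Iff.rfl : Fin.val i ∈ r₁ ∧ Fin.val i ∈ r₂ ↔ _)
      simp [Holds, Mu.code]
  | or φ ψ ih₁ ih₂ =>
    obtain ⟨r₁, h₁, h₁'⟩ := ih₁ e
    obtain ⟨r₂, h₂, h₂'⟩ := ih₂ e
    refine ⟨combine (((Mu.code (.or φ ψ), e), D), r₁, r₂), ?_,
      Set.ext fun i => mem_combine.trans ?_⟩
    · rw [hev]
      simp [evalStep, leftInput, rightInput, Mu.code]
      exact ⟨r₁, h₁, r₂, h₂, rfl⟩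
    · rw [Mu.sem, ← h₁', ← h₂']
      refine Iff.trans ?_ (Iff.rfl : Fin.val i ∈ r₁ ∨ Fin.val i ∈ r₂ ↔ _)
      simp [Holds, Mu.code]
  | dia φ ih =>
    obtain ⟨r, h, h'⟩ := ih e
    -- For a modality, the left and the right input are the same subformula, so its result is passed
    -- twice.
    refine ⟨combine (((Mu.code (.dia φ), e), D), r, r), ?_, Set.ext fun i => mem_combine.trans ?_⟩
    · rw [hev]
      simp [evalStep, leftInput, rightInput, Mu.code]
      exact ⟨r, h, r, h, rfl⟩
    · rw [Mu.sem, ← h']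
      refine Iff.trans ?_
        (Iff.rfl : (∃ j : Fin (size D), (Fin.val i, j.val) ∈ D.2.2 ∧ j.val ∈ r) ↔ _)
      refine Iff.trans (b := ∃ t ∈ D.2.2, t.1 = Fin.val i ∧ t.2 ∈ r) (by simp [Holds, Mu.code]) ?_
      constructor
      · rintro ⟨⟨_, j⟩, hj, rfl, hjr⟩
        exact ⟨⟨j, lt_size hj⟩, hj, hjr⟩
      · rintro ⟨j, hj, hjr⟩
        exact ⟨_, hj, rfl, hjr⟩
  | box φ ih =>
    obtain ⟨r, h, h'⟩ := ih e
    refine ⟨combine (((Mu.code (.box φ), e), D), r, r), ?_, Set.ext fun i => mem_combine.trans ?_⟩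
    · rw [hev]
      simp [evalStep, leftInput, rightInput, Mu.code]
      exact ⟨r, h, r, h, rfl⟩
    · rw [Mu.sem, ← h']
      refine Iff.trans ?_
        (Iff.rfl : (∀ j : Fin (size D), (Fin.val i, j.val) ∈ D.2.2 → j.val ∈ r) ↔ _)
      refine Iff.trans (b := ∀ t ∈ D.2.2, t.1 = Fin.val i → t.2 ∈ r) (by simp [Holds, Mu.code]) ?_
      constructor
      · exact fun hall j hj => hall _ hj rfl
      · rintro hall ⟨_, j⟩ hj rfl
        exact hall ⟨j, lt_size hj⟩ hj
  | mu φ ih =>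
    obtain ⟨X, hX, hs⟩ := exists_iterate ih e [] (size D)
    refine ⟨X, ?_, ?_⟩
    · rw [hev]
      simpa [evalStep, bodyInput, startSet, Mu.code] using hX
    · have h := iterate_empty_eq (monotone_sem φ (listEnv D e))
      rw [card_boundTS] at h
      rw [hs, listSet_nil, h]
      rfl
  | nu φ ih =>
    obtain ⟨X, hX, hs⟩ := exists_iterate ih e (List.range (size D)) (size D)
    refine ⟨X, ?_, ?_⟩
    · rw [hev]
      simpa [evalStep, bodyInput, startSet, Mu.code] using hX
    · have h := iterate_univ_eq (monotone_sem φ (listEnv D e))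
      rw [card_boundTS] at h
      have h₀ : listSet D (List.range (size D)) = Set.univ :=
        Set.eq_univ_of_forall fun i => List.mem_range.2 (Fin.isLt i)
      rw [hs, h₀, h]
      rfl

end

/-- Model checking of finite transition systems is decidable. -/
theorem computablePred_satisfies :
    ComputablePred fun x : ℕ × FinTS ℕ => ∃ φ : Mu, φ.code = x.1 ∧ (finTS x.2).Satisfies φ := by
  classical
  obtain ⟨v, hv, hvs⟩ := exists_isFormula
  obtain ⟨c, hc⟩ := exists_recursive partrec_evalStep
  have hmem : Primrec₂ fun (x : ℕ × FinTS ℕ) (X : List ℕ) => decide (x.2.2.1 ∈ X) :=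
    (primrecPred_mem_list (Primrec.fst.comp (Primrec.snd.comp (Primrec.snd.comp Primrec.fst)))
      Primrec.snd).decide
  -- The evaluator is run only on numbers of formulas; for other numbers the answer is `false`.
  have hp : Partrec fun x : ℕ × FinTS ℕ => bif v x.1 then
      (evalAs EvalInput (List ℕ) c ((x.1, []), x.2)).map fun X => decide (x.2.2.1 ∈ X)
      else Part.some false := by
    refine Partrec.cond (hv.comp Primrec.fst).to_comp (Partrec.map ?_ hmem.to_comp)
      (Computable.const false).partrec
    exact partrec_evalAs.comp (Computable.const c) (Primrec.to_comp
      (Primrec.pair (Primrec.pair Primrec.fst (Primrec.const [])) Primrec.snd))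
  refine ⟨inferInstance, hp.of_eq fun x => ?_⟩
  have hspec : ∀ φ : Mu, φ.code = x.1 → ∀ X ∈ evalAs EvalInput (List ℕ) c ((x.1, []), x.2),
      (x.2.2.1 ∈ X ↔ (finTS x.2).Satisfies φ) := by
    intro φ hφ X hX
    obtain ⟨Y, hY, hYs⟩ := eval_spec hc φ [] (D := x.2)
    rw [hφ] at hY
    rw [Part.mem_unique hX hY, (bisimilar_boundTS x.2).satisfies_iff φ]
    rw [listEnv_nil] at hYs
    exact Set.ext_iff.1 hYs (boundTS x.2).init
  by_cases hx : ∃ φ : Mu, φ.code = x.1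
  · rw [(hvs _).2 hx]
    obtain ⟨φ, hφ⟩ := hx
    obtain ⟨X, hX, -⟩ := eval_spec hc φ [] (D := x.2)
    rw [hφ] at hX
    have h : x.2.2.1 ∈ X ↔ ∃ φ : Mu, φ.code = x.1 ∧ (finTS x.2).Satisfies φ :=
      ⟨fun h => ⟨φ, hφ, (hspec φ hφ X hX).1 h⟩, fun ⟨ψ, hψ, h⟩ => (hspec ψ hψ X hX).2 h⟩
    rw [Part.eq_some_iff.2 hX]
    simp [h]
  · have hvx : v x.1 = false := by
      rw [← Bool.not_eq_true, hvs]
      exact hx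
    rw [hvx]
    have : ¬ ∃ φ : Mu, φ.code = x.1 ∧ (finTS x.2).Satisfies φ := fun ⟨φ, h, _⟩ => hx ⟨φ, h⟩
    simp [this]

end UP

theorem mainTheorem4 (S : UP.Sig) :
    -- the abstract transition system of a coherent program is finite and bisimilar to it,
    -- whichever bases the abstraction uses
    (∀ P : UP.Stmt S, UP.Coherent P →
      ∀ α : UP.Config S → UP.Config S, UP.IsAbstraction P α →
        {a | (UP.absTS P α).Reachable a}.Finite ∧
        ∃ ρ : UP.Config S → UP.Config S → Prop,
          UP.IsBisimulation (UP.progTS P) (UP.absTS P α) ρ ∧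
          ∀ c, (UP.progTS P).Reachable c → ρ c (α c)) ∧
    -- it is computable from the program, for a suitable choice of the bases
    (∃ α : UP.Config S → UP.Config S,
      (∀ P : UP.Stmt S, UP.Coherent P → UP.IsAbstraction P α) ∧
      ∃ F : ℕ →. UP.FinTS (ℕ × List ℕ), Partrec F ∧
        ∀ P : UP.Stmt S, UP.Coherent P → ∃ D ∈ F P.code, UP.Lists D P α) ∧
    -- every family of bisimulation-invariant properties that is decidable on finite transition
    -- systems is decidable on coherent programs
    (∀ Φ : ℕ → UP.TS → Prop,
      (∀ k T T', UP.Bisimilar T T' → (Φ k T ↔ Φ k T')) →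
      ComputablePred (fun x : ℕ × UP.FinTS ℕ => Φ x.1 (UP.finTS x.2)) →
      ∃ g, UP.DecidesCoherent S g (fun P k => Φ k (UP.progTS P))) ∧
    -- in particular, model checking of temporal logic is decidable on coherent programs
    (∃ g, UP.DecidesCoherent S g
      (fun P k => ∃ φ : UP.Mu, φ.code = k ∧ (UP.progTS P).Satisfies φ)) := by
  refine ⟨fun P hP α hα => ⟨hα.finite, UP.SameKey P α, hα.isBisimulation hP,
    fun c hc => UP.sameKey_self hc⟩, ⟨UP.keyAbs, fun P _ => UP.keyAbs_isAbstraction P,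
    UP.exists_lists S⟩, fun Φ hΦ hdec => UP.exists_decidesCoherent S hΦ hdec, ?_⟩
  -- Formulas enter through their numbers; for a number of no formula, the property is false in
  -- every system, so it is still invariant.
  exact UP.exists_decidesCoherent S (Φ := fun k T => ∃ φ : UP.Mu, φ.code = k ∧ T.Satisfies φ)
    (fun k T T' h => exists_congr fun φ => and_congr_right fun _ => h.satisfies_iff φ)
    UP.computablePred_satisfies
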